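/- Let $n\ge 1$ and $r\ge 2$, and let $M$ be a compact $n$-dimensional smooth manifold with an equiaffine structure $(\nabla,\theta)$: $\nabla$ is a torsion-free affine connection and $\theta$ a nowhere vanishing volume form (which orients $M$) with $\nabla\theta=0$. Let $V$ be a real vector space of dimension $m=n+r$ with a nonzero volume form $\omega$, considered as an affine space with its flat connection $\tilde\nabla$. **Equiaffine immersions.** A pair $(N,\theta^\perp)$ for an immersion $f:M\to V$ consists of a smooth rank $r$ subbundle $N\subset M\times V$ with $V=df(T_pM)\oplus N_p$ for all $p$ and a nowhere vanishing volume form $\theta^\perp$ on $N$. It induces $(\nabla,\theta)$ if $\tilde\nabla_X df(Y)=df(\nabla_XY)+\alpha(X,Y)$ with $\alpha(X,Y)\in N$ for all vector fields $X,Y$, and $\theta(X_1,\dots,X_n)=\omega(df(X_1),\dots,df(X_n),\xi_1,\dots,\xi_r)/\theta^\perp(\xi_1,\dots,\xi_r)$ for every frame $\xi_1,\dots,\xi_r$ of $N$. The map $f:(M,\nabla,\theta)\to(V,\tilde\nabla,\omega)$ is an equiaffine immersion if such a pair inducing $(\nabla,\theta)$ exists. The same definitions apply to maps into an affine space with translation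 space $V$. **Unit ellipsoids.** Let $\omega'$ be the volume form on $\bigwedge^{m-1}V$ for which $\omega'\big((v_1\wedge\cdots\widehat{v_i}\cdots\wedge v_m)_{i=1,\dots,m}\big)=(-1)^{m(m-1)/2}$ whenever $\omega(v_1,\dots,v_m)=1$. A unit ellipsoid is a set $S=\{\sum_i a_i\zeta_i : \sum_i a_i^2=1\}$, where $\zeta_1,\dots,\zeta_m$ is a basis of $\bigwedge^{m-1}V$ with $\omega'(\zeta_1,\dots,\zeta_m)=1$. **Total absolute curvature.** Let $(N,\theta^\perp)$ induce $(\nabla,\theta)$. For $\eta\in\bigwedge^{r-1}N_p$ put $\nu(\eta)=df(e_1)\wedge\cdots\wedge df(e_n)\wedge\eta$, where $e_1,\dots,e_n\in T_pM$ and $\theta(e_1,\dots,e_n)=1$, and let $B=\nu^{-1}(S)\subset\bigwedge^{r-1}N$, with fibres $B_p$. Put $G(\eta)=(-1)^n\det\big[\tilde h_\eta(\alpha(e_i,e_j))\big]_{i,j}$ with $\tilde h_\eta(v)=\omega(\nu(\eta),v)$. Let $\omega_B$ be the volume element of $B$ that is the product of $\theta$ on $M$ and, on each fibre $B_p$, of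 the contraction with the position vector $\eta$ of the volume form of $\bigwedge^{r-1}N_p$ obtained from $\theta^\perp$ in the same way as $\omega'$ from $\omega$. Then $$\tau_S(f)=\frac{1}{\operatorname{vol}(\mathcal S^{m-1}(1))}\int_B|G|\,\omega_B ,$$ where $\mathcal S^{m-1}(1)$ is the Euclidean unit sphere in $\mathbb R^m$. **Proposition.** Let $f:(M,\nabla,\theta)\to(\mathbb R^{n+r},\tilde\nabla,\omega)$ be an equiaffine immersion such that $\tau_S(f)=2$, for some unit ellipsoid $S$ and some pair inducing $(\nabla,\theta)$. Suppose that $f(M)$ is contained in an $(n+r-1)$-dimensional affine subspace $L$, with parallel linear subspace $L'$. Let $\xi\in\mathbb R^{n+r}\setminus L'$ and let $\omega_L(X_1,\dots,X_{n+r-1})=\omega(X_1,\dots,X_{n+r-1},\xi)$ for $X_i\in L'$. Then: 1. The map $f_L:(M,\nabla,\theta)\to(L,\tilde\nabla|_L,\omega_L)$ given by $f$ is an equiaffine immersion, that is, there is a pair $(N_L,\theta_L^\perp)$ for $f_L$ which induces the same $(\nabla,\theta)$. 2. For every unit ellipsoid $S_L\subset\bigwedge^{n+r-2}L'$, and with respect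 to every pair for $f_L$ which induces $(\nabla,\theta)$, the total absolute curvature $\tau_{S_L}(f_L)$ equals $2$. -/

import Mathlib

open scoped Manifold ContDiff ENNReal
open MeasureTheory

noncomputable section

namespace Equiaffine

/-! ## Linear algebra of volume forms and exterior powers -/

section LinearAlgebra

variable {V : Type*} [AddCommGroup V] [Module ℝ V]

/-- A frame `v` with `vol v = 1` (every construction below is independent of which one). -/
def unimodularFrame {d : ℕ} (vol : V [⋀^Fin d]→ₗ[ℝ] ℝ) : Fin d → V :=
  open Classical in if h : ∃ v, vol v = 1 then h.choose else 0

/-- A nonzero form of positive degree takes the value `1` on some frame. -/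
theorem apply_unimodularFrame {d : ℕ} (hd : 0 < d) (vol : V [⋀^Fin d]→ₗ[ℝ] ℝ) (hvol : vol ≠ 0) :
    vol (unimodularFrame vol) = 1 := by
  have h : ∃ v, vol v = 1 := by
    obtain ⟨v, hv⟩ : ∃ v, vol v ≠ 0 := by
      by_contra! h
      exact hvol (AlternatingMap.ext h)
    refine ⟨Function.update v ⟨0, hd⟩ ((vol v)⁻¹ • v ⟨0, hd⟩), ?_⟩
    rw [AlternatingMap.map_update_smul, Function.update_eq_self, smul_eq_mul, inv_mul_cancel₀ hv]
  unfold unimodularFrame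
  rw [dif_pos h]
  exact h.choose_spec

/-- Contraction with `x` in the last slot: `(v₁, …, v_k) ↦ vol (v₁, …, v_k, x)`. -/
def curryLast {k : ℕ} (vol : V [⋀^Fin (k + 1)]→ₗ[ℝ] ℝ) (x : V) : V [⋀^Fin k]→ₗ[ℝ] ℝ :=
  (-1 : ℝ) ^ k • vol.curryLeft x

theorem curryLast_apply {k : ℕ} (vol : V [⋀^Fin (k + 1)]→ₗ[ℝ] ℝ) (x : V) (v : Fin k → V) :
    curryLast vol x v = vol (Fin.snoc v x) := by
  have h : (Fin.snoc v x : Fin (k + 1) → V) =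
      (Matrix.vecCons x v : Fin (k + 1) → V) ∘ (finRotate (k + 1)) := by
    rw [Fin.snoc_eq_cons_rotate]; rfl
  rw [h, AlternatingMap.map_perm, sign_finRotate]
  simp [curryLast, Units.smul_def]

/-- The height function `v ↦ vol (φ, v)` associated with `φ ∈ ⋀ᵏ V`, where `dim V = k + 1`,
so `v ↦ vol (v₁, …, v_k, v)` for `φ = v₁ ∧ ⋯ ∧ v_k`. It is linear in `φ` as well. -/
def height {k : ℕ} (vol : V [⋀^Fin (k + 1)]→ₗ[ℝ] ℝ) : ⋀[ℝ]^k V →ₗ[ℝ] V →ₗ[ℝ] ℝ :=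
  (-1 : ℝ) ^ k •
    ((exteriorPower.alternatingMapLinearEquiv (R := ℝ) (M := V) (N := ℝ) (n := k)).toLinearMap ∘ₗ
      vol.curryLeft).flip

theorem height_ιMulti {k : ℕ} (vol : V [⋀^Fin (k + 1)]→ₗ[ℝ] ℝ) (v : Fin k → V) (x : V) :
    height vol (exteriorPower.ιMulti ℝ k v) x = vol (Fin.snoc v x) := by
  rw [← curryLast_apply]
  simp [height, curryLast, exteriorPower.alternatingMapLinearEquiv_apply_ιMulti]

/-- The volume form `vol'` on `⋀ᵏ V`, where `dim V = k + 1`, induced by a volume form `vol` on `V`;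
see `inducedVolume_omit` for its defining property. -/
def inducedVolume {k : ℕ} (vol : V [⋀^Fin (k + 1)]→ₗ[ℝ] ℝ) :
    (⋀[ℝ]^k V) [⋀^Fin (k + 1)]→ₗ[ℝ] ℝ :=
  Matrix.detRowAlternating.compLinearMap
    (LinearMap.pi fun j => (height vol).flip (unimodularFrame vol j))

/-- Replacing the `i`-th vector of a frame `v` with `vol v = 1` by `x` gives the `i`-th coordinate
of `x`. -/
theorem exists_basis_coord {k : ℕ} (vol : V [⋀^Fin (k + 1)]→ₗ[ℝ] ℝ)
    (hV : Module.finrank ℝ V = k + 1) (v : Fin (k + 1) → V) (hv : vol v = 1) :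
    ∃ b : Module.Basis (Fin (k + 1)) ℝ V, ⇑b = v ∧
      ∀ i x, vol (Function.update v i x) = b.repr x i := by
  have hli : LinearIndependent ℝ v := by
    by_contra h
    exact one_ne_zero (hv.symm.trans (vol.map_linearDependent v h))
  refine ⟨basisOfLinearIndependentOfCardEqFinrank hli (by simp [hV]), by simp, fun i x => ?_⟩
  set b := basisOfLinearIndependentOfCardEqFinrank hli (by simp [hV]) with hb
  have hbv : ⇑b = v := by simp [hb]
  have h : vol.toMultilinearMap.toLinearMap v i = b.coord i := by
    refine b.ext fun l => ?_
    rw [hbv, MultilinearMap.toLinearMap_apply, ← hbv, Module.Basis.coord_apply,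
      Module.Basis.repr_self]
    by_cases hl : l = i
    · subst hl
      simpa [hbv] using hv
    · rw [Finsupp.single_eq_of_ne (Ne.symm hl)]
      exact vol.map_update_self _ (Ne.symm hl)
  simpa using LinearMap.congr_fun h x

/-- The height function of `φ = v₁ ∧ ⋯ ∧ v_k` is the projection to the line of `v_{k+1}` along the
span of `v₁, …, v_k`, when `vol (v₁, …, v_{k+1}) = 1`. -/
theorem sub_height_smul_mem {k : ℕ} (vol : V [⋀^Fin (k + 1)]→ₗ[ℝ] ℝ)
    (hV : Module.finrank ℝ V = k + 1) (v : Fin (k + 1) → V) (hv : vol v = 1) (x : V) :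
    x - height vol (exteriorPower.ιMulti ℝ k fun i => v i.castSucc) x • v (Fin.last k) ∈
      Submodule.span ℝ (Set.range fun i : Fin k => v i.castSucc) := by
  obtain ⟨b, rfl, hb⟩ := exists_basis_coord vol hV v hv
  have h : (Fin.snoc (fun i : Fin k => b i.castSucc) x : Fin (k + 1) → V) =
      Function.update b (Fin.last k) x := by
    rw [← Fin.snoc_init_self (⇑b), Fin.update_snoc_last]
    simp only [Fin.snoc_castSucc]
  rw [height_ιMulti, h, hb]
  nth_rewrite 1 [← b.sum_repr x]
  rw [Fin.sum_univ_castSucc, add_sub_cancel_right]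
  exact Submodule.sum_mem _ fun i _ => Submodule.smul_mem _ _ (Submodule.subset_span ⟨i, rfl⟩)

/-- The property which defines `vol'`: if `vol (v₁, …, v_m) = 1`, where `m = k + 1`, then `vol'`
takes the value `(-1)^(m (m - 1) / 2)` on the `m` vectors `v₁ ∧ ⋯ ∧ v_m` with `v_i` omitted,
`i = 1, …, m`. -/
theorem inducedVolume_omit {k : ℕ} (vol : V [⋀^Fin (k + 1)]→ₗ[ℝ] ℝ)
    (hV : Module.finrank ℝ V = k + 1) (v : Fin (k + 1) → V) (hv : vol v = 1) :
    inducedVolume vol (fun i => exteriorPower.ιMulti ℝ k fun j => v (i.succAbove j)) =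
      (-1) ^ ((k + 1) * k / 2) := by
  have hvol : vol ≠ 0 := by
    rintro rfl
    simp at hv
  have hu := apply_unimodularFrame (Nat.succ_pos k) vol hvol
  obtain ⟨b, rfl, hb⟩ := exists_basis_coord vol hV v hv
  have hM : inducedVolume vol (fun i => exteriorPower.ιMulti ℝ k fun j => b (i.succAbove j)) =
      (Matrix.of fun i j : Fin (k + 1) =>
        ((-1 : ℝ) ^ k * (-1) ^ (i : ℕ)) * b.toMatrix (unimodularFrame vol) i j).det := by
    change Matrix.det _ = _
    congr 1
    ext i j
    have h1 : (Matrix.vecCons (unimodularFrame vol j) fun l => b (i.succAbove l)) =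
      (Fin.cons (unimodularFrame vol j) fun l => b (i.succAbove l) : Fin (k + 1) → V) := rfl
    have h2 : (i.insertNth (unimodularFrame vol j) fun l => b (i.succAbove l) : Fin (k + 1) → V) =
        Function.update b i (unimodularFrame vol j) := by
      exact Fin.insertNth_removeNth i _ _
    have h3 := vol.neg_one_pow_smul_map_insertNth i (unimodularFrame vol j)
      fun l => b (i.succAbove l)
    rw [h2, hb] at h3
    simp only [LinearMap.pi_apply, LinearMap.flip_apply, height_ιMulti, Matrix.of_apply]
    rw [← curryLast_apply]
    simp only [curryLast, AlternatingMap.smul_apply, AlternatingMap.curryLeft_apply_apply, ← h3,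
      Module.Basis.toMatrix_apply, smul_eq_mul, zsmul_eq_mul]
    push_cast
    ring
  have hdet : (b.toMatrix (unimodularFrame vol)).det = 1 := by
    have h := congrArg (fun g => g (unimodularFrame vol)) (AlternatingMap.eq_smul_basis_det b vol)
    simp only [hu, hv, one_smul] at h
    rw [← Module.Basis.det_apply, ← h]
  rw [hM, Matrix.det_mul_column, hdet, mul_one, Finset.prod_mul_distrib, Finset.prod_const,
    Finset.prod_pow_eq_pow_sum, Fin.sum_univ_eq_sum_range (fun i => i), Finset.sum_range_id]
  simp [← pow_mul, (Nat.even_mul_succ_self k).neg_one_pow]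

/-- The unit ellipsoid `{a₁ ζ₁ + ⋯ + a_{k+1} ζ_{k+1} | a₁² + ⋯ + a_{k+1}² = 1}` in `⋀ᵏ V`, where
`dim V = k + 1`, of some basis `ζ` of `⋀ᵏ V` with `vol' ζ = 1`. -/
def IsUnitEllipsoid {k : ℕ} (vol : V [⋀^Fin (k + 1)]→ₗ[ℝ] ℝ) (S : Set (⋀[ℝ]^k V)) : Prop :=
  ∃ ζ : Fin (k + 1) → ⋀[ℝ]^k V, inducedVolume vol ζ = 1 ∧
    S = {φ | ∃ a : Fin (k + 1) → ℝ, ∑ i, a i ^ 2 = 1 ∧ φ = ∑ i, a i • ζ i}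

/-- Exterior multiplication `φ ↦ a ∧ φ` by `a ∈ ⋀ⁿ V`. -/
def wedge {n s : ℕ} (a : ⋀[ℝ]^n V) : ⋀[ℝ]^s V →ₗ[ℝ] ⋀[ℝ]^(n + s) V :=
  ((LinearMap.mulLeft ℝ (a : ExteriorAlgebra ℝ V)) ∘ₗ (⋀[ℝ]^s V).subtype).codRestrict
    (⋀[ℝ]^(n + s) V) fun φ => by
      change _ ∈ LinearMap.range (ExteriorAlgebra.ι ℝ (M := V)) ^ (n + s)
      rw [pow_add]
      exact Submodule.mul_mem_mul a.2 φ.2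

end LinearAlgebra

/-! ## Volume measures -/

/-- The σ-algebra on an exterior power generated by the linear functionals
(in finite dimension, the Borel σ-algebra of the usual topology). -/
instance exteriorPowerMeasurableSpace {W : Type*} [AddCommGroup W] [Module ℝ W] (k : ℕ) :
    MeasurableSpace (⋀[ℝ]^k W) :=
  ⨆ l : Module.Dual ℝ (⋀[ℝ]^k W), (borel ℝ).comap l

/-- The translation-invariant measure `|vol|` on a `d`-dimensional vector space: Lebesgue measure
in the coordinates of a basis `u` with `vol u = 1`. -/
def formMeasure {W : Type*} [AddCommGroup W] [Module ℝ W] [MeasurableSpace W] {d : ℕ}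
    (vol : W [⋀^Fin d]→ₗ[ℝ] ℝ) : Measure W :=
  (volume : Measure (Fin d → ℝ)).map fun a => ∑ i, a i • unimodularFrame vol i

/-- The volume measure on an ellipsoid `B` centred at the origin of a `d`-dimensional vector space
with volume form `vol`. It is the measure of the volume element
`(X₁, …, X_{d-1}) ↦ vol (X₁, …, X_{d-1}, η)` of `B` (with `X_i` tangent to `B` at `η`, and the
position vector `η` as transversal vector): the measure of `A ⊆ B` is `d` times the measure of the
cone `{t η | 0 ≤ t ≤ 1, η ∈ A}`. It is written as the image of `d • |vol|`, restricted to the solid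
ellipsoid, under the radial projection onto `B`. For the unit sphere of a Euclidean space it is the
usual surface measure. -/
def ellipsoidMeasure {W : Type*} [AddCommGroup W] [Module ℝ W] [MeasurableSpace W] {d : ℕ}
    (vol : W [⋀^Fin d]→ₗ[ℝ] ℝ) (B : Set W) : Measure W :=
  let solid : Set W := {x | ∃ t ∈ Set.Icc (0 : ℝ) 1, ∃ η ∈ B, x = t • η}
  (d : ℝ≥0∞) • ((formMeasure vol).restrict solid).map fun x => (gauge solid x)⁻¹ • x

section Manifold

variable {n : ℕ} {M : Type*} [TopologicalSpace M] [ChartedSpace (EuclideanSpace ℝ (Fin n)) M]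

/-- The measure `|θ|` of a volume form `θ` on `M`: the least measure which on the domain of every
chart (of the given atlas) dominates (and then agrees with) the measure of density
`|θ (∂₁, …, ∂ₙ)|` with respect to Lebesgue measure in the chart. -/
def volumeMeasure [MeasurableSpace M]
    (θ : ∀ p : M, TangentSpace (𝓡 n) p [⋀^Fin n]→ₗ[ℝ] ℝ) : Measure M :=
  ⨆ x : M, ((volume.restrict (chartAt (EuclideanSpace ℝ (Fin n)) x).target).withDensity fun y =>
    ENNReal.ofReal |θ ((chartAt (EuclideanSpace ℝ (Fin n)) x).symm y) fun i =>
      mfderiv (𝓡 n) (𝓡 n) (chartAt (EuclideanSpace ℝ (Fin n)) x).symm y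
        (EuclideanSpace.single i (1 : ℝ))|).map (chartAt (EuclideanSpace ℝ (Fin n)) x).symm

/-! ## Equiaffine structures and equiaffine immersions -/

variable [IsManifold (𝓡 n) ∞ M]

/-- Smoothness of a vector field on a subset of `M`. -/
def SmoothFieldOn (X : ∀ p : M, TangentSpace (𝓡 n) p) (U : Set M) : Prop :=
  ContMDiffOn (𝓡 n) (𝓡 n).tangent ∞ (fun p => (⟨p, X p⟩ : TangentBundle (𝓡 n) M)) U

variable (n M) in
/-- An equiaffine structure `(∇, θ)`: a smooth torsion-free affine connection `∇` and a smooth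
nowhere vanishing volume form `θ` with `∇θ = 0`. In Mathlib's order of arguments,
`conn Y p v` is `∇_v Y` at `p`. -/
structure EquiaffineStructure where
  conn : CovariantDerivative (𝓡 n) (EuclideanSpace ℝ (Fin n)) (TangentSpace (𝓡 n) : M → Type _)
  conn_smooth : CovariantDerivative.ContMDiffCovariantDerivative conn ∞
  torsion_free : conn.torsion = 0
  vol : ∀ p : M, TangentSpace (𝓡 n) p [⋀^Fin n]→ₗ[ℝ] ℝ
  vol_ne_zero : ∀ p, vol p ≠ 0
  vol_smooth : ∀ U : Set M, IsOpen U → ∀ X : Fin n → ∀ p : M, TangentSpace (𝓡 n) p,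
    (∀ i, SmoothFieldOn (X i) U) →
      ContMDiffOn (𝓡 n) 𝓘(ℝ, ℝ) ∞ (fun p => vol p fun i => X i p) U
  parallel : ∀ X : Fin n → ∀ p : M, TangentSpace (𝓡 n) p,
    (∀ i, SmoothFieldOn (X i) Set.univ) → ∀ (p : M) (v : TangentSpace (𝓡 n) p),
      mvfderiv (𝓡 n) (fun q => vol q fun i => X i q) p v =
        ∑ i, vol p (Function.update (fun j => X j p) i (conn (X i) p v))

/-! The ambient affine space is `P`, with vector space of translations `V`. -/

variable {V P : Type*} [NormedAddCommGroup V] [NormedSpace ℝ V] [AddTorsor V P]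

/-- The differential `df_p : T_p M → V` of a map into an affine space. -/
def affineDeriv (f : M → P) (p : M) : TangentSpace (𝓡 n) p →L[ℝ] V :=
  mvfderiv (𝓡 n) (fun q => (f q -ᵥ f p : V)) p

variable (n) in
/-- `f` is a smooth immersion into the affine space `P`. -/
def IsSmoothImmersion (f : M → P) : Prop :=
  (∀ o : P, ContMDiff (𝓡 n) 𝓘(ℝ, V) ∞ fun q => (f q -ᵥ o : V)) ∧
    ∀ p : M, Function.Injective (affineDeriv (n := n) (V := V) f p)

variable (n) in
/-- A pair `(N, θ^⊥)`: a transversal bundle `N` of `f` of rank `r`, i.e. a smooth subbundle of the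
trivial bundle `M × V` complementary to `df(TM)`, and a smooth nowhere vanishing volume form `θ^⊥`
on `N`. -/
structure TransversalPair (f : M → P) (r : ℕ) where
  N : M → Submodule ℝ V
  isCompl : ∀ p, IsCompl (affineDeriv (n := n) (V := V) f p).range (N p)
  smooth_frame : ∀ p₀ : M, ∃ U : Set M, IsOpen U ∧ p₀ ∈ U ∧ ∃ ξ : Fin r → M → V,
    (∀ i, ContMDiffOn (𝓡 n) 𝓘(ℝ, V) ∞ (ξ i) U) ∧
      ∀ p ∈ U, LinearIndependent ℝ (fun i => ξ i p) ∧
        Submodule.span ℝ (Set.range fun i => ξ i p) = N p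
  vol : ∀ p, N p [⋀^Fin r]→ₗ[ℝ] ℝ
  vol_ne_zero : ∀ p, vol p ≠ 0
  vol_smooth : ∀ U : Set M, IsOpen U → ∀ ξ : Fin r → ∀ p, N p,
    (∀ i, ContMDiffOn (𝓡 n) 𝓘(ℝ, V) ∞ (fun p => (ξ i p : V)) U) →
      ContMDiffOn (𝓡 n) 𝓘(ℝ, ℝ) ∞ (fun p => vol p fun i => ξ i p) U

/-- The pair `(N, θ^⊥)` induces the equiaffine structure `A = (∇, θ)`: the vector `df(∇_X Y)` is the
`df(TM)`-component of the flat derivative of `df(Y)` along `X`, that is, their difference lies in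
`N`; and `θ(X₁, …, Xₙ) = Ω(df X₁, …, df Xₙ, ξ₁, …, ξ_r) / θ^⊥(ξ₁, …, ξ_r)` for frames `ξ` of
`N`. -/
structure TransversalPair.Induces {f : M → P} {r : ℕ} (D : TransversalPair n (V := V) f r)
    (A : EquiaffineStructure n M) (Ω : V [⋀^Fin (n + r)]→ₗ[ℝ] ℝ) : Prop where
  gauss : ∀ Y : ∀ p : M, TangentSpace (𝓡 n) p, SmoothFieldOn Y Set.univ →
    ∀ (p : M) (v : TangentSpace (𝓡 n) p),
      mvfderiv (𝓡 n) (fun q => affineDeriv (V := V) f q (Y q)) p v -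
        affineDeriv (V := V) f p (A.conn Y p v) ∈ D.N p
  volume_eq : ∀ (p : M) (X : Fin n → TangentSpace (𝓡 n) p) (ξ : Fin r → D.N p),
    LinearIndependent ℝ ξ →
      A.vol p X =
        Ω (Fin.append (fun i => affineDeriv (V := V) f p (X i)) fun j => (ξ j : V)) / D.vol p ξ

/-- `f : (M, ∇, θ) → (P, Ω)` is an equiaffine immersion of codimension `r`; the affine space `P`
carries its flat connection and the parallel volume form `Ω`. -/
def IsEquiaffineImmersion {r : ℕ} (A : EquiaffineStructure n M) (Ω : V [⋀^Fin (n + r)]→ₗ[ℝ] ℝ)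
    (f : M → P) : Prop :=
  Ω ≠ 0 ∧ IsSmoothImmersion n (V := V) f ∧ ∃ D : TransversalPair n (V := V) f r, D.Induces A Ω

/-! ## Lipschitz-Killing curvature and total absolute curvature

The codimension is `s + 1` from here on, so that `dim V = n + s + 1`. -/

namespace TransversalPair

/-- The affine fundamental form `α(v, w)` of `(f, N)` at `p`: the `N`-component of the flat
derivative along `v` of `df(Y)`, where `Y` is a vector field near `p` with `Y p = w`. -/
def fundamentalForm {f : M → P} {r : ℕ} (D : TransversalPair n (V := V) f r) (p : M)
    (v w : TangentSpace (𝓡 n) p) : V :=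
  (D.N p).projection (affineDeriv (n := n) (V := V) f p).range (D.isCompl p).symm
    (mvfderiv (𝓡 n) (fun q => affineDeriv (V := V) f q
      (FiberBundle.extend (EuclideanSpace ℝ (Fin n)) w q)) p v)

variable {f : M → P} {s : ℕ} (A : EquiaffineStructure n M) (Ω : V [⋀^Fin (n + (s + 1))]→ₗ[ℝ] ℝ)
  (D : TransversalPair n (V := V) f (s + 1)) (S : Set (⋀[ℝ]^(n + s) V))

/-- The map `η ↦ df(e₁) ∧ ⋯ ∧ df(eₙ) ∧ η` from `⋀^s N_p` to `⋀^(n+s) V`, with `θ(e₁, …, eₙ) = 1`. -/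
def gaussMap (p : M) : ⋀[ℝ]^s (D.N p) →ₗ[ℝ] ⋀[ℝ]^(n + s) V :=
  wedge (exteriorPower.ιMulti ℝ n fun i =>
    affineDeriv (V := V) f p (unimodularFrame (A.vol p) i)) ∘ₗ
      exteriorPower.map s (D.N p).subtype

/-- The fibre over `p` of the transversal ellipsoid bundle `B`. -/
def ellipsoidFibre (p : M) : Set (⋀[ℝ]^s (D.N p)) :=
  D.gaussMap A p ⁻¹' S

/-- The Lipschitz-Killing curvature
`G(η) = (-1)ⁿ det [h̃_η(α(e_i, e_j))]`, with `θ(e₁, …, eₙ) = 1`. -/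
def lipschitzKilling (p : M) (η : ⋀[ℝ]^s (D.N p)) : ℝ :=
  (-1) ^ n * (Matrix.of fun i j : Fin n =>
    height (k := n + s) Ω (D.gaussMap A p η)
      (D.fundamentalForm p (unimodularFrame (A.vol p) i) (unimodularFrame (A.vol p) j))).det

/-- The total absolute curvature `τ_S(f) = (1 / vol S^{n+s}(1)) ∫_B |G| ω_B`, computed with the
pair `(N, θ^⊥)`. The volume element `ω_B` of `B` is the product of `θ` on `M` and of the volume
elements of the fibres `B_p ⊆ ⋀^s N_p`, which come from the volume form of `⋀^s N_p` induced by
`θ^⊥`; so `B` is integrated fibre by fibre, and then over `M`. -/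
def totalAbsoluteCurvature [MeasurableSpace M] : ℝ≥0∞ :=
  (∫⁻ p, ∫⁻ η, ENNReal.ofReal |D.lipschitzKilling A Ω p η|
      ∂(ellipsoidMeasure (inducedVolume (D.vol p)) (D.ellipsoidFibre A S p))
    ∂(volumeMeasure A.vol)) /
  (volume : Measure (EuclideanSpace ℝ (Fin (n + (s + 1))))).toSphere Set.univ

end TransversalPair

end Manifold

/-- The volume form `Ω_L(X₁, …, X_k) = Ω(X₁, …, X_k, ξ)` on a subspace `L'`. -/
def restrictVolume {V : Type*} [AddCommGroup V] [Module ℝ V] {k : ℕ}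
    (Ω : V [⋀^Fin (k + 1)]→ₗ[ℝ] ℝ) (L' : Submodule ℝ V) (ξ : V) : L' [⋀^Fin k]→ₗ[ℝ] ℝ :=
  (curryLast Ω ξ).compLinearMap L'.subtype

end Equiaffine

end

open Equiaffine

/-!
The total absolute curvature is an average number of critical points of height functions, and this
number does not change when `f` is regarded as a map into an affine hyperplane.

Fix a pair `(N, θ^⊥)` and a unit ellipsoid `S`. The height function of the vector `ν(η) = df(e₁) ∧
⋯ ∧ df(eₙ) ∧ η`, for `η ∈ ⋀^s N_p`, is a covector on `V` which annihilates `df(T_p M)` and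
restricts to the height function of `η` on `N_p`. Moreover `S` is the unit sphere for the
coordinates `φ ↦ height φ (w i)` given by a basis `w` of `V` with `Ω w = 1`
(`IsUnitEllipsoid.exists_basis`). So the bundle of all `⋀^s N_p` is the conormal bundle of `f`, of
the same dimension as `V*`, and its projection to `V*` takes the solid transversal ellipsoids to
the unit ball. In a chart with a frame of `N`, the Jacobian of this projection is, up to the
factors which turn coordinates into the measures `|θ|` and `|θ^⊥|`, the determinant of the second
fundamental form in the direction of the covector, that is, the Lipschitz-Killing curvature
(`det_mul_det_fderiv_conormalMap`, `abs_lipschitzKilling_eq`, `fibre_integral_eq`). The preimages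
of a covector `l` are the critical points of `l ∘ f`. As the curvature is homogeneous of degree
`n` in `η`, integration over the ellipsoids amounts to integration over the solid ellipsoids with
the weight `|x|⁻ⁿ`, and the area formula gives `vol(S^{n+s}(1)) τ_S(f) = (s + 1) ∫_{|ℓ| ≤ 1} |ℓ|⁻ⁿ
#{critical points of ℓ ∘ f} dℓ` (`lintegral_lipschitzKilling`).

On a compact manifold of positive dimension every height function has a maximum and a minimum, so
the number of critical points is at least `2`; and `(s + 1) ∫_{|ℓ| ≤ 1} |ℓ|⁻ⁿ dℓ` is the volume of
the sphere. Hence `τ_S(f) = 2` if and only if almost every height function has exactly two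
critical points (`totalAbsoluteCurvature_eq_two_iff`), a condition on `f` alone. If `f` takes its
values in `L`, the critical points of `l ∘ f` are those of `l|_{L'} ∘ f_L`, and restriction `V* →
L'*` is a surjective linear map, so null sets correspond to null sets. This is the second
assertion (`totalAbsoluteCurvature_codRestrict_eq_two`).

For the first assertion, take `N_L = N ∩ L'` and `θ_L^⊥ = θ^⊥(…, z)`, where `z ∈ N` and `δ(z) = 1`
for the linear form `δ` with kernel `L'` and `δ(ξ) = 1`. Neither `θ^⊥(…, z)` on `N_L` nor `Ω(…,
z)` on `L'` depends on the choice of `z` (`apply_snoc_eq`), which makes `θ_L^⊥` smooth and gives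
the volume condition; the condition on the connection is inherited because derivatives of maps
into `L'` stay in `L'`.
-/

noncomputable section

namespace Equiaffine

/-! ### Heights and induced volume forms -/

section LinearAlgebra

variable {V : Type*} [AddCommGroup V] [Module ℝ V]

/-- The pairing between `⋀ᵏ V` and `V` by heights is unimodular for the induced volume form. -/
theorem det_height_eq_inducedVolume_mul {k : ℕ} (vol : V [⋀^Fin (k + 1)]→ₗ[ℝ] ℝ)
    (hV : Module.finrank ℝ V = k + 1) (hvol : vol ≠ 0) (η : Fin (k + 1) → ⋀[ℝ]^k V)
    (v : Fin (k + 1) → V) :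
    (Matrix.of fun i j => height vol (η i) (v j)).det = inducedVolume vol η * vol v := by
  have hu := apply_unimodularFrame (Nat.succ_pos k) vol hvol
  obtain ⟨b, hb, -⟩ := exists_basis_coord vol hV _ hu
  have h1 : vol v = b.det v := by
    have h := congrArg (fun g => g v) (AlternatingMap.eq_smul_basis_det b vol)
    simpa [hb, hu] using h
  have h2 : (Matrix.of fun i j => height vol (η i) (v j)) =
      (Matrix.of fun i j => height vol (η i) (unimodularFrame vol j)) * b.toMatrix v := by
    ext i j
    rw [Matrix.mul_apply, Matrix.of_apply]
    conv_lhs => rw [← b.sum_repr (v j)]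
    simp [Module.Basis.toMatrix_apply, hb, mul_comm]
  rw [h2, Matrix.det_mul, h1, Module.Basis.det_apply]
  rfl

theorem inducedVolume_ne_zero {k : ℕ} (vol : V [⋀^Fin (k + 1)]→ₗ[ℝ] ℝ)
    (hV : Module.finrank ℝ V = k + 1) (hvol : vol ≠ 0) : inducedVolume vol ≠ 0 := by
  intro h
  have := inducedVolume_omit vol hV _ (apply_unimodularFrame (Nat.succ_pos k) vol hvol)
  rw [h] at this
  simp only [AlternatingMap.zero_apply] at this
  exact pow_ne_zero _ (by norm_num : (-1 : ℝ) ≠ 0) this.symm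

/-- In terms of height functions, a unit ellipsoid is the unit sphere for the coordinates
`φ ↦ height φ (w i)` given by a unimodular basis `w` of `V`. -/
theorem IsUnitEllipsoid.exists_basis {k : ℕ} {vol : V [⋀^Fin (k + 1)]→ₗ[ℝ] ℝ}
    (hV : Module.finrank ℝ V = k + 1) (hvol : vol ≠ 0) {S : Set (⋀[ℝ]^k V)}
    (hS : IsUnitEllipsoid vol S) :
    ∃ w : Module.Basis (Fin (k + 1)) ℝ V, vol w = 1 ∧
      S = {φ | ∑ i, height vol φ (w i) ^ 2 = 1} := by
  obtain ⟨ζ, hζ, rfl⟩ := hS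
  have : FiniteDimensional ℝ V := Module.finite_of_finrank_pos (by omega)
  set A : Matrix (Fin (k + 1)) (Fin (k + 1)) ℝ :=
    Matrix.of fun i j => height vol (ζ i) (unimodularFrame vol j) with hA
  have hdet : A.det = 1 := hζ
  set v : Fin (k + 1) → V := fun j => ∑ l, A⁻¹ l j • unimodularFrame vol l with hv
  have hd : ∀ i j, height vol (ζ i) (v j) = (1 : Matrix (Fin (k + 1)) (Fin (k + 1)) ℝ) i j := by
    intro i j
    rw [← Matrix.mul_nonsing_inv A (by rw [hdet]; exact isUnit_one), Matrix.mul_apply]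
    simp [hv, hA, mul_comm]
  have hv1 : vol v = 1 := by
    have h := det_height_eq_inducedVolume_mul vol hV hvol ζ v
    rw [hζ, one_mul] at h
    rw [← h]
    have : (Matrix.of fun i j => height vol (ζ i) (v j)) = 1 := by
      ext i j
      exact hd i j
    rw [this, Matrix.det_one]
  obtain ⟨w, hw, -⟩ := exists_basis_coord vol hV v hv1
  refine ⟨w, by rw [hw, hv1], ?_⟩
  have hli : LinearIndependent ℝ ζ := by
    by_contra h
    exact one_ne_zero (hζ.symm.trans ((inducedVolume vol).map_linearDependent ζ h))
  have hcoord : ∀ (a : Fin (k + 1) → ℝ) (j), height vol (∑ i, a i • ζ i) (w j) = a j := by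
    intro a j
    simp [hw, hd, Matrix.one_apply]
  let bζ := basisOfLinearIndependentOfCardEqFinrank hli (by
    rw [exteriorPower.finrank_eq, hV]; simp)
  ext φ
  constructor
  · rintro ⟨a, ha, rfl⟩
    simpa only [Set.mem_ofPred_eq, hcoord] using ha
  · intro hφ
    have hsum : φ = ∑ i, bζ.repr φ i • ζ i := by
      conv_lhs => rw [← bζ.sum_repr φ]
      simp [bζ]
    refine ⟨bζ.repr φ, ?_, hsum⟩
    rw [hsum] at hφ
    simpa only [hcoord, Set.mem_ofPred_eq] using hφ

theorem wedge_ιMulti {n s : ℕ} (a : Fin n → V) (b : Fin s → V) :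
    wedge (exteriorPower.ιMulti ℝ n a) (exteriorPower.ιMulti ℝ s b) =
      exteriorPower.ιMulti ℝ (n + s) (Fin.append a b) := by
  apply Subtype.ext
  change ExteriorAlgebra.ιMulti ℝ n a * ExteriorAlgebra.ιMulti ℝ s b =
    ExteriorAlgebra.ιMulti ℝ (n + s) (Fin.append a b)
  rw [ExteriorAlgebra.ιMulti_apply, ExteriorAlgebra.ιMulti_apply, ExteriorAlgebra.ιMulti_apply,
    ← List.prod_append, ← List.ofFn_fin_append]
  congr 2
  ext i
  refine Fin.addCases (fun i => ?_) (fun i => ?_) i <;> simp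

theorem snoc_append {α : Type*} {n s : ℕ} (a : Fin n → α) (b : Fin s → α) (x : α) :
    (Fin.snoc (Fin.append a b) x : Fin (n + s + 1) → α) = Fin.append a (Fin.snoc b x) := by
  rw [Fin.append_snoc]

/-- If `Ω (a, ξ) = ν ξ` for all frames `ξ` of `N`, then the height function of `a ∧ η` restricts
to the height function of `η` on `N`. -/
theorem height_wedge_map_of_mem {n s : ℕ} (Ω : V [⋀^Fin (n + (s + 1))]→ₗ[ℝ] ℝ) (a : Fin n → V)
    (N : Submodule ℝ V) (ν : N [⋀^Fin (s + 1)]→ₗ[ℝ] ℝ)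
    (h : ∀ ξ : Fin (s + 1) → N, Ω (Fin.append a fun j => (ξ j : V)) = ν ξ) (η : ⋀[ℝ]^s N) (v : N) :
    height (k := n + s) Ω (wedge (exteriorPower.ιMulti ℝ n a) (exteriorPower.map s N.subtype η)) v =
      height ν η v := by
  have : ((height (k := n + s) Ω).flip (v : V) ∘ₗ wedge (exteriorPower.ιMulti ℝ n a)) ∘ₗ
      exteriorPower.map s N.subtype = (height ν).flip v := by
    refine LinearMap.ext_on_range (exteriorPower.ιMulti_span ℝ s N) fun ξ => ?_
    simp only [LinearMap.comp_apply, exteriorPower.map_apply_ιMulti, wedge_ιMulti,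
      LinearMap.flip_apply, height_ιMulti, snoc_append]
    rw [← h]
    congr 2
    funext j
    refine Fin.lastCases ?_ (fun j => ?_) j <;> simp
  exact LinearMap.congr_fun this η

theorem height_wedge_of_mem_span {n s : ℕ} (Ω : V [⋀^Fin (n + (s + 1))]→ₗ[ℝ] ℝ) (a : Fin n → V)
    (φ : ⋀[ℝ]^s V) {v : V} (hv : v ∈ Submodule.span ℝ (Set.range a)) :
    height (k := n + s) Ω (wedge (exteriorPower.ιMulti ℝ n a) φ) v = 0 := by
  induction hv using Submodule.span_induction with
  | zero => simp
  | add x y _ _ hx hy => rw [map_add, hx, hy, add_zero]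
  | smul c x _ hx => rw [map_smul, hx, smul_zero]
  | mem x hx =>
    obtain ⟨i, rfl⟩ := hx
    have : ((height (k := n + s) Ω).flip (a i) ∘ₗ wedge (exteriorPower.ιMulti ℝ n a)) = 0 := by
      refine LinearMap.ext_on_range (exteriorPower.ιMulti_span ℝ s V) fun ξ => ?_
      simp only [LinearMap.comp_apply, wedge_ιMulti, LinearMap.flip_apply, height_ιMulti,
        LinearMap.zero_apply]
      refine Ω.map_eq_zero_of_eq _ (i := (Fin.castAdd s i).castSucc) (j := Fin.last _) ?_ ?_
      · simp
      · exact (Fin.castSucc_lt_last _).ne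
    exact LinearMap.congr_fun this φ

/-! ### Measures on exterior powers -/

theorem measurable_dual {k : ℕ} (l : Module.Dual ℝ (⋀[ℝ]^k V)) : Measurable l := by
  rw [measurable_iff_comap_le]
  exact le_iSup (fun l : Module.Dual ℝ (⋀[ℝ]^k V) => (borel ℝ).comap l) l

theorem measurable_exteriorPower_iff {k : ℕ} {α : Type*} [MeasurableSpace α] {f : α → ⋀[ℝ]^k V} :
    Measurable f ↔ ∀ l : Module.Dual ℝ (⋀[ℝ]^k V), Measurable fun x => l (f x) := by
  refine ⟨fun h l => (measurable_dual l).comp h, fun h => ?_⟩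
  rw [measurable_iff_comap_le, exteriorPowerMeasurableSpace, MeasurableSpace.comap_iSup]
  refine iSup_le fun l => ?_
  rw [MeasurableSpace.comap_comp]
  exact (h l).comap_le

theorem measurable_linear_comb {k : ℕ} {d : ℕ} (u : Fin d → ⋀[ℝ]^k V) :
    Measurable fun a : Fin d → ℝ => ∑ i, a i • u i := by
  rw [measurable_exteriorPower_iff]
  intro l
  simp only [map_sum, map_smul, smul_eq_mul]
  fun_prop

/-- In the coordinates of `η` given by the heights of a frame `Ξ`, the measure of the induced
volume form on `⋀ᵏ V` is a multiple of Lebesgue measure. -/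
theorem map_height_formMeasure {k : ℕ} (vol : V [⋀^Fin (k + 1)]→ₗ[ℝ] ℝ)
    (hV : Module.finrank ℝ V = k + 1) (Ξ : Fin (k + 1) → V) (hΞ : vol Ξ ≠ 0) :
    (formMeasure (inducedVolume vol)).map (fun η j => height vol η (Ξ j)) =
      ENNReal.ofReal |(vol Ξ)⁻¹| • (volume : Measure (Fin (k + 1) → ℝ)) := by
  have hvol : vol ≠ 0 := by
    rintro rfl
    simp at hΞ
  have hu := apply_unimodularFrame (Nat.succ_pos k) _ (inducedVolume_ne_zero vol hV hvol)
  set u := unimodularFrame (inducedVolume vol) with hudef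
  set A : Matrix (Fin (k + 1)) (Fin (k + 1)) ℝ := Matrix.of fun i j => height vol (u i) (Ξ j)
  have hA : A.det = vol Ξ := by
    rw [det_height_eq_inducedVolume_mul vol hV hvol u Ξ, hu, one_mul]
  have hmeas : Measurable fun (η : ⋀[ℝ]^k V) (j : Fin (k + 1)) => height vol η (Ξ j) := by
    rw [measurable_pi_iff]
    exact fun j => measurable_dual ((height vol).flip (Ξ j))
  have hcomp : (fun (η : ⋀[ℝ]^k V) (j : Fin (k + 1)) => height vol η (Ξ j)) ∘
      (fun a : Fin (k + 1) → ℝ => ∑ i, a i • u i) = A.vecMulLinear := by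
    ext a j
    simp [Matrix.vecMul, dotProduct, A]
  have hdet : LinearMap.det A.vecMulLinear = vol Ξ := by
    have : A.vecMulLinear = Matrix.toLin' A.transpose := by
      ext a j
      simp
    rw [this, LinearMap.det_toLin', Matrix.det_transpose, hA]
  rw [formMeasure, Measure.map_map hmeas (measurable_linear_comb u), hcomp,
    Real.map_linearMap_volume_pi_eq_smul_volume_pi (by rwa [hdet]), hdet]

end LinearAlgebra

/-! ### The area formula with multiplicities -/

section Area

variable {E : Type*} [NormedAddCommGroup E] [NormedSpace ℝ E] [FiniteDimensional ℝ E]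
  [MeasurableSpace E] [BorelSpace E]

/-- A set on which a differentiable map has invertible derivative is a countable disjoint union of
measurable pieces on each of which the map is injective. -/
theorem exists_partition_injOn {s : Set E} {f : E → E} {f' : E → E →L[ℝ] E}
    (hf' : ∀ x ∈ s, HasFDerivWithinAt f (f' x) s x) (hdet : ∀ x ∈ s, (f' x).det ≠ 0) :
    ∃ t : ℕ → Set E, Pairwise (Function.onFun Disjoint t) ∧ (∀ i, MeasurableSet (t i)) ∧
      s ⊆ ⋃ i, t i ∧ ∀ i, Set.InjOn f (s ∩ t i) := by
  have hδ : ∀ A : E →L[ℝ] E, ∃ δ : NNReal, δ ≠ 0 ∧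
      (A.det ≠ 0 → ∀ t : Set E, ApproximatesLinearOn f A t δ → Set.InjOn f t) := by
    intro A
    by_cases hA : A.det = 0
    · exact ⟨1, one_ne_zero, fun h => absurd hA h⟩
    · set B := A.toContinuousLinearEquivOfDetNeZero hA
      have hB : (B : E →L[ℝ] E) = A := A.coe_toContinuousLinearEquivOfDetNeZero hA
      rcases B.subsingleton_or_nnnorm_symm_pos with h | h
      · exact ⟨1, one_ne_zero, fun _ t _ x _ y _ _ => Subsingleton.elim x y⟩
      · refine ⟨‖(B.symm : E →L[ℝ] E)‖₊⁻¹ / 2, by positivity, fun _ t ht => ?_⟩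
        rw [← hB] at ht
        refine ht.injOn (Or.inr ?_)
        exact NNReal.half_lt_self (inv_pos.2 h).ne'
  choose δ hδ0 hδ using hδ
  obtain ⟨t, A, htd, htm, hst, hta, hA⟩ :=
    exists_partition_approximatesLinearOn_of_hasFDerivWithinAt f s f' hf' δ hδ0
  refine ⟨t, htd, htm, hst, fun i => ?_⟩
  rcases s.eq_empty_or_nonempty with rfl | hs
  · simp
  · obtain ⟨y, hy, hAy⟩ := hA hs i
    exact hδ (A i) (by rw [hAy]; exact hdet y hy) _ (hta i)

/-- The area formula: integrating with the Jacobian counts the preimages. The points where the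
Jacobian vanishes have a null image; the other ones are partitioned into pieces where the change of
variables formula for injective maps applies. -/
theorem lintegral_abs_det_fderiv_mul_eq_lintegral_mul_encard (μ : Measure E) [μ.IsAddHaarMeasure]
    {s : Set E} (hs : MeasurableSet s) {f : E → E} {f' : E → E →L[ℝ] E}
    (hf' : ∀ x ∈ s, HasFDerivWithinAt f (f' x) s x) (hc : ContinuousOn f' s) :
    AEMeasurable (fun y => ((s ∩ f ⁻¹' {y}).encard : ℝ≥0∞)) μ ∧
      ∀ g : E → ℝ≥0∞, Measurable g →
        ∫⁻ x in s, ENNReal.ofReal |(f' x).det| * g (f x) ∂μ =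
          ∫⁻ y, g y * ((s ∩ f ⁻¹' {y}).encard : ℝ≥0∞) ∂μ := by
  have hcd : ContinuousOn (fun x => (f' x).det) s :=
    ContinuousLinearMap.continuous_det.comp_continuousOn hc
  set s0 : Set E := s ∩ (fun x => (f' x).det) ⁻¹' {0} with hs0
  set s1 : Set E := s ∩ (fun x => (f' x).det) ⁻¹' {0}ᶜ with hs1
  have hm0 : MeasurableSet s0 := by
    obtain ⟨u, hu, hus⟩ := continuousOn_iff_isClosed.1 hcd {0} isClosed_singleton
    rw [hs0, Set.inter_comm, hus]
    exact hu.measurableSet.inter hs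
  have hm1 : MeasurableSet s1 := by
    have : s1 = s \ s0 := by
      ext x
      simp only [hs1, hs0, Set.mem_inter_iff, Set.mem_preimage, Set.mem_compl_iff,
        Set.mem_singleton_iff, Set.mem_sdiff]
      tauto
    rw [this]
    exact hs.diff hm0
  have hsub0 : s0 ⊆ s := Set.inter_subset_left
  have hsub1 : s1 ⊆ s := Set.inter_subset_left
  have hunion : s = s1 ∪ s0 := by
    ext x
    simp only [hs1, hs0, Set.mem_inter_iff, Set.mem_preimage, Set.mem_compl_iff,
      Set.mem_singleton_iff, Set.mem_union]
    tauto
  have hdisj : Disjoint s1 s0 := by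
    rw [Set.disjoint_left]
    exact fun x h1 h0 => h1.2 h0.2
  have hf0 : ∀ x ∈ s0, HasFDerivWithinAt f (f' x) s0 x := fun x hx => (hf' x hx.1).mono hsub0
  have hf1 : ∀ x ∈ s1, HasFDerivWithinAt f (f' x) s1 x := fun x hx => (hf' x hx.1).mono hsub1
  have hnull : μ (f '' s0) = 0 :=
    addHaar_image_eq_zero_of_det_fderivWithin_eq_zero μ hf0 fun x hx => hx.2
  obtain ⟨t, htd, htm, hst, hinj⟩ := exists_partition_injOn hf1 fun x hx => hx.2
  have hmt : ∀ i, MeasurableSet (s1 ∩ t i) := fun i => hm1.inter (htm i)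
  have hft : ∀ i, ∀ x ∈ s1 ∩ t i, HasFDerivWithinAt f (f' x) (s1 ∩ t i) x := fun i x hx =>
    (hf1 x hx.1).mono Set.inter_subset_left
  have himg : ∀ i, MeasurableSet (f '' (s1 ∩ t i)) := fun i =>
    measurable_image_of_fderivWithin (hmt i) (hft i) (hinj i)
  have hcover : s1 = ⋃ i, s1 ∩ t i := by
    rw [← Set.inter_iUnion, Set.inter_eq_left.2 hst]
  have hpd : Pairwise (Function.onFun Disjoint fun i => s1 ∩ t i) := fun i j hij =>
    (htd hij).mono Set.inter_subset_right Set.inter_subset_right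
  set c : E → ℝ≥0∞ := fun y => ∑' i, (f '' (s1 ∩ t i)).indicator 1 y with hcdef
  have hcm : Measurable c := Measurable.tsum fun i =>
    measurable_one.indicator (himg i)
  have hcount : ∀ y, c y = ((s1 ∩ f ⁻¹' {y}).encard : ℝ≥0∞) := by
    intro y
    -- The counting measure of all subsets, to get additivity of cardinalities over the pieces.
    let _ : MeasurableSpace E := ⊤
    have h1 : s1 ∩ f ⁻¹' {y} = ⋃ i, (s1 ∩ t i) ∩ f ⁻¹' {y} := by
      rw [← Set.iUnion_inter, ← hcover]
    rw [← Measure.count_apply (s := s1 ∩ f ⁻¹' {y}) MeasurableSpace.measurableSet_top, h1,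
      measure_iUnion]
    · refine tsum_congr fun i => ?_
      rw [Measure.count_apply MeasurableSpace.measurableSet_top]
      by_cases hy : y ∈ f '' (s1 ∩ t i)
      · obtain ⟨x, hx, rfl⟩ := hy
        rw [Set.indicator_of_mem (Set.mem_image_of_mem f hx)]
        have : (s1 ∩ t i) ∩ f ⁻¹' {f x} = {x} := by
          ext z
          refine ⟨fun hz => hinj i hz.1 hx hz.2, ?_⟩
          rintro rfl
          exact ⟨hx, rfl⟩
        rw [this]
        simp
      · rw [Set.indicator_of_notMem hy]
        have : (s1 ∩ t i) ∩ f ⁻¹' {y} = ∅ := by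
          ext z
          simp only [Set.mem_inter_iff, Set.mem_preimage, Set.mem_singleton_iff,
            Set.mem_empty_iff_false, iff_false]
          exact fun hz => hy ⟨z, hz.1, hz.2⟩
        rw [this]
        simp
    · exact fun i j hij => (hpd hij).mono Set.inter_subset_left Set.inter_subset_left
    · exact fun i => MeasurableSpace.measurableSet_top
  have hae : (fun y => ((s ∩ f ⁻¹' {y}).encard : ℝ≥0∞)) =ᵐ[μ] c := by
    filter_upwards [compl_mem_ae_iff.2 hnull] with y hy
    rw [hcount]
    congr 2
    ext x
    refine ⟨fun hx => ?_, fun hx => ⟨hsub1 hx.1, hx.2⟩⟩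
    rcases hunion ▸ hx.1 with h | h
    · exact ⟨h, hx.2⟩
    · exact absurd ⟨x, h, hx.2⟩ hy
  refine ⟨⟨c, hcm, hae⟩, fun g hg => ?_⟩
  have hzero : ∫⁻ x in s0, ENNReal.ofReal |(f' x).det| * g (f x) ∂μ = 0 := by
    rw [setLIntegral_congr_fun (g := fun _ => 0) hm0]
    · simp
    · intro x hx
      have : (f' x).det = 0 := hx.2
      simp [this]
  calc ∫⁻ x in s, ENNReal.ofReal |(f' x).det| * g (f x) ∂μ
      = ∫⁻ x in s1, ENNReal.ofReal |(f' x).det| * g (f x) ∂μ := by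
        conv_lhs => rw [hunion]
        rw [lintegral_union hm0 hdisj, hzero, add_zero]
    _ = ∑' i, ∫⁻ x in s1 ∩ t i, ENNReal.ofReal |(f' x).det| * g (f x) ∂μ := by
        conv_lhs => rw [hcover]
        rw [lintegral_iUnion hmt hpd]
    _ = ∑' i, ∫⁻ y in f '' (s1 ∩ t i), g y ∂μ := by
        refine tsum_congr fun i => ?_
        rw [lintegral_image_eq_lintegral_abs_det_fderiv_mul μ (hmt i) (hft i) (hinj i)]
    _ = ∑' i, ∫⁻ y, g y * (f '' (s1 ∩ t i)).indicator 1 y ∂μ := by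
        refine tsum_congr fun i => ?_
        rw [← lintegral_indicator (himg i)]
        refine lintegral_congr fun y => ?_
        by_cases hy : y ∈ f '' (s1 ∩ t i)
        · rw [Set.indicator_of_mem hy, Set.indicator_of_mem hy]; simp
        · rw [Set.indicator_of_notMem hy, Set.indicator_of_notMem hy]; simp
    _ = ∫⁻ y, g y * c y ∂μ := by
        simp only [hcdef, ← ENNReal.tsum_mul_left]
        exact (lintegral_tsum fun i =>
          (hg.mul (measurable_one.indicator (himg i))).aemeasurable).symm
    _ = _ := lintegral_congr_ae (by filter_upwards [hae] with y hy; rw [hy])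

end Area

/-! ### Integration over an ellipsoid -/

section Ellipsoid

/-- The function `|x|⁻ⁿ` on the closed unit ball, and `0` outside. -/
def ballWeight {ι : Type*} [Fintype ι] (n : ℕ) (x : ι → ℝ) : ℝ≥0∞ :=
  Set.indicator {x : ι → ℝ | √(∑ i, x i ^ 2) ≤ 1}
    (fun x => ENNReal.ofReal ((√(∑ i, x i ^ 2))⁻¹ ^ n)) x

theorem measurable_ballWeight {ι : Type*} [Fintype ι] (n : ℕ) :
    Measurable (ballWeight (ι := ι) n) := by
  have h : Measurable fun x : ι → ℝ => √(∑ i, x i ^ 2) := by fun_prop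
  refine Measurable.indicator (by fun_prop) ?_
  exact measurableSet_le h measurable_const

theorem ballWeight_reindex {ι κ : Type*} [Fintype ι] [Fintype κ] (n : ℕ) (e : ι ≃ κ) (x : κ → ℝ) :
    ballWeight n (fun i => x (e i)) = ballWeight n x := by
  simp only [ballWeight, Set.indicator, Set.mem_ofPred_eq]
  rw [e.sum_comp fun k => x k ^ 2]

theorem ballWeight_ne_zero {ι : Type*} [Fintype ι] {n : ℕ} {x : ι → ℝ} (hx : x ≠ 0)
    (hx1 : ∑ i, x i ^ 2 ≤ 1) : ballWeight n x ≠ 0 := by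
  have hpos : 0 < ∑ i, x i ^ 2 := by
    obtain ⟨i, hi⟩ := Function.ne_iff.1 hx
    exact Finset.sum_pos' (fun j _ => sq_nonneg _) ⟨i, Finset.mem_univ _, sq_pos_of_ne_zero hi⟩
  rw [ballWeight, Set.indicator_of_mem (Set.mem_ofPred_eq ▸ Real.sqrt_le_one.2 hx1)]
  have := Real.sqrt_pos.2 hpos
  simp only [ne_eq, ENNReal.ofReal_eq_zero, not_le]
  positivity

/-- Integration in polar coordinates: the sphere in dimension `n + (s + 1)` has `s + 1` times the
integral of `|x|⁻ⁿ` over the unit ball as its volume. -/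
theorem volume_ball_mul_eq (n s : ℕ) :
    ((s + 1 : ℕ) : ℝ≥0∞) * ∫⁻ x : Fin (n + (s + 1)) → ℝ, ballWeight n x =
      (volume : Measure (EuclideanSpace ℝ (Fin (n + (s + 1))))).toSphere Set.univ := by
  set E := EuclideanSpace ℝ (Fin (n + (s + 1)))
  have : Nontrivial E := by
    have : Nonempty (Fin (n + (s + 1))) := ⟨Fin.last _⟩
    infer_instance
  set f : ℝ → ℝ := (Set.Iic 1).indicator fun t => t⁻¹ ^ n with hf
  have hfin : Module.finrank ℝ E = n + (s + 1) := by simp [E]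
  have hpow : ∀ t ∈ Set.Ioi (0 : ℝ), t ^ (Module.finrank ℝ E - 1) • f t =
      (Set.Iic 1).indicator (fun t => t ^ s) t := by
    intro t ht
    have ht : t ≠ 0 := (Set.mem_Ioi.1 ht).ne'
    simp only [hf, Set.indicator, smul_eq_mul]
    split_ifs
    · rw [hfin, show n + (s + 1) - 1 = s + n by omega, pow_add, mul_assoc, ← mul_pow,
        mul_inv_cancel₀ ht, one_pow, mul_one]
    · simp
  have hinter : Set.Ioi (0 : ℝ) ∩ Set.Iic 1 = Set.Ioc 0 1 := rfl
  have hint : Integrable (fun x : E => f ‖x‖) volume := by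
    rw [integrable_fun_norm_addHaar, integrableOn_congr_fun hpow measurableSet_Ioi,
      IntegrableOn, integrable_indicator_iff measurableSet_Iic, IntegrableOn,
      Measure.restrict_restrict measurableSet_Iic, Set.inter_comm, hinter]
    exact (((continuous_pow s).integrableOn_Icc (a := 0) (b := 1)).mono_set Set.Ioc_subset_Icc_self)
  have hval : ∫ x : E, f ‖x‖ =
      (n + (s + 1) : ℕ) * volume.real (Metric.ball (0 : E) 1) / (s + 1) := by
    rw [integral_fun_norm_addHaar, setIntegral_congr_fun measurableSet_Ioi hpow,
      integral_indicator measurableSet_Iic, Measure.restrict_restrict measurableSet_Iic,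
      Set.inter_comm, hinter, ← intervalIntegral.integral_of_le zero_le_one, integral_pow, hfin]
    simp [div_eq_mul_inv, mul_assoc]
  have hlint : ∫⁻ x : Fin (n + (s + 1)) → ℝ, ballWeight n x =
      ENNReal.ofReal (∫ x : E, f ‖x‖) := by
    rw [ofReal_integral_eq_lintegral_ofReal hint
      (Filter.Eventually.of_forall fun x => Set.indicator_apply_nonneg fun _ => by positivity)]
    · rw [← (EuclideanSpace.volume_preserving_symm_measurableEquiv_toLp
        (Fin (n + (s + 1)))).lintegral_comp (measurable_ballWeight n)]
      refine lintegral_congr fun x => ?_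
      have hx : ‖x‖ = √(∑ i, x i ^ 2) := by
        rw [EuclideanSpace.norm_eq]
        simp
      simp only [ballWeight, hf, hx]
      change Set.indicator {y : Fin (n + (s + 1)) → ℝ | √(∑ i, y i ^ 2) ≤ 1} _ (fun i => x i) = _
      by_cases h : √(∑ i, x i ^ 2) ≤ 1
      · rw [Set.indicator_of_mem (by exact h), Set.indicator_of_mem (by exact h)]
      · rw [Set.indicator_of_notMem (by exact h), Set.indicator_of_notMem (by exact h)]
        simp
  rw [hlint, hval, Measure.toSphere_apply_univ, hfin, ← ENNReal.ofReal_natCast,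
    ← ENNReal.ofReal_mul (by positivity)]
  have : ((s + 1 : ℕ) : ℝ) * ((n + (s + 1) : ℕ) * volume.real (Metric.ball (0 : E) 1) / (s + 1)) =
      (n + (s + 1) : ℕ) * volume.real (Metric.ball (0 : E) 1) := by
    push_cast
    field_simp
  rw [this, ENNReal.ofReal_mul (by positivity), ENNReal.ofReal_natCast, Measure.real,
    ENNReal.ofReal_toReal measure_ball_lt_top.ne]

variable {V : Type*} [AddCommGroup V] [Module ℝ V]

/-- Integration of a homogeneous function of degree `n` over the ellipsoid `∑ (l i)² = 1` in terms
of the solid ellipsoid. -/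
theorem lintegral_ellipsoidMeasure {k d n : ℕ} {ι : Type*} [Fintype ι]
    (vol : (⋀[ℝ]^k V) [⋀^Fin d]→ₗ[ℝ] ℝ) (l : ι → Module.Dual ℝ (⋀[ℝ]^k V))
    (hnull : formMeasure vol {η | ∀ i, l i η = 0} = 0) {h : ⋀[ℝ]^k V → ℝ≥0∞} (hh : Measurable h)
    (hom : ∀ (c : ℝ) η, 0 < c → h (c • η) = ENNReal.ofReal (c ^ n) * h η) :
    ∫⁻ η, h η ∂(ellipsoidMeasure vol {η | ∑ i, l i η ^ 2 = 1}) =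
      d * ∫⁻ η, ballWeight n (fun i => l i η) * h η ∂(formMeasure vol) := by
  set q : ⋀[ℝ]^k V → ℝ := fun η => √(∑ i, l i η ^ 2) with hq
  have hqm : Measurable q := by
    have := fun i => measurable_dual (l i)
    fun_prop
  have hql : ∀ (c : ℝ) η, 0 ≤ c → q (c • η) = c * q η := by
    intro c η hc
    simp only [hq, map_smul, smul_eq_mul, mul_pow, ← Finset.mul_sum]
    rw [Real.sqrt_mul (sq_nonneg c), Real.sqrt_sq hc]
  have hq1 : ∀ η, ∑ i, l i η ^ 2 = 1 ↔ q η = 1 := fun η => by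
    rw [hq, Real.sqrt_eq_one]
  have hqpos : ∀ᵐ η ∂(formMeasure vol), 0 < q η := by
    filter_upwards [compl_mem_ae_iff.2 hnull] with η hη
    refine Real.sqrt_pos.2 ?_
    simp only [Set.mem_compl_iff, Set.mem_ofPred_eq, not_forall] at hη
    obtain ⟨i, hi⟩ := hη
    exact Finset.sum_pos' (fun j _ => sq_nonneg _) ⟨i, Finset.mem_univ _, by positivity⟩
  set solid : Set (⋀[ℝ]^k V) :=
    {x | ∃ t ∈ Set.Icc (0 : ℝ) 1, ∃ η ∈ {η | ∑ i, l i η ^ 2 = 1}, x = t • η} with hsolid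
  have hmem : ∀ x, 0 < q x → (x ∈ solid ↔ q x ≤ 1) := by
    intro x hx
    constructor
    · rintro ⟨t, ht, η, hη, rfl⟩
      rw [hql t η ht.1, (hq1 η).1 hη, mul_one]
      exact ht.2
    · intro hx1
      refine ⟨q x, ⟨hx.le, hx1⟩, (q x)⁻¹ • x, (hq1 _).2 ?_, ?_⟩
      · rw [hql _ _ (inv_nonneg.2 hx.le), inv_mul_cancel₀ hx.ne']
      · rw [smul_smul, mul_inv_cancel₀ hx.ne', one_smul]
  have hgauge : ∀ x, 0 < q x → gauge solid x = q x := by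
    intro x hx
    rw [gauge_def']
    have : {r : ℝ | r ∈ Set.Ioi 0 ∧ r⁻¹ • x ∈ solid} = Set.Ici (q x) := by
      ext r
      simp only [Set.mem_ofPred_eq, Set.mem_Ioi, Set.mem_Ici]
      constructor
      · rintro ⟨hr, hrx⟩
        rw [hmem _ (by rw [hql _ _ (inv_nonneg.2 hr.le)]; positivity),
          hql _ _ (inv_nonneg.2 hr.le)] at hrx
        rwa [inv_mul_le_iff₀ hr, mul_one] at hrx
      · intro hr
        have hr0 : 0 < r := hx.trans_le hr
        refine ⟨hr0, ?_⟩
        rw [hmem _ (by rw [hql _ _ (inv_nonneg.2 hr0.le)]; positivity),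
          hql _ _ (inv_nonneg.2 hr0.le)]
        rwa [inv_mul_le_iff₀ hr0, mul_one]
    rw [this, csInf_Ici]
  have hrm : Measurable fun x => (q x)⁻¹ • x := by
    rw [measurable_exteriorPower_iff]
    intro l'
    simp only [map_smul, smul_eq_mul]
    exact hqm.inv.mul (measurable_dual l')
  have hball : MeasurableSet {x | q x ≤ 1} := measurableSet_le hqm measurable_const
  have hsae : solid =ᵐ[formMeasure vol] {x | q x ≤ 1} := by
    filter_upwards [hqpos] with x hx
    exact propext (hmem x hx)
  have hgae : (fun x => (gauge solid x)⁻¹ • x) =ᵐ[(formMeasure vol).restrict solid]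
      fun x => (q x)⁻¹ • x := by
    filter_upwards [ae_restrict_of_ae hqpos] with x hx
    rw [hgauge x hx]
  change ∫⁻ η, h η ∂((d : ℝ≥0∞) • ((formMeasure vol).restrict solid).map
    fun x => (gauge solid x)⁻¹ • x) = _
  rw [lintegral_smul_measure, Measure.map_congr hgae, lintegral_map hh hrm,
    setLIntegral_congr hsae, ← lintegral_indicator hball, smul_eq_mul]
  congr 1
  refine lintegral_congr_ae ?_
  filter_upwards [hqpos] with x hx
  by_cases hx1 : q x ≤ 1
  · rw [Set.indicator_of_mem (show x ∈ {x | q x ≤ 1} from hx1), ballWeight,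
      Set.indicator_of_mem (show (fun i => l i x) ∈ {x : ι → ℝ | √(∑ i, x i ^ 2) ≤ 1} from hx1),
      hom _ _ (inv_pos.2 hx)]
  · rw [Set.indicator_of_notMem (show x ∉ {x | q x ≤ 1} from hx1), ballWeight,
      Set.indicator_of_notMem (show (fun i => l i x) ∉ {x : ι → ℝ | √(∑ i, x i ^ 2) ≤ 1} from hx1),
      zero_mul]

end Ellipsoid

/-! ### The measure of a volume form in charts -/

theorem alternatingMap_comp_linearMap {W : Type*} [AddCommGroup W] [Module ℝ W] {n : ℕ}
    (b : Module.Basis (Fin n) ℝ W) (ψ : W [⋀^Fin n]→ₗ[ℝ] ℝ) (T : W →ₗ[ℝ] W) (v : Fin n → W) :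
    ψ (fun i => T (v i)) = LinearMap.det T * ψ v := by
  rw [AlternatingMap.eq_smul_basis_det b ψ]
  have := b.det_comp T v
  simp only [AlternatingMap.smul_apply, smul_eq_mul]
  rw [show (fun i => T (v i)) = T ∘ v from rfl, this]
  ring

section Manifold

variable {n : ℕ} {M : Type*} [TopologicalSpace M] [ChartedSpace (EuclideanSpace ℝ (Fin n)) M]

/-- The component `θ (∂₁, …, ∂ₙ)` of a volume form in the preferred chart at `x`. -/
def chartDensity (θ : ∀ p : M, TangentSpace (𝓡 n) p [⋀^Fin n]→ₗ[ℝ] ℝ) (x : M)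
    (y : EuclideanSpace ℝ (Fin n)) : ℝ :=
  θ ((chartAt (EuclideanSpace ℝ (Fin n)) x).symm y) fun i =>
    mfderiv (𝓡 n) (𝓡 n) (chartAt (EuclideanSpace ℝ (Fin n)) x).symm y
      (EuclideanSpace.single i (1 : ℝ))

/-- The measure `|θ|` on the domain of the preferred chart at `x`. -/
def chartMeasure [MeasurableSpace M]
    (θ : ∀ p : M, TangentSpace (𝓡 n) p [⋀^Fin n]→ₗ[ℝ] ℝ) (x : M) : Measure M :=
  ((volume.restrict (chartAt (EuclideanSpace ℝ (Fin n)) x).target).withDensity fun y =>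
    ENNReal.ofReal |chartDensity θ x y|).map (chartAt (EuclideanSpace ℝ (Fin n)) x).symm

theorem volumeMeasure_eq_iSup [MeasurableSpace M]
    (θ : ∀ p : M, TangentSpace (𝓡 n) p [⋀^Fin n]→ₗ[ℝ] ℝ) :
    volumeMeasure θ = ⨆ x, chartMeasure θ x := rfl

variable [MeasurableSpace M] [BorelSpace M]
  (θ : ∀ p : M, TangentSpace (𝓡 n) p [⋀^Fin n]→ₗ[ℝ] ℝ)

theorem lintegral_chartMeasure (x : M) (G : M → ℝ≥0∞) :
    ∫⁻ p, G p ∂(chartMeasure θ x) =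
      ∫⁻ y, G ((chartAt (EuclideanSpace ℝ (Fin n)) x).symm y)
        ∂((volume.restrict (chartAt (EuclideanSpace ℝ (Fin n)) x).target).withDensity fun y =>
          ENNReal.ofReal |chartDensity θ x y|) := by
  set φ := chartAt (EuclideanSpace ℝ (Fin n)) x
  set ν := (volume.restrict φ.target).withDensity fun y => ENNReal.ofReal |chartDensity θ x y|
    with hν
  have hT : MeasurableSet φ.target := φ.open_target.measurableSet
  have hνT : ν.restrict φ.target = ν := by
    rw [hν, restrict_withDensity hT, Measure.restrict_restrict hT, Set.inter_self]
  have he : MeasurableEmbedding fun t : φ.target => φ.symm t := by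
    refine Topology.IsOpenEmbedding.measurableEmbedding ?_
    have := φ.symm.toHomeomorphSourceTarget
    refine ((φ.open_source).isOpenEmbedding_subtypeVal).comp
      (φ.symm.toHomeomorphSourceTarget.isOpenEmbedding)
  have hemb := MeasurableEmbedding.subtype_coe hT
  have h1 : chartMeasure θ x = (ν.comap ((↑) : φ.target → _)).map fun t : φ.target => φ.symm t := by
    have h2 : ν = (ν.comap ((↑) : φ.target → _)).map (↑) := by
      rw [hemb.map_comap, Subtype.range_coe, hνT]
    have hae : AEMeasurable φ.symm ν := by
      rw [← hνT]
      exact φ.continuousOn_symm.aemeasurable hT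
    have h3 := AEMeasurable.map_map_of_aemeasurable (μ := ν.comap ((↑) : φ.target → _))
      (f := ((↑) : φ.target → _)) (g := φ.symm) (h2 ▸ hae) hemb.measurable.aemeasurable
    rw [← h2] at h3
    exact h3
  rw [h1, he.lintegral_map]
  conv_rhs => rw [← hνT]
  rw [← hemb.lintegral_map (fun y => G (φ.symm y)), hemb.map_comap, Subtype.range_coe]

theorem measurableSet_chart_symm_preimage (x : M) {B : Set M} (hB : MeasurableSet B) :
    MeasurableSet ((chartAt (EuclideanSpace ℝ (Fin n)) x).target ∩
      (chartAt (EuclideanSpace ℝ (Fin n)) x).symm ⁻¹' B) := by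
  set φ := chartAt (EuclideanSpace ℝ (Fin n)) x
  have h := (continuousOn_iff_continuous_domRestrict.1 φ.continuousOn_symm).measurable hB
  have h2 := φ.open_target.measurableSet.subtype_image h
  convert h2 using 1
  ext y
  simp [and_comm]

/-- Integration over a piece of a coordinate domain, for functions `G` which need not be measurable:
this is why the density stays part of the measure. -/
theorem setLIntegral_chartMeasure_withDensity (x : M) {B : Set M} (hB : MeasurableSet B)
    (G : M → ℝ≥0∞) :
    ∫⁻ p in B, G p ∂(chartMeasure θ x) =
      ∫⁻ y, G ((chartAt (EuclideanSpace ℝ (Fin n)) x).symm y)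
        ∂((volume.restrict ((chartAt (EuclideanSpace ℝ (Fin n)) x).target ∩
          (chartAt (EuclideanSpace ℝ (Fin n)) x).symm ⁻¹' B)).withDensity fun y =>
            ENNReal.ofReal |chartDensity θ x y|) := by
  have hm := measurableSet_chart_symm_preimage (n := n) x hB
  set φ := chartAt (EuclideanSpace ℝ (Fin n)) x
  rw [← lintegral_indicator hB, lintegral_chartMeasure]
  set ν := (volume.restrict φ.target).withDensity fun y => ENNReal.ofReal |chartDensity θ x y|
    with hν
  have hT : MeasurableSet φ.target := φ.open_target.measurableSet
  have hνT : ν.restrict φ.target = ν := by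
    rw [hν, restrict_withDensity hT, Measure.restrict_restrict hT, Set.inter_self]
  have h1 : ∫⁻ y, B.indicator G (φ.symm y) ∂ν =
      ∫⁻ y in φ.target ∩ φ.symm ⁻¹' B, G (φ.symm y) ∂ν := by
    rw [← lintegral_indicator hm, ← hνT, ← lintegral_indicator hT, ← lintegral_indicator hT]
    refine lintegral_congr fun y => ?_
    by_cases hy : y ∈ φ.target <;> by_cases hy' : φ.symm y ∈ B <;>
      simp [Set.indicator, hy, hy']
  rw [h1, hν, restrict_withDensity hm, Measure.restrict_restrict hm,
    Set.inter_eq_left.2 Set.inter_subset_left]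

theorem setLIntegral_chartMeasure (x : M) {B : Set M} (hB : MeasurableSet B) (G : M → ℝ≥0∞)
    (hd : AEMeasurable (chartDensity θ x)
      (volume.restrict ((chartAt (EuclideanSpace ℝ (Fin n)) x).target ∩
        (chartAt (EuclideanSpace ℝ (Fin n)) x).symm ⁻¹' B))) :
    ∫⁻ p in B, G p ∂(chartMeasure θ x) =
      ∫⁻ y in (chartAt (EuclideanSpace ℝ (Fin n)) x).target ∩
          (chartAt (EuclideanSpace ℝ (Fin n)) x).symm ⁻¹' B,
        ENNReal.ofReal |chartDensity θ x y| *
          G ((chartAt (EuclideanSpace ℝ (Fin n)) x).symm y) := by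
  rw [setLIntegral_chartMeasure_withDensity θ x hB,
    lintegral_withDensity_eq_lintegral_mul_non_measurable₀]
  · rfl
  · fun_prop
  · simp

theorem chartMeasure_apply (x : M) {B : Set M} (hB : MeasurableSet B) :
    chartMeasure θ x B = ∫⁻ y in (chartAt (EuclideanSpace ℝ (Fin n)) x).target ∩
          (chartAt (EuclideanSpace ℝ (Fin n)) x).symm ⁻¹' B,
        ENNReal.ofReal |chartDensity θ x y| := by
  rw [← setLIntegral_one, setLIntegral_chartMeasure_withDensity θ x hB, lintegral_one,
    withDensity_apply _ MeasurableSet.univ, Measure.restrict_univ]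

variable [IsManifold (𝓡 n) ∞ M]

omit [MeasurableSpace M] [BorelSpace M] in
/-- The transformation rule of the component of a volume form under a change of charts. -/
theorem chartDensity_transform (x x' : M) {z : EuclideanSpace ℝ (Fin n)}
    (hz : z ∈ (chartAt (EuclideanSpace ℝ (Fin n)) x).target)
    (hz' : (chartAt (EuclideanSpace ℝ (Fin n)) x).symm z ∈
      (chartAt (EuclideanSpace ℝ (Fin n)) x').source) :
    DifferentiableAt ℝ (chartAt (EuclideanSpace ℝ (Fin n)) x' ∘
        (chartAt (EuclideanSpace ℝ (Fin n)) x).symm) z ∧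
      chartDensity θ x z =
        (fderiv ℝ (chartAt (EuclideanSpace ℝ (Fin n)) x' ∘
          (chartAt (EuclideanSpace ℝ (Fin n)) x).symm) z).det *
        chartDensity θ x' (chartAt (EuclideanSpace ℝ (Fin n)) x'
          ((chartAt (EuclideanSpace ℝ (Fin n)) x).symm z)) := by
  have : IsManifold (𝓡 n) 1 M := .of_le (n := ∞) (by norm_cast)
  set φ := chartAt (EuclideanSpace ℝ (Fin n)) x with hφ
  set ψ := chartAt (EuclideanSpace ℝ (Fin n)) x' with hψ
  have hφd : MDifferentiableAt (𝓡 n) (𝓡 n) φ.symm z :=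
    mdifferentiableAt_atlas_symm (chart_mem_atlas _ _) hz
  have hψd : MDifferentiableAt (𝓡 n) (𝓡 n) ψ (φ.symm z) :=
    mdifferentiableAt_atlas (chart_mem_atlas _ _) hz'
  have hψsd : MDifferentiableAt (𝓡 n) (𝓡 n) ψ.symm (ψ (φ.symm z)) :=
    mdifferentiableAt_atlas_symm (chart_mem_atlas _ _) (ψ.map_source hz')
  have hτ : MDifferentiableAt (𝓡 n) (𝓡 n) (ψ ∘ φ.symm) z := hψd.comp z hφd
  refine ⟨mdifferentiableAt_iff_differentiableAt.1 hτ, ?_⟩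
  have heq : φ.symm =ᶠ[nhds z] ψ.symm ∘ (ψ ∘ φ.symm) := by
    have h1 : φ.target ∩ φ.symm ⁻¹' ψ.source ∈ nhds z :=
      (φ.isOpen_inter_preimage_symm ψ.open_source).mem_nhds ⟨hz, hz'⟩
    filter_upwards [h1] with y hy
    exact (ψ.left_inv hy.2).symm
  have hder : ∀ v : EuclideanSpace ℝ (Fin n),
      (mfderiv (𝓡 n) (𝓡 n) φ.symm z v : EuclideanSpace ℝ (Fin n)) =
      (mfderiv (𝓡 n) (𝓡 n) ψ.symm (ψ (φ.symm z)) (fderiv ℝ (ψ ∘ φ.symm) z v) :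
        EuclideanSpace ℝ (Fin n)) := by
    intro v
    have h2 : mfderiv (𝓡 n) (𝓡 n) φ.symm z = mfderiv (𝓡 n) (𝓡 n) (ψ.symm ∘ (ψ ∘ φ.symm)) z :=
      heq.mfderiv_eq
    have h3 := mfderiv_comp_apply z (g := ψ.symm) (f := ψ ∘ φ.symm) hψsd hτ v
    rw [mfderiv_eq_fderiv (f := ψ ∘ φ.symm)] at h3
    exact (congrArg (fun L : EuclideanSpace ℝ (Fin n) →L[ℝ] EuclideanSpace ℝ (Fin n) => L v)
      h2).trans h3
  have hcongr : ∀ {p q : M} (_ : p = q) (v : Fin n → EuclideanSpace ℝ (Fin n)),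
      θ p v = θ q v := by
    rintro p q rfl v
    rfl
  have key := alternatingMap_comp_linearMap (EuclideanSpace.basisFun (Fin n) ℝ).toBasis
    ((θ (ψ.symm (ψ (φ.symm z)))).compLinearMap
      (mfderiv (𝓡 n) (𝓡 n) ψ.symm (ψ (φ.symm z))).toLinearMap)
    (fderiv ℝ (ψ ∘ φ.symm) z).toLinearMap fun i => EuclideanSpace.single i (1 : ℝ)
  refine Eq.trans ?_ key
  refine (hcongr (ψ.left_inv hz').symm _).trans ?_
  refine congrArg (θ (ψ.symm (ψ (φ.symm z)))) ?_
  funext i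
  exact hder _

theorem chartMeasure_apply_eq (x x' : M) {B : Set M} (hB : MeasurableSet B)
    (hx : B ⊆ (chartAt (EuclideanSpace ℝ (Fin n)) x).source)
    (hx' : B ⊆ (chartAt (EuclideanSpace ℝ (Fin n)) x').source) :
    chartMeasure θ x B = chartMeasure θ x' B := by
  rw [chartMeasure_apply θ x hB, chartMeasure_apply θ x' hB]
  have hm := measurableSet_chart_symm_preimage (n := n) x hB
  have htr := fun z hz hz' => chartDensity_transform θ x x' (z := z) hz hz'
  set φ := chartAt (EuclideanSpace ℝ (Fin n)) x with hφ
  set ψ := chartAt (EuclideanSpace ℝ (Fin n)) x' with hψ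
  have himg : ψ.target ∩ ψ.symm ⁻¹' B = (ψ ∘ φ.symm) '' (φ.target ∩ φ.symm ⁻¹' B) := by
    ext y
    constructor
    · rintro ⟨hy, hyB⟩
      refine ⟨φ (ψ.symm y), ⟨φ.map_source (hx hyB), ?_⟩, ?_⟩
      · rwa [Set.mem_preimage, φ.left_inv (hx hyB)]
      · rw [Function.comp_apply, φ.left_inv (hx hyB), ψ.right_inv hy]
    · rintro ⟨z, ⟨hz, hzB⟩, rfl⟩
      refine ⟨ψ.map_source (hx' hzB), ?_⟩
      rwa [Set.mem_preimage, Function.comp_apply, ψ.left_inv (hx' hzB)]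
  have hinj : Set.InjOn (ψ ∘ φ.symm) (φ.target ∩ φ.symm ⁻¹' B) := by
    rintro z ⟨hz, hzB⟩ z' ⟨hz', hzB'⟩ h
    exact φ.symm.injOn hz hz' (ψ.injOn (hx' hzB) (hx' hzB') h)
  rw [himg, lintegral_image_eq_lintegral_abs_det_fderiv_mul volume hm
    (f' := fun z => fderiv ℝ (ψ ∘ φ.symm) z)
    (fun z hz => (htr z hz.1 (hx' hz.2)).1.hasFDerivAt.hasFDerivWithinAt) hinj]
  refine setLIntegral_congr_fun hm fun z hz => ?_
  rw [(htr z hz.1 (hx' hz.2)).2, abs_mul, ENNReal.ofReal_mul (abs_nonneg _)]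
  rfl

/-- The measure `|θ|` can be computed chart by chart. -/
theorem lintegral_volumeMeasure {κ : Type*} [Fintype κ] (x : κ → M) (B : κ → Set M)
    (hB : ∀ i, MeasurableSet (B i)) (hd : Pairwise (Function.onFun Disjoint B))
    (hcover : ⋃ i, B i = Set.univ)
    (hsub : ∀ i, B i ⊆ (chartAt (EuclideanSpace ℝ (Fin n)) (x i)).source) (G : M → ℝ≥0∞) :
    ∫⁻ p, G p ∂(volumeMeasure θ) = ∑ i, ∫⁻ p in B i, G p ∂(chartMeasure θ (x i)) := by
  have hdecomp : ∀ μ : Measure M, μ = ∑ i, μ.restrict (B i) := by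
    intro μ
    conv_lhs => rw [← Measure.restrict_univ (μ := μ), ← hcover, Measure.restrict_iUnion hd hB]
    exact Measure.sum_fintype _
  have hle : ∀ y : M, ∀ i, (chartMeasure θ y).restrict (B i) ≤
      (chartMeasure θ (x i)).restrict (B i) := by
    intro y i
    refine Measure.le_iff.2 fun A hA => ?_
    rw [Measure.restrict_apply hA, Measure.restrict_apply hA]
    set C : Set M := A ∩ B i ∩ (chartAt (EuclideanSpace ℝ (Fin n)) y).source
    have hCm : MeasurableSet C :=
      (hA.inter (hB i)).inter (chartAt (EuclideanSpace ℝ (Fin n)) y).open_source.measurableSet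
    have h1 : chartMeasure θ y (A ∩ B i) = chartMeasure θ y C := by
      rw [chartMeasure_apply θ y (hA.inter (hB i)), chartMeasure_apply θ y hCm]
      congr 2
      ext z
      simp only [C, Set.mem_inter_iff, Set.mem_preimage]
      refine ⟨fun h => ⟨h.1, h.2, ?_⟩, fun h => ⟨h.1, h.2.1⟩⟩
      exact (chartAt (EuclideanSpace ℝ (Fin n)) y).map_target h.1
    rw [h1, chartMeasure_apply_eq θ y (x i) hCm Set.inter_subset_right
      fun p hp => hsub i hp.1.2]
    exact measure_mono Set.inter_subset_left
  have heq : volumeMeasure θ = ∑ i, (chartMeasure θ (x i)).restrict (B i) := by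
    apply le_antisymm
    · rw [volumeMeasure_eq_iSup]
      refine iSup_le fun y => ?_
      rw [hdecomp (chartMeasure θ y)]
      exact Finset.sum_le_sum fun i _ => hle y i
    · rw [hdecomp (volumeMeasure θ)]
      refine Finset.sum_le_sum fun i _ => Measure.restrict_mono le_rfl ?_
      rw [volumeMeasure_eq_iSup]
      exact le_iSup (chartMeasure θ) (x i)
  rw [heq, lintegral_finsetSum_measure]

end Manifold

/-! ### The conormal map of a moving frame -/

section MovingFrame

variable {α β : Type*} [Fintype α] [Fintype β] [DecidableEq α] [DecidableEq β]

theorem contDiffOn_det {E ι : Type*} [NormedAddCommGroup E] [NormedSpace ℝ E] [Fintype ι]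
    [DecidableEq ι] {A : E → Matrix ι ι ℝ} {W : Set E} {N : WithTop ℕ∞}
    (hA : ∀ i k, ContDiffOn ℝ N (fun y => A y i k) W) :
    ContDiffOn ℝ N (fun y => (A y).det) W := by
  simp only [Matrix.det_apply]
  exact ContDiffOn.sum fun σ _ => (contDiffOn_prod fun i _ => hA _ _).const_smul _

theorem contDiffOn_matrix_inv {E ι : Type*} [NormedAddCommGroup E] [NormedSpace ℝ E] [Fintype ι]
    [DecidableEq ι] {A : E → Matrix ι ι ℝ} {W : Set E} {N : WithTop ℕ∞}
    (hA : ∀ i k, ContDiffOn ℝ N (fun y => A y i k) W) (hdet : ∀ y ∈ W, (A y).det ≠ 0) (i k : ι) :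
    ContDiffOn ℝ N (fun y => (A y)⁻¹ i k) W := by
  have h : ∀ y, (A y)⁻¹ i k = ((A y).det)⁻¹ * ((A y).updateRow k (Pi.single i 1)).det := by
    intro y
    rw [Matrix.inv_def, Ring.inverse_eq_inv', Matrix.smul_apply, smul_eq_mul,
      Matrix.adjugate_apply]
  simp only [h]
  refine ((contDiffOn_det hA).inv hdet).mul (contDiffOn_det fun i' k' => ?_)
  by_cases h : i' = k
  · subst h
    simpa using contDiffOn_const
  · simpa [Matrix.updateRow_ne h] using hA i' k'

/-- The first block of coordinates, as a point of Euclidean space. -/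
def basePoint (α β : Type*) [Fintype α] [Fintype β] : (α ⊕ β → ℝ) →L[ℝ] EuclideanSpace ℝ α :=
  (PiLp.continuousLinearEquiv 2 ℝ fun _ : α => ℝ).symm.toContinuousLinearMap ∘L
    ContinuousLinearMap.pi fun i => ContinuousLinearMap.proj (Sum.inl i)

/-- The conormal map of a moving frame `A`, given by the rows of a matrix: at the base point `y`,
the covector with values `0` on the first block of rows and `c` on the second one. -/
def conormalMap (A : EuclideanSpace ℝ α → Matrix (α ⊕ β) (α ⊕ β) ℝ) (x : α ⊕ β → ℝ) :
    α ⊕ β → ℝ :=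
  (A (basePoint α β x))⁻¹.mulVec (Sum.elim (0 : α → ℝ) fun j => x (Sum.inr j))

variable {A : EuclideanSpace ℝ α → Matrix (α ⊕ β) (α ⊕ β) ℝ} {W : Set (EuclideanSpace ℝ α)}

theorem contDiffOn_conormalMap (hA : ∀ i k, ContDiffOn ℝ 1 (fun y => A y i k) W)
    (hdet : ∀ y ∈ W, (A y).det ≠ 0) :
    ContDiffOn ℝ 1 (conormalMap A) (basePoint α β ⁻¹' W) := by
  rw [contDiffOn_pi]
  intro k
  simp only [conormalMap, Matrix.mulVec, dotProduct]
  refine ContDiffOn.sum fun l _ => ContDiffOn.mul ?_ ?_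
  · exact (contDiffOn_matrix_inv hA hdet k l).comp (basePoint α β).contDiff.contDiffOn
      fun x hx => hx
  · rcases l with l | l
    · exact contDiffOn_const
    · exact (contDiff_apply ℝ ℝ (Sum.inr l)).contDiffOn

theorem conormalMap_spec {x : α ⊕ β → ℝ} (hdet : (A (basePoint α β x)).det ≠ 0) (ℓ : α ⊕ β → ℝ) :
    conormalMap A x = ℓ ↔
      (A (basePoint α β x)).mulVec ℓ = Sum.elim (0 : α → ℝ) fun j => x (Sum.inr j) := by
  have hu : IsUnit (A (basePoint α β x)).det := isUnit_iff_ne_zero.2 hdet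
  constructor
  · rintro rfl
    rw [conormalMap, Matrix.mulVec_mulVec, Matrix.mul_nonsing_inv _ hu, Matrix.one_mulVec]
  · intro h
    rw [conormalMap, ← h, Matrix.mulVec_mulVec, Matrix.nonsing_inv_mul _ hu, Matrix.one_mulVec]

/-- The Jacobian of the conormal map. It is found by differentiating `A · conormalMap A = (0, c)`,
which makes `A` times the Jacobian matrix block triangular. -/
theorem det_mul_det_fderiv_conormalMap (hW : IsOpen W)
    (hA : ∀ i k, ContDiffOn ℝ 1 (fun y => A y i k) W) (hdet : ∀ y ∈ W, (A y).det ≠ 0)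
    {x : α ⊕ β → ℝ} (hx : basePoint α β x ∈ W) :
    (A (basePoint α β x)).det * (fderiv ℝ (conormalMap A) x).det =
      (Matrix.of fun i j : α => -∑ k, fderiv ℝ (fun y => A y (Sum.inl i) k) (basePoint α β x)
        (EuclideanSpace.single j 1) * conormalMap A x k).det := by
  have hW' : IsOpen (basePoint α β ⁻¹' W) := hW.preimage (basePoint α β).continuous
  have hG : DifferentiableAt ℝ (conormalMap A) x :=
    ((contDiffOn_conormalMap hA hdet).differentiableOn one_ne_zero).differentiableAt
      (hW'.mem_nhds hx)
  have hAd : ∀ i k, DifferentiableAt ℝ (fun y => A y i k) (basePoint α β x) := fun i k =>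
    ((hA i k).differentiableOn one_ne_zero).differentiableAt (hW.mem_nhds hx)
  set J : Matrix (α ⊕ β) (α ⊕ β) ℝ :=
    LinearMap.toMatrix' (fderiv ℝ (conormalMap A) x).toLinearMap with hJ
  have hJdet : J.det = (fderiv ℝ (conormalMap A) x).det := LinearMap.det_toMatrix' _
  have hGk : ∀ k, HasFDerivAt (fun x => conormalMap A x k)
      ((ContinuousLinearMap.proj k).comp (fderiv ℝ (conormalMap A) x)) x := fun k =>
    (hasFDerivAt_pi'.1 hG.hasFDerivAt) k
  have hrow : ∀ i, HasFDerivAt (fun x => ∑ k, A (basePoint α β x) i k * conormalMap A x k)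
      (∑ k, (A (basePoint α β x) i k •
        ((ContinuousLinearMap.proj k).comp (fderiv ℝ (conormalMap A) x)) +
        conormalMap A x k • (fderiv ℝ (fun y => A y i k) (basePoint α β x)).comp
          (basePoint α β))) x := fun i =>
    HasFDerivAt.fun_sum fun k _ =>
      ((hAd i k).hasFDerivAt.comp x (basePoint α β).hasFDerivAt).mul (hGk k)
  have hrow' : ∀ i, (fun x => ∑ k, A (basePoint α β x) i k * conormalMap A x k) =ᶠ[nhds x]
      fun x => (Sum.elim (0 : α → ℝ) fun j => x (Sum.inr j) : α ⊕ β → ℝ) i := by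
    intro i
    filter_upwards [hW'.mem_nhds hx] with z hz
    exact congrFun ((conormalMap_spec (hdet _ hz) _).1 rfl) i
  have hent : ∀ i j, (A (basePoint α β x) * J) i j =
      fderiv ℝ (fun x => (Sum.elim (0 : α → ℝ) fun j => x (Sum.inr j) : α ⊕ β → ℝ) i) x
          (Pi.single j 1) -
        ∑ k, fderiv ℝ (fun y => A y i k) (basePoint α β x) (basePoint α β (Pi.single j 1)) *
          conormalMap A x k := by
    intro i j
    rw [← (hrow' i).fderiv_eq, (hrow i).fderiv, Matrix.mul_apply]
    simp only [sum_apply, add_apply,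
      smul_apply, ContinuousLinearMap.comp_apply, smul_eq_mul,
      Finset.sum_add_distrib, ContinuousLinearMap.proj_apply, hJ, LinearMap.toMatrix'_apply]
    simp [mul_comm]
  have hb1 : ∀ j : α, basePoint α β (Pi.single (Sum.inl j) 1) = EuclideanSpace.single j 1 := by
    intro j
    ext i
    simp [basePoint, Pi.single_apply]
  have hb2 : ∀ j : β, basePoint α β (Pi.single (Sum.inr j) 1) = 0 := by
    intro j
    ext i
    simp [basePoint]
  have hblock : A (basePoint α β x) * J = Matrix.fromBlocks
      (Matrix.of fun i j : α => -∑ k, fderiv ℝ (fun y => A y (Sum.inl i) k) (basePoint α β x)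
        (EuclideanSpace.single j 1) * conormalMap A x k) 0
      (Matrix.of fun (i : β) (j : α) => (A (basePoint α β x) * J) (Sum.inr i) (Sum.inl j)) 1 := by
    ext i j
    rcases i with i | i <;> rcases j with j | j
    · rw [hent, hb1]
      simp
    · rw [hent, hb2]
      simp
    · simp
    · rw [hent, hb2]
      have : fderiv ℝ (fun x : α ⊕ β → ℝ => x (Sum.inr i)) x =
          ContinuousLinearMap.proj (Sum.inr i) :=
        (ContinuousLinearMap.proj (R := ℝ) (φ := fun _ : α ⊕ β => ℝ) (Sum.inr i)).fderiv
      simp [this, Matrix.one_apply, Pi.single_apply]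
  rw [← hJdet, ← Matrix.det_mul, hblock, Matrix.det_fromBlocks_zero₁₂, Matrix.det_one, mul_one]

end MovingFrame

/-! ### Derivatives in a chart -/

section Charts

variable {n : ℕ} {M : Type*} [TopologicalSpace M] [ChartedSpace (EuclideanSpace ℝ (Fin n)) M]
  [IsManifold (𝓡 n) ∞ M] {V : Type*} [NormedAddCommGroup V] [NormedSpace ℝ V]

theorem contDiffOn_comp_chart_symm {g : M → V} (hg : ContMDiff (𝓡 n) 𝓘(ℝ, V) ∞ g) (x : M) :
    ContDiffOn ℝ ∞ (g ∘ (chartAt (EuclideanSpace ℝ (Fin n)) x).symm)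
      (chartAt (EuclideanSpace ℝ (Fin n)) x).target := by
  rw [← contMDiffOn_iff_contDiffOn]
  exact hg.comp_contMDiffOn contMDiffOn_chart_symm

theorem mdifferentiableAt_chart {x p : M}
    (hp : p ∈ (chartAt (EuclideanSpace ℝ (Fin n)) x).source) :
    MDifferentiableAt (𝓡 n) (𝓡 n) (chartAt (EuclideanSpace ℝ (Fin n)) x) p :=
  have : IsManifold (𝓡 n) 1 M := .of_le (n := ∞) (by norm_cast)
  mdifferentiableAt_atlas (chart_mem_atlas _ _) hp

theorem mdifferentiableAt_chart_symm {x : M} {y : EuclideanSpace ℝ (Fin n)}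
    (hy : y ∈ (chartAt (EuclideanSpace ℝ (Fin n)) x).target) :
    MDifferentiableAt (𝓡 n) (𝓡 n) (chartAt (EuclideanSpace ℝ (Fin n)) x).symm y :=
  have : IsManifold (𝓡 n) 1 M := .of_le (n := ∞) (by norm_cast)
  mdifferentiableAt_atlas_symm (chart_mem_atlas _ _) hy

theorem differentiableAt_comp_chart_symm {g : M → V} {x p : M}
    (hp : p ∈ (chartAt (EuclideanSpace ℝ (Fin n)) x).source)
    (hg : MDifferentiableAt (𝓡 n) 𝓘(ℝ, V) g p) :
    DifferentiableAt ℝ (g ∘ (chartAt (EuclideanSpace ℝ (Fin n)) x).symm)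
      (chartAt (EuclideanSpace ℝ (Fin n)) x p) := by
  rw [← mdifferentiableAt_iff_differentiableAt]
  refine MDifferentiableAt.comp _ ?_
    (mdifferentiableAt_chart_symm ((chartAt (EuclideanSpace ℝ (Fin n)) x).map_source hp))
  rwa [(chartAt (EuclideanSpace ℝ (Fin n)) x).left_inv hp]

/-- The differential of a vector-valued function, computed in the preferred chart at any point `x`
whose domain contains `p`. -/
theorem mvfderiv_eq_fderiv_chart {g : M → V} {x p : M}
    (hp : p ∈ (chartAt (EuclideanSpace ℝ (Fin n)) x).source)
    (hg : MDifferentiableAt (𝓡 n) 𝓘(ℝ, V) g p) (v : TangentSpace (𝓡 n) p) :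
    mvfderiv (𝓡 n) g p v = fderiv ℝ (g ∘ (chartAt (EuclideanSpace ℝ (Fin n)) x).symm)
      (chartAt (EuclideanSpace ℝ (Fin n)) x p)
        (mfderiv (𝓡 n) (𝓡 n) (chartAt (EuclideanSpace ℝ (Fin n)) x) p v) := by
  have hd := differentiableAt_comp_chart_symm hp hg
  have hφ := mdifferentiableAt_chart hp
  set φ := chartAt (EuclideanSpace ℝ (Fin n)) x
  have heq : g =ᶠ[nhds p] (g ∘ φ.symm) ∘ φ := by
    filter_upwards [φ.open_source.mem_nhds hp] with q hq
    simp [φ.left_inv hq]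
  have h1 : mfderiv (𝓡 n) 𝓘(ℝ, V) g p = mfderiv (𝓡 n) 𝓘(ℝ, V) ((g ∘ φ.symm) ∘ φ) p :=
    heq.mfderiv_eq
  have h2 := mfderiv_comp_apply p (g := g ∘ φ.symm) (f := φ)
    (mdifferentiableAt_iff_differentiableAt.2 hd) hφ v
  rw [mfderiv_eq_fderiv (f := g ∘ φ.symm)] at h2
  exact (congrArg (fun L : EuclideanSpace ℝ (Fin n) →L[ℝ] V => L v) h1).trans h2

theorem mfderiv_chart_mfderiv_symm {x : M} {y : EuclideanSpace ℝ (Fin n)}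
    (hy : y ∈ (chartAt (EuclideanSpace ℝ (Fin n)) x).target) (v : EuclideanSpace ℝ (Fin n)) :
    (mfderiv (𝓡 n) (𝓡 n) (chartAt (EuclideanSpace ℝ (Fin n)) x)
      ((chartAt (EuclideanSpace ℝ (Fin n)) x).symm y)
      (mfderiv (𝓡 n) (𝓡 n) (chartAt (EuclideanSpace ℝ (Fin n)) x).symm y v) :
        EuclideanSpace ℝ (Fin n)) = v := by
  have : IsManifold (𝓡 n) 1 M := .of_le (n := ∞) (by norm_cast)
  exact congrArg (fun L : EuclideanSpace ℝ (Fin n) →L[ℝ] EuclideanSpace ℝ (Fin n) => L v)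
    ((mdifferentiable_chart (I := 𝓡 n) x).comp_symm_deriv hy)

theorem bijective_mfderiv_chart {x p : M}
    (hp : p ∈ (chartAt (EuclideanSpace ℝ (Fin n)) x).source) :
    Function.Bijective (mfderiv (𝓡 n) (𝓡 n) (chartAt (EuclideanSpace ℝ (Fin n)) x) p) :=
  have : IsManifold (𝓡 n) 1 M := .of_le (n := ∞) (by norm_cast)
  (mdifferentiable_chart (I := 𝓡 n) x).mfderiv_bijective hp

theorem mvfderiv_mfderiv_chart_symm {g : M → V} {x : M} {y : EuclideanSpace ℝ (Fin n)}
    (hy : y ∈ (chartAt (EuclideanSpace ℝ (Fin n)) x).target)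
    (hg : MDifferentiableAt (𝓡 n) 𝓘(ℝ, V) g ((chartAt (EuclideanSpace ℝ (Fin n)) x).symm y))
    (v : EuclideanSpace ℝ (Fin n)) :
    mvfderiv (𝓡 n) g ((chartAt (EuclideanSpace ℝ (Fin n)) x).symm y)
        (mfderiv (𝓡 n) (𝓡 n) (chartAt (EuclideanSpace ℝ (Fin n)) x).symm y v) =
      fderiv ℝ (g ∘ (chartAt (EuclideanSpace ℝ (Fin n)) x).symm) y v := by
  rw [mvfderiv_eq_fderiv_chart ((chartAt (EuclideanSpace ℝ (Fin n)) x).map_target hy) hg,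
    mfderiv_chart_mfderiv_symm hy, (chartAt (EuclideanSpace ℝ (Fin n)) x).right_inv hy]

/-- A covector which is conormal at `p` sees the derivative of `dg (Y)`, where `Y` extends `w`, as
the second derivative of `g` in a chart, whatever the extension. -/
theorem apply_mvfderiv_extend {g : M → V} (hg : ContMDiff (𝓡 n) 𝓘(ℝ, V) ∞ g) {x p : M}
    (hp : p ∈ (chartAt (EuclideanSpace ℝ (Fin n)) x).source) (l : V →L[ℝ] ℝ)
    (hl : ∀ v, l (mvfderiv (𝓡 n) g p v) = 0) (v w : TangentSpace (𝓡 n) p) :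
    l (mvfderiv (𝓡 n) (fun q => mvfderiv (𝓡 n) g q
        (FiberBundle.extend (EuclideanSpace ℝ (Fin n)) w q)) p v) =
      l (fderiv ℝ (fderiv ℝ (g ∘ (chartAt (EuclideanSpace ℝ (Fin n)) x).symm))
        (chartAt (EuclideanSpace ℝ (Fin n)) x p)
        (mfderiv (𝓡 n) (𝓡 n) (chartAt (EuclideanSpace ℝ (Fin n)) x) p v)
        (mfderiv (𝓡 n) (𝓡 n) (chartAt (EuclideanSpace ℝ (Fin n)) x) p w)) := by
  have : IsManifold (𝓡 n) 1 M := .of_le (n := ∞) (by norm_cast)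
  have : IsManifold (𝓡 n) 2 M := .of_le (n := ∞) (by norm_cast)
  have hgd : ∀ q, MDifferentiableAt (𝓡 n) 𝓘(ℝ, V) g q := fun q =>
    (hg q).mdifferentiableAt (by simp)
  have hF := contDiffOn_comp_chart_symm hg x
  have hchart := fun (u : M → V) hu v => mvfderiv_eq_fderiv_chart (g := u) hp hu v
  have hdiff := fun (u : M → EuclideanSpace ℝ (Fin n)) hu =>
    differentiableAt_comp_chart_symm (g := u) hp hu
  have hgq : ∀ q ∈ (chartAt (EuclideanSpace ℝ (Fin n)) x).source, ∀ v, mvfderiv (𝓡 n) g q v = _ :=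
    fun q hq v => mvfderiv_eq_fderiv_chart hq (hgd q) v
  have hφ := mdifferentiableAt_chart hp
  set K : M → EuclideanSpace ℝ (Fin n) := fun q =>
    mfderiv (𝓡 n) (𝓡 n) (chartAt (EuclideanSpace ℝ (Fin n)) x) q
      (FiberBundle.extend (EuclideanSpace ℝ (Fin n)) w q) with hKdef
  have hK : MDifferentiableAt (𝓡 n) 𝓘(ℝ, EuclideanSpace ℝ (Fin n)) K p := by
    have h1 := FiberBundle.mdifferentiableAt_extend (𝓡 n) (EuclideanSpace ℝ (Fin n)) w
    rw [(trivializationAt (EuclideanSpace ℝ (Fin n)) (TangentSpace (𝓡 n)) x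
      ).mdifferentiableAt_section_iff (𝓡 n) _ (by simpa using hp)] at h1
    refine h1.congr_of_eventuallyEq ?_
    filter_upwards [(chartAt (EuclideanSpace ℝ (Fin n)) x).open_source.mem_nhds hp] with q hq
    have h2 := TangentBundle.continuousLinearMapAt_trivializationAt (I := 𝓡 n) hq
    have h3 := congrArg (fun L : EuclideanSpace ℝ (Fin n) →L[ℝ] EuclideanSpace ℝ (Fin n) =>
      L (FiberBundle.extend (EuclideanSpace ℝ (Fin n)) w q)) h2
    have h4 : (trivializationAt (EuclideanSpace ℝ (Fin n)) (TangentSpace (𝓡 n)) x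
        ).continuousLinearMapAt ℝ q (FiberBundle.extend (EuclideanSpace ℝ (Fin n)) w q) =
        (trivializationAt (EuclideanSpace ℝ (Fin n)) (TangentSpace (𝓡 n)) x
          ⟨q, FiberBundle.extend (EuclideanSpace ℝ (Fin n)) w q⟩).2 := by
      rw [Bundle.Trivialization.continuousLinearMapAt_apply,
        Bundle.Trivialization.coe_linearMapAt_of_mem _ (by simpa using hq)]
    exact h3.symm.trans h4
  set φ := chartAt (EuclideanSpace ℝ (Fin n)) x
  set F := g ∘ φ.symm with hFdef
  have hFd : DifferentiableAt ℝ (fderiv ℝ F) (φ p) := by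
    have h1 : ContDiffAt ℝ ∞ F (φ p) :=
      hF.contDiffAt (φ.open_target.mem_nhds (φ.map_source hp))
    exact (h1.fderiv_right (m := 1) (by norm_cast)).differentiableAt one_ne_zero
  have hKd : DifferentiableAt ℝ (K ∘ φ.symm) (φ p) := hdiff K hK
  set u : M → V := fun q => mvfderiv (𝓡 n) g q
    (FiberBundle.extend (EuclideanSpace ℝ (Fin n)) w q) with hu
  have hu1 : u =ᶠ[nhds p] fun q => fderiv ℝ F (φ q) (K q) := by
    filter_upwards [φ.open_source.mem_nhds hp] with q hq
    exact hgq q hq _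
  have hu2 : u ∘ φ.symm =ᶠ[nhds (φ p)] fun y => fderiv ℝ F y ((K ∘ φ.symm) y) := by
    filter_upwards [φ.open_target.mem_nhds (φ.map_source hp)] with y hy
    have h := hgq (φ.symm y) (φ.map_target hy)
      (FiberBundle.extend (EuclideanSpace ℝ (Fin n)) w (φ.symm y))
    rw [φ.right_inv hy] at h
    exact h
  have hud : MDifferentiableAt (𝓡 n) 𝓘(ℝ, V) u p := by
    have h1 : MDifferentiableAt (𝓡 n) 𝓘(ℝ, EuclideanSpace ℝ (Fin n) →L[ℝ] V)
        (fun q => fderiv ℝ F (φ q)) p :=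
      (mdifferentiableAt_iff_differentiableAt.2 hFd).comp p hφ
    exact (h1.clm_apply hK).congr_of_eventuallyEq hu1
  have hw : (K ∘ φ.symm) (φ p) = mfderiv (𝓡 n) (𝓡 n) φ p w := by
    rw [Function.comp_apply, φ.left_inv hp]
    simp only [hKdef, FiberBundle.extend_apply_self]
    rfl
  have hl' : ∀ z : EuclideanSpace ℝ (Fin n), l (fderiv ℝ F (φ p) z) = 0 := by
    intro z
    have : IsManifold (𝓡 n) 1 M := .of_le (n := ∞) (by norm_cast)
    obtain ⟨v', hv'⟩ := (bijective_mfderiv_chart hp).2 z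
    rw [← hl v', hgq p hp v', hv']
  have key : ∀ z : EuclideanSpace ℝ (Fin n), l (fderiv ℝ (u ∘ φ.symm) (φ p) z) =
      l (fderiv ℝ (fderiv ℝ F) (φ p) z ((K ∘ φ.symm) (φ p))) := by
    intro z
    rw [hu2.fderiv_eq, (hFd.hasFDerivAt.clm_apply hKd.hasFDerivAt).fderiv]
    simp only [add_apply, ContinuousLinearMap.comp_apply, map_add, hl',
      ContinuousLinearMap.flip_apply, zero_add]
  rw [hw] at key
  exact (congrArg l (hchart u hud v)).trans (key _)

end Charts

/-! ### Fibre integrals -/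

/-- Integration of a homogeneous function over an ellipsoid in `⋀ˢ W`, where `dim W = s + 1`, in the
coordinates of `η` given by the heights of a frame `Ξ` of `W`. Here `G` and `Q` are the linear forms
`l` and the integrand `h` in these coordinates. -/
theorem lintegral_ellipsoidMeasure_inducedVolume {W ι : Type*} [AddCommGroup W] [Module ℝ W]
    [Fintype ι] {s n : ℕ} (hW : Module.finrank ℝ W = s + 1) (ν : W [⋀^Fin (s + 1)]→ₗ[ℝ] ℝ)
    (Ξ : Fin (s + 1) → W) (hΞ : ν Ξ ≠ 0) (l : ι → Module.Dual ℝ (⋀[ℝ]^s W))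
    {h : ⋀[ℝ]^s W → ℝ≥0∞}
    (hom : ∀ (c : ℝ) η, 0 < c → h (c • η) = ENNReal.ofReal (c ^ n) * h η)
    {G : (Fin (s + 1) → ℝ) → ι → ℝ} (hGm : Measurable G)
    (hG : ∀ η, (fun i => l i η) = G fun j => height ν η (Ξ j)) (hG0 : ∀ c, G c = 0 → c = 0)
    {Q : (Fin (s + 1) → ℝ) → ℝ≥0∞} (hQm : Measurable Q)
    (hQ : ∀ η, h η = Q fun j => height ν η (Ξ j)) :
    ∫⁻ η, h η ∂(ellipsoidMeasure (inducedVolume ν) {η | ∑ i, l i η ^ 2 = 1}) =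
      (s + 1 : ℕ) * (ENNReal.ofReal |(ν Ξ)⁻¹| * ∫⁻ c, ballWeight n (G c) * Q c) := by
  have hmap := map_height_formMeasure ν hW Ξ hΞ
  have hmeas : Measurable fun (η : ⋀[ℝ]^s W) (j : Fin (s + 1)) => height ν η (Ξ j) := by
    rw [measurable_pi_iff]
    exact fun j => measurable_dual ((height ν).flip (Ξ j))
  have hh : Measurable h := by
    rw [show h = Q ∘ fun η j => height ν η (Ξ j) from funext hQ]
    exact hQm.comp hmeas
  -- The forms `l` have no common zero but `0`, so that the ellipsoid is compact.
  have hnull : formMeasure (inducedVolume ν) {η | ∀ i, l i η = 0} = 0 := by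
    refine measure_mono_null (t := (fun η j => height ν η (Ξ j)) ⁻¹' {0}) ?_ ?_
    · intro η hη
      refine hG0 _ ?_
      rw [← hG]
      exact funext hη
    · rw [← Measure.map_apply hmeas (measurableSet_singleton 0), hmap]
      simp
  rw [lintegral_ellipsoidMeasure _ l hnull hh hom]
  congr 1
  have hm : Measurable fun c => ballWeight n (G c) * Q c :=
    ((measurable_ballWeight n).comp hGm).mul hQm
  rw [← smul_eq_mul (a := ENNReal.ofReal _), ← lintegral_smul_measure, ← hmap,
    lintegral_map hm hmeas]
  exact lintegral_congr fun η => by rw [hG, hQ]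

theorem det_bilinear_comp {n : ℕ}
    (H : EuclideanSpace ℝ (Fin n) →ₗ[ℝ] EuclideanSpace ℝ (Fin n) →ₗ[ℝ] ℝ)
    (e : Fin n → EuclideanSpace ℝ (Fin n)) :
    (Matrix.of fun i j => H (e i) (e j)).det =
      (EuclideanSpace.basisFun (Fin n) ℝ).toBasis.det e ^ 2 *
        (Matrix.of fun i j => H (EuclideanSpace.single i 1) (EuclideanSpace.single j 1)).det := by
  set b := (EuclideanSpace.basisFun (Fin n) ℝ).toBasis with hb
  have hbs : ∀ i, b i = EuclideanSpace.single i 1 := by simp [hb]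
  have : (Matrix.of fun i j => H (e i) (e j)) = (b.toMatrix e).transpose *
      (Matrix.of fun i j => H (EuclideanSpace.single i 1) (EuclideanSpace.single j 1)) *
      b.toMatrix e := by
    ext i j
    rw [Matrix.of_apply]
    conv_lhs => rw [← b.sum_repr (e i), ← b.sum_repr (e j)]
    simp only [Matrix.mul_apply, Matrix.transpose_apply, Matrix.of_apply, map_sum, map_smul,
      LinearMap.sum_apply, LinearMap.smul_apply, smul_eq_mul, hbs, Finset.sum_mul,
      Finset.mul_sum,
      Module.Basis.toMatrix_apply]
    refine Finset.sum_congr rfl fun k _ => Finset.sum_congr rfl fun l _ => ?_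
    ring
  rw [this, Matrix.det_mul, Matrix.det_mul, Matrix.det_transpose, Module.Basis.det_apply]
  ring

/-- The determinant of a frame in unimodular coordinates. -/
theorem det_repr_sum_elim {V : Type*} [AddCommGroup V] [Module ℝ V] {n r : ℕ}
    (Ω : V [⋀^Fin (n + r)]→ₗ[ℝ] ℝ) (w : Module.Basis (Fin (n + r)) ℝ V) (hw : Ω w = 1)
    (a : Fin n → V) (b : Fin r → V) :
    (Matrix.of fun i k => (w.reindex finSumFinEquiv.symm).repr (Sum.elim a b i) k).det =
      Ω (Fin.append a b) := by
  have h1 : Ω (Fin.append a b) = w.det (Fin.append a b) := by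
    have h := congrArg (fun g => g (Fin.append a b)) (AlternatingMap.eq_smul_basis_det w Ω)
    simpa [hw] using h
  have h2 : Sum.elim a b ∘ finSumFinEquiv.symm = Fin.append a b := by
    ext i
    refine Fin.addCases (fun i => ?_) (fun i => ?_) i <;> simp
  have h3 : (Matrix.of fun i k => (w.reindex finSumFinEquiv.symm).repr (Sum.elim a b i) k) =
      ((w.reindex finSumFinEquiv.symm).toMatrix (Sum.elim a b)).transpose := by
    ext i k
    rfl
  rw [h3, Matrix.det_transpose, ← Module.Basis.det_apply, Module.Basis.det_reindex, h1, ← h2]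

/-- Tonelli's theorem in the coordinates `(y, c)`. -/
theorem setLIntegral_basePoint_preimage {α β : Type*} [Fintype α] [Fintype β]
    {T : Set (EuclideanSpace ℝ α)} {H : (α ⊕ β → ℝ) → ℝ≥0∞}
    (hH : AEMeasurable H (volume.restrict (basePoint α β ⁻¹' T))) :
    ∫⁻ x in basePoint α β ⁻¹' T, H x = ∫⁻ y in T, ∫⁻ c : β → ℝ, H (Sum.elim y c) := by
  set e : (α ⊕ β → ℝ) ≃ᵐ EuclideanSpace ℝ α × (β → ℝ) :=
    (MeasurableEquiv.sumPiEquivProdPi fun _ : α ⊕ β => ℝ).trans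
      ((MeasurableEquiv.toLp 2 (α → ℝ)).prodCongr (MeasurableEquiv.refl _)) with he
  have hmp : MeasurePreserving e volume volume := by
    have h1 := volume_measurePreserving_sumPiEquivProdPi fun _ : α ⊕ β => ℝ
    have h2 := (EuclideanSpace.volume_preserving_symm_measurableEquiv_toLp α).symm.prod
      (MeasurePreserving.id (volume : Measure (β → ℝ)))
    exact h2.comp h1
  have hes : ∀ y c, e.symm (y, c) = Sum.elim y c := fun y c => by
    rw [MeasurableEquiv.symm_apply_eq]
    rfl
  have hpre : basePoint α β ⁻¹' T = e ⁻¹' (T ×ˢ Set.univ) := by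
    ext x
    simp only [Set.mem_preimage, Set.mem_prod, Set.mem_univ, and_true]
    rfl
  have hmpT := hmp.restrict_preimage_emb e.measurableEmbedding (T ×ˢ Set.univ)
  rw [← hpre] at hmpT
  have hint : ∫⁻ x in basePoint α β ⁻¹' T, H x = ∫⁻ z in T ×ˢ Set.univ, H (e.symm z) := by
    rw [← hmpT.lintegral_comp_emb e.measurableEmbedding]
    simp
  have hae : AEMeasurable (fun z => H (e.symm z)) (volume.restrict (T ×ˢ Set.univ)) := by
    rw [← hmpT.aemeasurable_comp_iff e.measurableEmbedding]
    simpa [Function.comp_def] using hH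
  rw [hint]
  rw [Measure.volume_eq_prod, ← Measure.prod_restrict, Measure.restrict_univ] at hae ⊢
  rw [lintegral_prod _ hae]
  simp only [hes]

/-! ### Conormal covectors of an immersion -/

section Pair

variable {n : ℕ} {M : Type*} [TopologicalSpace M] [ChartedSpace (EuclideanSpace ℝ (Fin n)) M]
  {V P : Type*} [NormedAddCommGroup V] [NormedSpace ℝ V] [AddTorsor V P]

theorem IsSmoothImmersion.mdifferentiableAt {f : M → P} (hf : IsSmoothImmersion n (V := V) f)
    (o : P) (p : M) : MDifferentiableAt (𝓡 n) 𝓘(ℝ, V) (fun q => (f q -ᵥ o : V)) p :=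
  (hf.1 o p).mdifferentiableAt (by simp)

theorem IsSmoothImmersion.affineDeriv_eq {f : M → P} (hf : IsSmoothImmersion n (V := V) f)
    (o : P) (p : M) :
    affineDeriv (n := n) (V := V) f p = mvfderiv (𝓡 n) (fun q => (f q -ᵥ o : V)) p := by
  have h : (fun q => (f q -ᵥ f p : V)) = fun q => (f q -ᵥ o : V) - (f p -ᵥ o) := by
    ext q
    simp
  rw [affineDeriv, h, mvfderiv_fun_sub (hf.mdifferentiableAt o p) mdifferentiableAt_const,
    mvfderiv_const, sub_zero]

/-- The points where a covector is conormal to `f`, that is, the critical points of the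
corresponding height function. -/
def criticalSet (n : ℕ) {M : Type*} [TopologicalSpace M]
    [ChartedSpace (EuclideanSpace ℝ (Fin n)) M] {V P : Type*} [NormedAddCommGroup V]
    [NormedSpace ℝ V] [AddTorsor V P] (f : M → P) (l : V →ₗ[ℝ] ℝ) : Set M :=
  {p | ∀ v : TangentSpace (𝓡 n) p, l (affineDeriv (V := V) f p v) = 0}

namespace TransversalPair

theorem finrank_N {f : M → P} {r : ℕ} (D : TransversalPair n (V := V) f r) (p : M) :
    Module.finrank ℝ (D.N p) = r := by
  obtain ⟨U, -, hp, ξ, -, hξ⟩ := D.smooth_frame p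
  rw [← (hξ p hp).2, finrank_span_eq_card (hξ p hp).1, Fintype.card_fin]

variable [IsManifold (𝓡 n) ∞ M]

variable {f : M → P} {s : ℕ} {A : EquiaffineStructure n M} {Ω : V [⋀^Fin (n + (s + 1))]→ₗ[ℝ] ℝ}
  {D : TransversalPair n (V := V) f (s + 1)}

/-- The condition on the volume forms without division, so that it holds for all vectors of `N`. -/
theorem Induces.apply_append (hD : D.Induces A Ω) (p : M)
    (X : Fin n → TangentSpace (𝓡 n) p) (ξ : Fin (s + 1) → D.N p) :
    Ω (Fin.append (fun i => affineDeriv (V := V) f p (X i)) fun j => (ξ j : V)) =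
      A.vol p X * D.vol p ξ := by
  by_cases h : LinearIndependent ℝ ξ
  · have hne : D.vol p ξ ≠ 0 := by
      have hb := (D.vol p).map_basis_ne_zero_iff
        (basisOfLinearIndependentOfCardEqFinrank h (by simp [D.finrank_N]))
      rw [coe_basisOfLinearIndependentOfCardEqFinrank] at hb
      exact hb.2 (D.vol_ne_zero p)
    rw [hD.volume_eq p X ξ h, div_mul_cancel₀ _ hne]
  · rw [(D.vol p).map_linearDependent ξ h, mul_zero]
    refine Ω.map_linearDependent _ fun h' => h ?_
    have h2 := h'.comp (Fin.natAdd n) (Fin.natAdd_injective _ _)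
    have h3 : (Fin.append (fun i => affineDeriv (V := V) f p (X i)) fun j => (ξ j : V)) ∘
        Fin.natAdd n = (D.N p).subtype ∘ ξ := by
      ext j
      simp
    rw [h3] at h2
    exact LinearIndependent.of_comp (D.N p).subtype h2

theorem _root_.Equiaffine.EquiaffineStructure.vol_unimodularFrame (A : EquiaffineStructure n M)
    (hn : 1 ≤ n) (p : M) : A.vol p (unimodularFrame (A.vol p)) = 1 :=
  apply_unimodularFrame hn _ (A.vol_ne_zero p)

/-- The height function of `ν(η)` is a conormal covector of `f`. -/
theorem height_gaussMap_affineDeriv (hn : 1 ≤ n) (p : M) (η : ⋀[ℝ]^s (D.N p))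
    (v : TangentSpace (𝓡 n) p) :
    height (k := n + s) Ω (D.gaussMap A p η) (affineDeriv (V := V) f p v) = 0 := by
  refine height_wedge_of_mem_span Ω _ _ ?_
  have hli : LinearIndependent ℝ (unimodularFrame (A.vol p)) := by
    by_contra h
    exact one_ne_zero ((A.vol_unimodularFrame hn p).symm.trans ((A.vol p).map_linearDependent _ h))
  have : FiniteDimensional ℝ (TangentSpace (𝓡 n) p) :=
    inferInstanceAs (FiniteDimensional ℝ (EuclideanSpace ℝ (Fin n)))
  have hfr : Module.finrank ℝ (TangentSpace (𝓡 n) p) = n :=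
    finrank_euclideanSpace_fin (𝕜 := ℝ) (n := n)
  have hsp : Submodule.span ℝ (Set.range (unimodularFrame (A.vol p))) = ⊤ :=
    hli.span_eq_top_of_card_eq_finrank' (by simp [hfr])
  have hv : v ∈ Submodule.span ℝ (Set.range (unimodularFrame (A.vol p))) := hsp ▸ trivial
  have := Submodule.mem_map_of_mem (f := (affineDeriv (V := V) f p).toLinearMap) hv
  rw [Submodule.map_span, ← Set.range_comp] at this
  exact this

/-- The height function of `ν(η)` restricts to the height function of `η` on `N`, because `Ω (df e₁,
…, df eₙ, …) = θ^⊥` on `N` when `θ (e₁, …, eₙ) = 1`. -/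
theorem Induces.height_gaussMap_of_mem (hD : D.Induces A Ω) (hn : 1 ≤ n) (p : M)
    (η : ⋀[ℝ]^s (D.N p)) (v : D.N p) :
    height (k := n + s) Ω (D.gaussMap A p η) v = height (D.vol p) η v := by
  refine height_wedge_map_of_mem Ω _ (D.N p) (D.vol p) (fun ξ => ?_) η v
  rw [hD.apply_append, A.vol_unimodularFrame hn, one_mul]

/-- A conormal covector does not see the tangential component of the derivative of `df(Y)`. -/
theorem apply_fundamentalForm {r : ℕ} (D : TransversalPair n (V := V) f r) {p : M} (l : V →ₗ[ℝ] ℝ)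
    (hl : p ∈ criticalSet n f l) (v w : TangentSpace (𝓡 n) p) :
    l (D.fundamentalForm p v w) = l (mvfderiv (𝓡 n) (fun q => affineDeriv (V := V) f q
      (FiberBundle.extend (EuclideanSpace ℝ (Fin n)) w q)) p v) := by
  rw [fundamentalForm]
  set z : V := mvfderiv (𝓡 n) (fun q => affineDeriv (V := V) f q
      (FiberBundle.extend (EuclideanSpace ℝ (Fin n)) w q)) p v
  have h := Submodule.projection_add_projection_eq_self (D.isCompl p) z
  have h2 : (affineDeriv (n := n) (V := V) f p).range.projection (D.N p) (D.isCompl p) z ∈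
      (affineDeriv (n := n) (V := V) f p).range := Submodule.projection_apply_mem _ z
  obtain ⟨u, hu⟩ := h2
  conv_rhs => rw [← h, map_add, ← hu]
  rw [show l ((affineDeriv (n := n) (V := V) f p).toLinearMap u) = 0 from hl u, zero_add]

end TransversalPair

end Pair

/-! ### The conormal map of an immersion in a chart -/

section FrameMatrix

variable {n r : ℕ} {V : Type*} [NormedAddCommGroup V] [NormedSpace ℝ V]
  (w : Module.Basis (Fin n ⊕ Fin r) ℝ V)
  (F : EuclideanSpace ℝ (Fin n) → V) (Ξ : Fin r → EuclideanSpace ℝ (Fin n) → V)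

/-- The frame `(∂₁F, …, ∂ₙF, Ξ₁, …, Ξᵣ)`, as the rows of a matrix in the basis `w`. -/
def frameMatrix (y : EuclideanSpace ℝ (Fin n)) : Matrix (Fin n ⊕ Fin r) (Fin n ⊕ Fin r) ℝ :=
  Matrix.of fun i k => w.repr (Sum.elim (fun i => fderiv ℝ F y (EuclideanSpace.single i 1))
    (fun j => Ξ j y) i) k

variable {w F Ξ}

theorem frameMatrix_mulVec (y : EuclideanSpace ℝ (Fin n)) (ℓ : Fin n ⊕ Fin r → ℝ) :
    (frameMatrix w F Ξ y).mulVec ℓ =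
      Sum.elim (fun i => w.constr ℝ ℓ (fderiv ℝ F y (EuclideanSpace.single i 1)))
        (fun j => w.constr ℝ ℓ (Ξ j y)) := by
  ext i
  rcases i with i | i <;>
    simp [Matrix.mulVec, dotProduct, frameMatrix, Module.Basis.constr_apply_fintype]

theorem contDiff_repr (k : Fin n ⊕ Fin r) : ContDiff ℝ ∞ fun v : V => w.repr v k := by
  have : FiniteDimensional ℝ V := Module.Basis.finiteDimensional_of_finite w
  exact (LinearMap.toContinuousLinearMap (w.coord k)).contDiff

theorem contDiffOn_frameMatrix {W : Set (EuclideanSpace ℝ (Fin n))} (hW : IsOpen W)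
    (hF : ContDiffOn ℝ ∞ F W) (hΞ : ∀ j, ContDiffOn ℝ 1 (Ξ j) W) (i k) :
    ContDiffOn ℝ 1 (fun y => frameMatrix w F Ξ y i k) W := by
  have hk : ContDiff ℝ 1 fun v : V => w.repr v k := (contDiff_repr k).of_le (by norm_cast)
  rcases i with i | i
  · refine hk.comp_contDiffOn (f := fun y => fderiv ℝ F y (EuclideanSpace.single i 1)) ?_
    exact (hF.fderiv_of_isOpen hW (m := 1) (by norm_cast)).clm_apply contDiffOn_const
  · exact hk.comp_contDiffOn (f := fun y => Ξ i y) (hΞ i)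

/-- The derivatives of the rows of coordinate vectors, paired with a covector, are its values on the
second derivatives of `F`. -/
theorem sum_fderiv_frameMatrix {y : EuclideanSpace ℝ (Fin n)}
    (hF : DifferentiableAt ℝ (fderiv ℝ F) y) (i : Fin n) (z : EuclideanSpace ℝ (Fin n))
    (ℓ : Fin n ⊕ Fin r → ℝ) :
    ∑ k, fderiv ℝ (fun y => frameMatrix w F Ξ y (Sum.inl i) k) y z * ℓ k =
      w.constr ℝ ℓ (fderiv ℝ (fderiv ℝ F) y z (EuclideanSpace.single i 1)) := by
  have : FiniteDimensional ℝ V := Module.Basis.finiteDimensional_of_finite w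
  rw [Module.Basis.constr_apply_fintype]
  refine Finset.sum_congr rfl fun k _ => ?_
  have h1 : HasFDerivAt (fun y => fderiv ℝ F y (EuclideanSpace.single i 1)) _ y :=
    hF.hasFDerivAt.clm_apply (hasFDerivAt_const (EuclideanSpace.single i (1 : ℝ)) y)
  have h2 := (LinearMap.toContinuousLinearMap (w.coord k)).hasFDerivAt.comp y h1
  have h3 : (fun y => frameMatrix w F Ξ y (Sum.inl i) k) =
      (LinearMap.toContinuousLinearMap (w.coord k)) ∘
        fun y => fderiv ℝ F y (EuclideanSpace.single i 1) := rfl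
  rw [h3, h2.fderiv]
  simp

theorem basePoint_elim {α β : Type*} [Fintype α] [Fintype β] (y : EuclideanSpace ℝ α) (c : β → ℝ) :
    basePoint α β (Sum.elim y c) = y := by
  ext i
  simp [basePoint]

end FrameMatrix

section Chart

variable {n : ℕ} {M : Type*} [TopologicalSpace M] [ChartedSpace (EuclideanSpace ℝ (Fin n)) M]
  [IsManifold (𝓡 n) ∞ M]

/-- The value of a volume form on any frame, from its component in a chart. -/
theorem det_mul_chartDensity (θ : ∀ p : M, TangentSpace (𝓡 n) p [⋀^Fin n]→ₗ[ℝ] ℝ) (x : M)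
    {y : EuclideanSpace ℝ (Fin n)} (hy : y ∈ (chartAt (EuclideanSpace ℝ (Fin n)) x).target)
    (v : Fin n → TangentSpace (𝓡 n) ((chartAt (EuclideanSpace ℝ (Fin n)) x).symm y)) :
    (EuclideanSpace.basisFun (Fin n) ℝ).toBasis.det
        (fun i => (mfderiv (𝓡 n) (𝓡 n) (chartAt (EuclideanSpace ℝ (Fin n)) x)
          ((chartAt (EuclideanSpace ℝ (Fin n)) x).symm y) (v i) : EuclideanSpace ℝ (Fin n))) *
      chartDensity θ x y = θ ((chartAt (EuclideanSpace ℝ (Fin n)) x).symm y) v := by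
  have hbij := bijective_mfderiv_chart ((chartAt (EuclideanSpace ℝ (Fin n)) x).map_target hy)
  have hinv := fun v => mfderiv_chart_mfderiv_symm hy v
  unfold chartDensity
  revert v
  set φ := chartAt (EuclideanSpace ℝ (Fin n)) x
  intro v
  set ψ : EuclideanSpace ℝ (Fin n) [⋀^Fin n]→ₗ[ℝ] ℝ := (θ (φ.symm y)).compLinearMap
    (mfderiv (𝓡 n) (𝓡 n) φ.symm y).toLinearMap with hψ
  have h1 := congrArg (fun g => g fun i => (mfderiv (𝓡 n) (𝓡 n) φ (φ.symm y) (v i) :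
    EuclideanSpace ℝ (Fin n))) (AlternatingMap.eq_smul_basis_det
      (EuclideanSpace.basisFun (Fin n) ℝ).toBasis ψ)
  have h2 : ψ (fun i => (mfderiv (𝓡 n) (𝓡 n) φ (φ.symm y) (v i) : EuclideanSpace ℝ (Fin n))) =
      θ (φ.symm y) v := by
    rw [hψ]
    refine congrArg (θ (φ.symm y)) ?_
    funext i
    exact hbij.1 (hinv _)
  have h3 : ψ (EuclideanSpace.basisFun (Fin n) ℝ).toBasis = θ (φ.symm y) fun i =>
      mfderiv (𝓡 n) (𝓡 n) φ.symm y (EuclideanSpace.single i (1 : ℝ)) := by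
    rw [hψ]
    refine congrArg (θ (φ.symm y)) ?_
    funext i
    simp only [OrthonormalBasis.coe_toBasis, EuclideanSpace.basisFun_apply]
    rfl
  refine (mul_comm _ _).trans (Eq.trans ?_ (h1.symm.trans h2))
  exact congrArg (fun t : ℝ => t * (EuclideanSpace.basisFun (Fin n) ℝ).toBasis.det
    fun i => (mfderiv (𝓡 n) (𝓡 n) φ (φ.symm y) (v i) : EuclideanSpace ℝ (Fin n))) h3.symm

end Chart

section Local

variable {n : ℕ} {M : Type*} [TopologicalSpace M] [ChartedSpace (EuclideanSpace ℝ (Fin n)) M]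
  [IsManifold (𝓡 n) ∞ M] {V P : Type*} [NormedAddCommGroup V] [NormedSpace ℝ V] [AddTorsor V P]
  {f : M → P} {s : ℕ} {A : EquiaffineStructure n M} {Ω : V [⋀^Fin (n + (s + 1))]→ₗ[ℝ] ℝ}
  {D : TransversalPair n (V := V) f (s + 1)}

omit [IsManifold (𝓡 n) ∞ M] in
theorem TransversalPair.vol_ne_zero_of_linearIndependent {p : M} {ξ : Fin (s + 1) → D.N p}
    (h : LinearIndependent ℝ ξ) : D.vol p ξ ≠ 0 := by
  have hb := (D.vol p).map_basis_ne_zero_iff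
    (basisOfLinearIndependentOfCardEqFinrank h (by simp [D.finrank_N]))
  rw [coe_basisOfLinearIndependentOfCardEqFinrank] at hb
  exact hb.2 (D.vol_ne_zero p)

/-- A frame of `N` over `U`, as sections of `N`, extended by zero. -/
def sectionOfFrame (D : TransversalPair n (V := V) f (s + 1)) {U : Set M}
    {ξ : Fin (s + 1) → M → V} (hξ : ∀ p ∈ U, LinearIndependent ℝ (fun i => ξ i p) ∧
        Submodule.span ℝ (Set.range fun i => ξ i p) = D.N p) (j : Fin (s + 1)) (p : M) : D.N p :=
  open Classical in if h : p ∈ U then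
    ⟨ξ j p, (hξ p h).2 ▸ Submodule.subset_span ⟨j, rfl⟩⟩ else 0

omit [IsManifold (𝓡 n) ∞ M] in
theorem coe_sectionOfFrame {U : Set M}
    {ξ : Fin (s + 1) → M → V} (hξ : ∀ p ∈ U, LinearIndependent ℝ (fun i => ξ i p) ∧
        Submodule.span ℝ (Set.range fun i => ξ i p) = D.N p) (j : Fin (s + 1)) {p : M}
    (hp : p ∈ U) : (sectionOfFrame D hξ j p : V) = ξ j p := by
  simp [sectionOfFrame, hp]

omit [IsManifold (𝓡 n) ∞ M] in
theorem vol_sectionOfFrame_ne_zero {U : Set M}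
    {ξ : Fin (s + 1) → M → V} (hξ : ∀ p ∈ U, LinearIndependent ℝ (fun i => ξ i p) ∧
        Submodule.span ℝ (Set.range fun i => ξ i p) = D.N p) {p : M} (hp : p ∈ U) :
    D.vol p (fun j => sectionOfFrame D hξ j p) ≠ 0 := by
  apply TransversalPair.vol_ne_zero_of_linearIndependent
  refine LinearIndependent.of_comp (D.N p).subtype ?_
  have : (D.N p).subtype ∘ (fun j => sectionOfFrame D hξ j p) = fun i => ξ i p := by
    ext j
    exact coe_sectionOfFrame hξ j hp
  rw [this]
  exact (hξ p hp).1

/-- The frame consisting of the coordinate vectors of `f` in the preferred chart at `x` and of the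
frame `ξ` of the transversal bundle, in coordinates. -/
def chartFrameMatrix (w : Module.Basis (Fin n ⊕ Fin (s + 1)) ℝ V) (f : M → P) (o : P) (x : M)
    (ξ : Fin (s + 1) → M → V) :
    EuclideanSpace ℝ (Fin n) → Matrix (Fin n ⊕ Fin (s + 1)) (Fin n ⊕ Fin (s + 1)) ℝ :=
  frameMatrix w ((fun q => (f q -ᵥ o : V)) ∘ (chartAt (EuclideanSpace ℝ (Fin n)) x).symm)
    fun j y => ξ j ((chartAt (EuclideanSpace ℝ (Fin n)) x).symm y)

/-- The determinant of the frame is the product of the components of `θ` and `θ^⊥`. -/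
theorem det_chartFrameMatrix (hf : IsSmoothImmersion n (V := V) f) (hD : D.Induces A Ω)
    (w : Module.Basis (Fin (n + (s + 1))) ℝ V) (hw : Ω w = 1) (o : P) (x : M) {U : Set M}
    {ξ : Fin (s + 1) → M → V} (hξ : ∀ p ∈ U, LinearIndependent ℝ (fun i => ξ i p) ∧
        Submodule.span ℝ (Set.range fun i => ξ i p) = D.N p)
    {y : EuclideanSpace ℝ (Fin n)} (hy : y ∈ (chartAt (EuclideanSpace ℝ (Fin n)) x).target)
    (hyU : (chartAt (EuclideanSpace ℝ (Fin n)) x).symm y ∈ U) :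
    (chartFrameMatrix (w.reindex finSumFinEquiv.symm) f o x ξ y).det =
      chartDensity A.vol x y * D.vol _ fun j =>
        sectionOfFrame D hξ j ((chartAt (EuclideanSpace ℝ (Fin n)) x).symm y) := by
  unfold chartDensity
  rw [← hD.apply_append, chartFrameMatrix, frameMatrix, det_repr_sum_elim Ω w hw]
  congr 1
  simp only [coe_sectionOfFrame hξ _ hyU]
  congr 1
  funext i
  rw [hf.affineDeriv_eq o]
  exact (mvfderiv_mfderiv_chart_symm hy (hf.mdifferentiableAt o _) _).symm

theorem chartDensity_ne_zero (A : EquiaffineStructure n M) (hn : 1 ≤ n) {x : M}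
    {y : EuclideanSpace ℝ (Fin n)} (hy : y ∈ (chartAt (EuclideanSpace ℝ (Fin n)) x).target) :
    chartDensity A.vol x y ≠ 0 := by
  intro h
  have := det_mul_chartDensity A.vol x hy (unimodularFrame (A.vol _))
  rw [h, mul_zero, A.vol_unimodularFrame hn] at this
  exact one_ne_zero this.symm

theorem det_chartFrameMatrix_ne_zero (hn : 1 ≤ n) (hf : IsSmoothImmersion n (V := V) f)
    (hD : D.Induces A Ω)
    (w : Module.Basis (Fin (n + (s + 1))) ℝ V) (hw : Ω w = 1) (o : P) (x : M) {U : Set M}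
    {ξ : Fin (s + 1) → M → V} (hξ : ∀ p ∈ U, LinearIndependent ℝ (fun i => ξ i p) ∧
        Submodule.span ℝ (Set.range fun i => ξ i p) = D.N p) :
    ∀ y ∈ (chartAt (EuclideanSpace ℝ (Fin n)) x).target ∩
      (chartAt (EuclideanSpace ℝ (Fin n)) x).symm ⁻¹' U,
      (chartFrameMatrix (w.reindex finSumFinEquiv.symm) f o x ξ y).det ≠ 0 := by
  intro y hy
  rw [det_chartFrameMatrix hf hD w hw o x hξ hy.1 hy.2]
  exact mul_ne_zero (chartDensity_ne_zero A hn hy.1) (vol_sectionOfFrame_ne_zero hξ hy.2)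

theorem contDiffOn_chartFrameMatrix (hf : IsSmoothImmersion n (V := V) f)
    (w : Module.Basis (Fin n ⊕ Fin (s + 1)) ℝ V) (o : P) (x : M) {U : Set M} (hU : IsOpen U)
    {ξ : Fin (s + 1) → M → V} (hξs : ∀ j, ContMDiffOn (𝓡 n) 𝓘(ℝ, V) ∞ (ξ j) U) (i k) :
    ContDiffOn ℝ 1 (fun y => chartFrameMatrix w f o x ξ y i k)
      ((chartAt (EuclideanSpace ℝ (Fin n)) x).target ∩
        (chartAt (EuclideanSpace ℝ (Fin n)) x).symm ⁻¹' U) := by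
  refine contDiffOn_frameMatrix ?_ ?_ (fun j => ?_) i k
  · exact (chartAt (EuclideanSpace ℝ (Fin n)) x).isOpen_inter_preimage_symm hU
  · exact (contDiffOn_comp_chart_symm (hf.1 o) x).mono Set.inter_subset_left
  · refine ContDiffOn.of_le (n := ∞) ?_ (by norm_cast)
    rw [← contMDiffOn_iff_contDiffOn]
    exact (hξs j).comp (contMDiffOn_chart_symm.mono Set.inter_subset_left) fun y hy => hy.2

theorem chartFrameMatrix_mulVec (hf : IsSmoothImmersion n (V := V) f)
    (w : Module.Basis (Fin n ⊕ Fin (s + 1)) ℝ V) (o : P) (x : M) (ξ : Fin (s + 1) → M → V)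
    {y : EuclideanSpace ℝ (Fin n)} (hy : y ∈ (chartAt (EuclideanSpace ℝ (Fin n)) x).target)
    (ℓ : Fin n ⊕ Fin (s + 1) → ℝ) :
    (chartFrameMatrix w f o x ξ y).mulVec ℓ =
      Sum.elim (fun i => w.constr ℝ ℓ (affineDeriv (V := V) f
          ((chartAt (EuclideanSpace ℝ (Fin n)) x).symm y)
          (mfderiv (𝓡 n) (𝓡 n) (chartAt (EuclideanSpace ℝ (Fin n)) x).symm y
            (EuclideanSpace.single i (1 : ℝ)))))
        (fun j => w.constr ℝ ℓ (ξ j ((chartAt (EuclideanSpace ℝ (Fin n)) x).symm y))) := by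
  rw [chartFrameMatrix, frameMatrix_mulVec]
  congr 1
  funext i
  rw [hf.affineDeriv_eq o]
  congr 1
  exact (mvfderiv_mfderiv_chart_symm hy (hf.mdifferentiableAt o _) _).symm

/-- The Lipschitz-Killing curvature in terms of the second derivatives of `f` in a chart. -/
theorem abs_lipschitzKilling_eq (hn : 1 ≤ n) (hf : IsSmoothImmersion n (V := V) f) (o : P) (x : M)
    {y : EuclideanSpace ℝ (Fin n)} (hy : y ∈ (chartAt (EuclideanSpace ℝ (Fin n)) x).target)
    [FiniteDimensional ℝ V]
    (η : ⋀[ℝ]^s (D.N ((chartAt (EuclideanSpace ℝ (Fin n)) x).symm y))) :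
    |D.lipschitzKilling A Ω ((chartAt (EuclideanSpace ℝ (Fin n)) x).symm y) η| =
      (chartDensity A.vol x y ^ 2)⁻¹ * |(Matrix.of fun i j : Fin n =>
        height (k := n + s) Ω (D.gaussMap A _ η) (fderiv ℝ (fderiv ℝ
          ((fun q => (f q -ᵥ o : V)) ∘ (chartAt (EuclideanSpace ℝ (Fin n)) x).symm)) y
            (EuclideanSpace.single i 1) (EuclideanSpace.single j 1))).det| := by
  have hdet := det_mul_chartDensity A.vol x hy (unimodularFrame (A.vol _))
  rw [A.vol_unimodularFrame hn] at hdet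
  have hp := (chartAt (EuclideanSpace ℝ (Fin n)) x).map_target hy
  revert η
  set φ := chartAt (EuclideanSpace ℝ (Fin n)) x with hφ
  set p := φ.symm y with hpdef
  intro η
  set l : V →ₗ[ℝ] ℝ := height (k := n + s) Ω (D.gaussMap A p η) with hl
  have hcrit : p ∈ criticalSet n f l := fun v =>
    TransversalPair.height_gaussMap_affineDeriv hn p η v
  set ē : Fin n → EuclideanSpace ℝ (Fin n) := fun i =>
    mfderiv (𝓡 n) (𝓡 n) φ p (unimodularFrame (A.vol p) i) with hē
  set H : EuclideanSpace ℝ (Fin n) →ₗ[ℝ] EuclideanSpace ℝ (Fin n) →ₗ[ℝ] ℝ :=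
    LinearMap.mk₂ ℝ (fun a b => l (fderiv ℝ (fderiv ℝ
          ((fun q => (f q -ᵥ o : V)) ∘ φ.symm)) y a b)) (by simp) (by simp) (by simp) (by simp)
    with hH
  have hα : ∀ i j, l (D.fundamentalForm p (unimodularFrame (A.vol p) i)
      (unimodularFrame (A.vol p) j)) = H (ē i) (ē j) := by
    intro i j
    rw [D.apply_fundamentalForm l hcrit]
    have hc : ∀ v, LinearMap.toContinuousLinearMap l
        (mvfderiv (𝓡 n) (fun q => (f q -ᵥ o : V)) p v) = 0 := by
      intro v
      rw [← hf.affineDeriv_eq o]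
      exact hcrit v
    have h := apply_mvfderiv_extend (hf.1 o) hp (LinearMap.toContinuousLinearMap l) hc
      (unimodularFrame (A.vol p) i) (unimodularFrame (A.vol p) j)
    rw [← hφ, hpdef, φ.right_inv hy] at h
    simp only [hf.affineDeriv_eq o]
    exact h
  have hLK : D.lipschitzKilling A Ω p η =
      (-1) ^ n * (Matrix.of fun i j : Fin n => H (ē i) (ē j)).det := by
    rw [TransversalPair.lipschitzKilling]
    congr 2
    ext i j
    exact hα i j
  rw [hLK, abs_mul, abs_pow, abs_neg, abs_one, one_pow, one_mul, det_bilinear_comp, abs_mul,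
    abs_pow, sq_abs]
  congr 1
  exact eq_inv_of_mul_eq_one_left (by rw [← mul_pow, hdet, one_pow])

end Local

/-! ### The curvature integral over a fibre -/

section FibreIntegral

variable {n : ℕ} {M : Type*} [TopologicalSpace M] [ChartedSpace (EuclideanSpace ℝ (Fin n)) M]
  [IsManifold (𝓡 n) ∞ M] {V P : Type*} [NormedAddCommGroup V] [NormedSpace ℝ V] [AddTorsor V P]
  {f : M → P} {s : ℕ} {A : EquiaffineStructure n M} {Ω : V [⋀^Fin (n + (s + 1))]→ₗ[ℝ] ℝ}
  {D : TransversalPair n (V := V) f (s + 1)}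

theorem continuous_sumElim (α : Type*) {β : Type*} [Fintype α] [Fintype β]
    (y : EuclideanSpace ℝ α) :
    Continuous fun c : β → ℝ => (Sum.elim y c : α ⊕ β → ℝ) := by
  refine continuous_pi fun i => ?_
  rcases i with i | i
  · exact continuous_const
  · exact continuous_apply i

theorem lipschitzKilling_smul [FiniteDimensional ℝ V] (p : M) (c : ℝ) (η : ⋀[ℝ]^s (D.N p)) :
    D.lipschitzKilling A Ω p (c • η) = c ^ n * D.lipschitzKilling A Ω p η := by
  unfold TransversalPair.lipschitzKilling
  have : (Matrix.of fun i j : Fin n =>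
    height (k := n + s) Ω (D.gaussMap A p (c • η))
      (D.fundamentalForm p (unimodularFrame (A.vol p) i) (unimodularFrame (A.vol p) j))) =
      c • (Matrix.of fun i j : Fin n =>
    height (k := n + s) Ω (D.gaussMap A p η)
      (D.fundamentalForm p (unimodularFrame (A.vol p) i) (unimodularFrame (A.vol p) j))) := by
    ext i j
    simp
  rw [this, Matrix.det_smul, Fintype.card_fin]
  ring

/-- The height function of `ν(η)`, in the coordinates of the basis `w`, is the conormal covector
with the heights of `η` as its values on the frame of `N`. -/
theorem gaussMap_eq_conormalMap (hn : 1 ≤ n) (hf : IsSmoothImmersion n (V := V) f)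
    (hD : D.Induces A Ω) (w : Module.Basis (Fin (n + (s + 1))) ℝ V) (hw : Ω w = 1) (o : P) (x : M)
    {U : Set M} {ξ : Fin (s + 1) → M → V} (hξ : ∀ p ∈ U, LinearIndependent ℝ (fun i => ξ i p) ∧
        Submodule.span ℝ (Set.range fun i => ξ i p) = D.N p)
    {y : EuclideanSpace ℝ (Fin n)} (hy : y ∈ (chartAt (EuclideanSpace ℝ (Fin n)) x).target)
    (hyU : (chartAt (EuclideanSpace ℝ (Fin n)) x).symm y ∈ U)
    (η : ⋀[ℝ]^s (D.N ((chartAt (EuclideanSpace ℝ (Fin n)) x).symm y))) :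
    (fun k => height (k := n + s) Ω (D.gaussMap A _ η) (w.reindex finSumFinEquiv.symm k)) =
      conormalMap (chartFrameMatrix (w.reindex finSumFinEquiv.symm) f o x ξ) (Sum.elim y fun j =>
        height (D.vol _) η
          (sectionOfFrame D hξ j ((chartAt (EuclideanSpace ℝ (Fin n)) x).symm y))) := by
  symm
  have hdet := det_chartFrameMatrix_ne_zero hn hf hD w hw o x hξ y ⟨hy, hyU⟩
  rw [conormalMap_spec (by rwa [basePoint_elim]), basePoint_elim,
    chartFrameMatrix_mulVec hf _ o x ξ hy]
  have : (w.reindex finSumFinEquiv.symm).constr ℝ (fun k => height (k := n + s) Ω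
      (D.gaussMap A _ η) (w.reindex finSumFinEquiv.symm k)) =
        height (k := n + s) Ω (D.gaussMap A _ η) := Module.Basis.constr_self _ _ _
  rw [this]
  congr 1
  · funext i
    exact TransversalPair.height_gaussMap_affineDeriv hn _ η _
  · funext j
    rw [← coe_sectionOfFrame hξ j hyU]
    exact hD.height_gaussMap_of_mem hn _ η _

/-- The curvature integral over the fibre of the transversal ellipsoid bundle, in terms of the
Jacobian of the conormal map. -/
theorem fibre_integral_eq [FiniteDimensional ℝ V]
    (hn : 1 ≤ n) (hf : IsSmoothImmersion n (V := V) f)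
    (hD : D.Induces A Ω) (w : Module.Basis (Fin (n + (s + 1))) ℝ V) (hw : Ω w = 1)
    (o : P) (x : M)
    {U : Set M} (hU : IsOpen U) {ξ : Fin (s + 1) → M → V}
    (hξs : ∀ j, ContMDiffOn (𝓡 n) 𝓘(ℝ, V) ∞ (ξ j) U)
    (hξ : ∀ p ∈ U, LinearIndependent ℝ (fun i => ξ i p) ∧
        Submodule.span ℝ (Set.range fun i => ξ i p) = D.N p)
    {y : EuclideanSpace ℝ (Fin n)} (hy : y ∈ (chartAt (EuclideanSpace ℝ (Fin n)) x).target)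
    (hyU : (chartAt (EuclideanSpace ℝ (Fin n)) x).symm y ∈ U) :
    ENNReal.ofReal |chartDensity A.vol x y| *
      ∫⁻ η, ENNReal.ofReal
          |D.lipschitzKilling A Ω ((chartAt (EuclideanSpace ℝ (Fin n)) x).symm y) η|
        ∂(ellipsoidMeasure (inducedVolume (D.vol _)) (D.ellipsoidFibre A
          {φ | ∑ i, height (k := n + s) Ω φ (w i) ^ 2 = 1}
          ((chartAt (EuclideanSpace ℝ (Fin n)) x).symm y))) =
      (s + 1 : ℕ) * ∫⁻ c : Fin (s + 1) → ℝ,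
        ENNReal.ofReal |(fderiv ℝ (conormalMap
          (chartFrameMatrix (w.reindex finSumFinEquiv.symm) f o x ξ)) (Sum.elim y c)).det| *
        ballWeight n (conormalMap
          (chartFrameMatrix (w.reindex finSumFinEquiv.symm) f o x ξ) (Sum.elim y c)) := by
  have hLK := fun η => abs_lipschitzKilling_eq (A := A) (Ω := Ω) (D := D) hn hf o x hy η
  have hgauss := fun η => gaussMap_eq_conormalMap hn hf hD w hw o x hξ hy hyU η
  have hdet := det_chartFrameMatrix_ne_zero hn hf hD w hw o x hξ
  have hdetv := det_chartFrameMatrix hf hD w hw o x hξ hy hyU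
  have hd0 := chartDensity_ne_zero A hn hy
  have hν0 := vol_sectionOfFrame_ne_zero hξ hyU
  have hsm := fun i k =>
    contDiffOn_chartFrameMatrix hf (w.reindex finSumFinEquiv.symm) o x hU hξs i k
  have hWo := (chartAt (EuclideanSpace ℝ (Fin n)) x).isOpen_inter_preimage_symm hU
  set φ := chartAt (EuclideanSpace ℝ (Fin n)) x with hφ
  set w' := w.reindex finSumFinEquiv.symm with hw'
  set A' := chartFrameMatrix w' f o x ξ with hA'
  set F := (fun q => (f q -ᵥ o : V)) ∘ φ.symm with hF
  have hyW : y ∈ φ.target ∩ φ.symm ⁻¹' U := ⟨hy, hyU⟩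
  set W := φ.target ∩ φ.symm ⁻¹' U with hW
  have hbase : ∀ c : Fin (s + 1) → ℝ, Sum.elim y c ∈ basePoint (Fin n) (Fin (s + 1)) ⁻¹' W := by
    intro c
    rwa [Set.mem_preimage, basePoint_elim]
  have hcm := contDiffOn_conormalMap hsm hdet
  have hWo' : IsOpen (basePoint (Fin n) (Fin (s + 1)) ⁻¹' W) :=
    hWo.preimage (basePoint _ _).continuous
  have hGc : Continuous fun c : Fin (s + 1) → ℝ => conormalMap A' (Sum.elim y c) :=
    hcm.continuousOn.comp_continuous (continuous_sumElim (Fin n) y) hbase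
  have hG'c : Continuous fun c : Fin (s + 1) → ℝ =>
      (fderiv ℝ (conormalMap A') (Sum.elim y c)).det :=
    ContinuousLinearMap.continuous_det.comp
      ((hcm.continuousOn_fderiv_of_isOpen hWo' le_rfl).comp_continuous
        (continuous_sumElim (Fin n) y) hbase)
  have hset : D.ellipsoidFibre A {φ | ∑ i, height (k := n + s) Ω φ (w i) ^ 2 = 1} (φ.symm y) =
      {η | ∑ k, ((height (k := n + s) Ω).flip (w' k) ∘ₗ D.gaussMap A (φ.symm y)) η ^ 2 = 1} := by
    ext η
    simp only [TransversalPair.ellipsoidFibre, Set.mem_preimage, Set.mem_ofPred_eq,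
      LinearMap.comp_apply, LinearMap.flip_apply, hw', Module.Basis.reindex_apply,
      Equiv.symm_symm]
    rw [finSumFinEquiv.sum_comp fun i =>
      height (k := n + s) Ω (D.gaussMap A (φ.symm y) η) (w i) ^ 2]
  have hF2 : DifferentiableAt ℝ (fderiv ℝ F) y := by
    have := (contDiffOn_comp_chart_symm (hf.1 o) x).fderiv_of_isOpen (m := 1) φ.open_target
      (by norm_cast)
    exact (this.differentiableOn one_ne_zero).differentiableAt (φ.open_target.mem_nhds hy)
  set c₀ : ℝ := (chartDensity A.vol x y ^ 2)⁻¹ * |(A' y).det| with hc₀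
  have hQ : ∀ η, |D.lipschitzKilling A Ω (φ.symm y) η| = c₀ *
      |(fderiv ℝ (conormalMap A') (Sum.elim y fun j => height (D.vol _) η
        (sectionOfFrame D hξ j (φ.symm y)))).det| := by
    intro η
    have h1 := det_mul_det_fderiv_conormalMap hWo hsm hdet
      (hbase fun j => height (D.vol _) η (sectionOfFrame D hξ j (φ.symm y)))
    rw [hLK, hc₀, mul_assoc, ← abs_mul]
    rw [← hgauss η, basePoint_elim] at h1
    rw [h1]
    congr 1
    have h2 : w'.constr ℝ (fun k => height (k := n + s) Ω (D.gaussMap A _ η) (w' k)) =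
        height (k := n + s) Ω (D.gaussMap A (φ.symm y) η) := Module.Basis.constr_self _ _ _
    have h3 : (Matrix.of fun i j : Fin n => -∑ k, fderiv ℝ (fun y => A' y (Sum.inl i) k) y
        (EuclideanSpace.single j 1) *
          height (k := n + s) Ω (D.gaussMap A (φ.symm y) η) (w' k)) =
        -(Matrix.of fun i j : Fin n => height (k := n + s) Ω (D.gaussMap A (φ.symm y) η)
          (fderiv ℝ (fderiv ℝ F) y (EuclideanSpace.single i 1)
            (EuclideanSpace.single j 1))).transpose := by
      ext i j
      simp only [Matrix.of_apply, Matrix.neg_apply, Matrix.transpose_apply]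
      have h4 := sum_fderiv_frameMatrix (w := w') (Ξ := fun j y => ξ j (φ.symm y)) hF2 i
        (EuclideanSpace.single j 1)
        fun k => height (k := n + s) Ω (D.gaussMap A (φ.symm y) η) (w' k)
      rw [h2] at h4
      exact congrArg Neg.neg h4
    rw [h3, Matrix.det_neg, Matrix.det_transpose, abs_mul, abs_pow, abs_neg, abs_one, one_pow,
      one_mul]
  have hmain := lintegral_ellipsoidMeasure_inducedVolume (n := n) (D.finrank_N (φ.symm y)) (D.vol _)
    (fun j => sectionOfFrame D hξ j (φ.symm y)) hν0
    (fun k => (height (k := n + s) Ω).flip (w' k) ∘ₗ D.gaussMap A (φ.symm y))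
    (h := fun η => ENNReal.ofReal |D.lipschitzKilling A Ω (φ.symm y) η|)
    (fun c η hc => by
      rw [lipschitzKilling_smul, abs_mul, ENNReal.ofReal_mul (abs_nonneg _),
        abs_of_pos (pow_pos hc n)])
    (G := fun c => conormalMap A' (Sum.elim y c)) hGc.measurable
    (fun η => hgauss η)
    (fun c hc => by
      rw [conormalMap_spec (by rw [basePoint_elim]; exact hdet y hyW), Matrix.mulVec_zero] at hc
      funext j
      exact (congrFun hc (Sum.inr j)).symm)
    (Q := fun c => ENNReal.ofReal (c₀ * |(fderiv ℝ (conormalMap A') (Sum.elim y c)).det|))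
    (ENNReal.measurable_ofReal.comp ((hG'c.abs.measurable).const_mul c₀))
    (fun η => by rw [hQ])
  rw [hset, hmain]
  have hc₀' : 0 ≤ c₀ := by positivity
  -- The factors from `|θ|`, from `|θ^⊥|` and from the determinant of the frame cancel.
  have hconst : ENNReal.ofReal |chartDensity A.vol x y| * ENNReal.ofReal
      |(D.vol (φ.symm y) fun j => sectionOfFrame D hξ j (φ.symm y))⁻¹| * ENNReal.ofReal c₀ = 1 := by
    rw [← ENNReal.ofReal_mul (abs_nonneg _), ← ENNReal.ofReal_mul (by positivity),
      ENNReal.ofReal_eq_one, hc₀, hdetv, abs_mul, abs_inv, ← sq_abs]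
    have h1 := abs_ne_zero.2 hd0
    have h2 := abs_ne_zero.2 hν0
    field_simp
  rw [mul_left_comm, ← mul_assoc (ENNReal.ofReal |chartDensity A.vol x y|)]
  congr 1
  have hsplit : ∀ c : Fin (s + 1) → ℝ, ballWeight n (conormalMap A' (Sum.elim y c)) *
      ENNReal.ofReal (c₀ * |(fderiv ℝ (conormalMap A') (Sum.elim y c)).det|) =
      ENNReal.ofReal c₀ * (ENNReal.ofReal |(fderiv ℝ (conormalMap A') (Sum.elim y c)).det| *
        ballWeight n (conormalMap A' (Sum.elim y c))) := by
    intro c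
    rw [ENNReal.ofReal_mul hc₀']
    ring
  simp only [hsplit]
  rw [lintegral_const_mul' _ _ ENNReal.ofReal_ne_top, ← mul_assoc, hconst, one_mul]

end FibreIntegral

/-! ### The curvature integral over a coordinate domain -/

section LocalFormula

variable {n : ℕ} {M : Type*} [TopologicalSpace M] [ChartedSpace (EuclideanSpace ℝ (Fin n)) M]
  [IsManifold (𝓡 n) ∞ M] {V P : Type*} [NormedAddCommGroup V] [NormedSpace ℝ V] [AddTorsor V P]
  {f : M → P} {s : ℕ} {A : EquiaffineStructure n M} {Ω : V [⋀^Fin (n + (s + 1))]→ₗ[ℝ] ℝ}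
  {D : TransversalPair n (V := V) f (s + 1)}

/-- Criticality may be tested on the coordinate vectors. -/
theorem mem_criticalSet_iff_chart (l : V →ₗ[ℝ] ℝ) (x : M) {y : EuclideanSpace ℝ (Fin n)}
    (hy : y ∈ (chartAt (EuclideanSpace ℝ (Fin n)) x).target) :
    (chartAt (EuclideanSpace ℝ (Fin n)) x).symm y ∈ criticalSet n f l ↔
      ∀ i, l (affineDeriv (V := V) f ((chartAt (EuclideanSpace ℝ (Fin n)) x).symm y)
          (mfderiv (𝓡 n) (𝓡 n) (chartAt (EuclideanSpace ℝ (Fin n)) x).symm y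
            (EuclideanSpace.single i (1 : ℝ)))) = 0 := by
  refine ⟨fun h i => h _, fun h v => ?_⟩
  have hbij := bijective_mfderiv_chart ((chartAt (EuclideanSpace ℝ (Fin n)) x).map_target hy)
  have hinv := fun v => mfderiv_chart_mfderiv_symm hy v
  revert v
  set φ := chartAt (EuclideanSpace ℝ (Fin n)) x
  intro v
  have hv : v = mfderiv (𝓡 n) (𝓡 n) φ.symm y (mfderiv (𝓡 n) (𝓡 n) φ (φ.symm y) v) :=
    (hbij.1 (hinv _)).symm
  set T : EuclideanSpace ℝ (Fin n) →ₗ[ℝ] ℝ := l ∘ₗ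
    ((affineDeriv (V := V) f (φ.symm y)).toLinearMap ∘ₗ
      (mfderiv (𝓡 n) (𝓡 n) φ.symm y).toLinearMap) with hT
  have hT0 : T = 0 := by
    refine (EuclideanSpace.basisFun (Fin n) ℝ).toBasis.ext fun i => ?_
    simp only [OrthonormalBasis.coe_toBasis, EuclideanSpace.basisFun_apply]
    exact h i
  rw [hv]
  exact congrArg (fun T : EuclideanSpace ℝ (Fin n) →ₗ[ℝ] ℝ =>
    T (mfderiv (𝓡 n) (𝓡 n) φ (φ.symm y) v)) hT0

/-- The preimages of a covector under the conormal map over `B` correspond to its critical points in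
`B`: the base point determines the other coordinates, as the values of the covector on the frame of
`N`. -/
theorem encard_conormalMap_fibre (hn : 1 ≤ n) (hf : IsSmoothImmersion n (V := V) f)
    (hD : D.Induces A Ω) (w : Module.Basis (Fin (n + (s + 1))) ℝ V) (hw : Ω w = 1)
    (o : P) (x : M)
    {U : Set M} {ξ : Fin (s + 1) → M → V}
    (hξ : ∀ p ∈ U, LinearIndependent ℝ (fun i => ξ i p) ∧
        Submodule.span ℝ (Set.range fun i => ξ i p) = D.N p)
    {B : Set M} (hBs : B ⊆ (chartAt (EuclideanSpace ℝ (Fin n)) x).source) (hBU : B ⊆ U)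
    (ℓ : Fin n ⊕ Fin (s + 1) → ℝ) :
    (basePoint (Fin n) (Fin (s + 1)) ⁻¹' ((chartAt (EuclideanSpace ℝ (Fin n)) x).target ∩
      (chartAt (EuclideanSpace ℝ (Fin n)) x).symm ⁻¹' B) ∩
      conormalMap (chartFrameMatrix (w.reindex finSumFinEquiv.symm) f o x ξ) ⁻¹' {ℓ}).encard =
    (B ∩ criticalSet n f ((w.reindex finSumFinEquiv.symm).constr ℝ ℓ)).encard := by
  have hdet := det_chartFrameMatrix_ne_zero hn hf hD w hw o x hξ
  set w' := w.reindex finSumFinEquiv.symm with hw'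
  have hspec : ∀ z : Fin n ⊕ Fin (s + 1) → ℝ, basePoint (Fin n) (Fin (s + 1)) z ∈
      (chartAt (EuclideanSpace ℝ (Fin n)) x).target ∩
        (chartAt (EuclideanSpace ℝ (Fin n)) x).symm ⁻¹' B →
      (conormalMap (chartFrameMatrix w' f o x ξ) z = ℓ ↔
        (chartAt (EuclideanSpace ℝ (Fin n)) x).symm (basePoint (Fin n) (Fin (s + 1)) z) ∈
          criticalSet n f (w'.constr ℝ ℓ) ∧
        ∀ j, w'.constr ℝ ℓ (ξ j ((chartAt (EuclideanSpace ℝ (Fin n)) x).symm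
          (basePoint (Fin n) (Fin (s + 1)) z))) = z (Sum.inr j)) := by
    intro z hz
    rw [conormalMap_spec (hdet _ ⟨hz.1, hBU hz.2⟩), chartFrameMatrix_mulVec hf _ o x ξ hz.1,
      mem_criticalSet_iff_chart _ x hz.1, Sum.elim_eq_iff, funext_iff, funext_iff]
    rfl
  set φ := chartAt (EuclideanSpace ℝ (Fin n)) x with hφ
  set Z := basePoint (Fin n) (Fin (s + 1)) ⁻¹' (φ.target ∩ φ.symm ⁻¹' B) ∩
    conormalMap (chartFrameMatrix w' f o x ξ) ⁻¹' {ℓ} with hZ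
  have hinj : Set.InjOn (fun z => φ.symm (basePoint (Fin n) (Fin (s + 1)) z)) Z := by
    rintro z ⟨hz, hzℓ⟩ z' ⟨hz', hzℓ'⟩ h
    have hb : basePoint (Fin n) (Fin (s + 1)) z = basePoint (Fin n) (Fin (s + 1)) z' :=
      φ.symm.injOn hz.1 hz'.1 h
    have h1 := ((hspec z hz).1 hzℓ).2
    have h2 := ((hspec z' hz').1 hzℓ').2
    funext i
    rcases i with i | j
    · exact congrArg (fun y : EuclideanSpace ℝ (Fin n) => y i) hb
    · rw [← h1, ← h2, hb]
  rw [← hinj.encard_image]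
  congr 1
  ext p
  constructor
  · rintro ⟨z, ⟨hz, hzℓ⟩, rfl⟩
    exact ⟨hz.2, ((hspec z hz).1 hzℓ).1⟩
  · rintro ⟨hpB, hp⟩
    have hps := hBs hpB
    have hbz : basePoint (Fin n) (Fin (s + 1))
        (Sum.elim (φ p) fun j => w'.constr ℝ ℓ (ξ j p)) = φ p := basePoint_elim _ _
    have hz : basePoint (Fin n) (Fin (s + 1))
        (Sum.elim (φ p) fun j => w'.constr ℝ ℓ (ξ j p)) ∈ φ.target ∩ φ.symm ⁻¹' B := by
      rw [hbz]
      exact ⟨φ.map_source hps, by rwa [Set.mem_preimage, φ.left_inv hps]⟩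
    refine ⟨Sum.elim (φ p) fun j => w'.constr ℝ ℓ (ξ j p), ⟨hz, ?_⟩, ?_⟩
    · refine (hspec _ hz).2 ⟨?_, fun j => ?_⟩
      · rwa [hbz, φ.left_inv hps]
      · rw [hbz, φ.left_inv hps]
        rfl
    · simp only [hbz]
      exact φ.left_inv hps

/-- Continuity of the component of `θ` in a chart. It is a quotient of the determinant of the frame
by the component of `θ^⊥`. -/
theorem continuousOn_chartDensity (hf : IsSmoothImmersion n (V := V) f)
    (hD : D.Induces A Ω) (w : Module.Basis (Fin (n + (s + 1))) ℝ V) (hw : Ω w = 1)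
    (o : P) (x : M)
    {U : Set M} (hU : IsOpen U) {ξ : Fin (s + 1) → M → V}
    (hξs : ∀ j, ContMDiffOn (𝓡 n) 𝓘(ℝ, V) ∞ (ξ j) U)
    (hξ : ∀ p ∈ U, LinearIndependent ℝ (fun i => ξ i p) ∧
        Submodule.span ℝ (Set.range fun i => ξ i p) = D.N p) :
    ContinuousOn (chartDensity A.vol x) ((chartAt (EuclideanSpace ℝ (Fin n)) x).target ∩
      (chartAt (EuclideanSpace ℝ (Fin n)) x).symm ⁻¹' U) := by
  have hsm := fun i k =>
    contDiffOn_chartFrameMatrix hf (w.reindex finSumFinEquiv.symm) o x hU hξs i k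
  have h1 := (contDiffOn_det hsm).continuousOn
  have h2 := D.vol_smooth U hU (sectionOfFrame D hξ) fun j =>
    (hξs j).congr fun p hp => coe_sectionOfFrame hξ j hp
  have h3 := h2.continuousOn.comp ((chartAt (EuclideanSpace ℝ (Fin n)) x).continuousOn_symm.mono
    (Set.inter_subset_left (t := (chartAt (EuclideanSpace ℝ (Fin n)) x).symm ⁻¹' U)))
    fun y hy => hy.2
  refine (h1.div h3 fun y hy => vol_sectionOfFrame_ne_zero hξ hy.2).congr fun y hy => ?_
  exact eq_div_of_mul_eq (vol_sectionOfFrame_ne_zero hξ hy.2)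
    (det_chartFrameMatrix hf hD w hw o x hξ hy.1 hy.2).symm

/-- The curvature integral over a measurable part `B` of a coordinate domain on which `N` has a
frame counts the critical points of height functions in `B`. -/
theorem setLIntegral_chartMeasure_lipschitzKilling [MeasurableSpace M] [BorelSpace M]
    [FiniteDimensional ℝ V]
    (hn : 1 ≤ n) (hf : IsSmoothImmersion n (V := V) f)
    (hD : D.Induces A Ω) (w : Module.Basis (Fin (n + (s + 1))) ℝ V) (hw : Ω w = 1)
    (o : P) (x : M)
    {U : Set M} (hU : IsOpen U) {ξ : Fin (s + 1) → M → V}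
    (hξs : ∀ j, ContMDiffOn (𝓡 n) 𝓘(ℝ, V) ∞ (ξ j) U)
    (hξ : ∀ p ∈ U, LinearIndependent ℝ (fun i => ξ i p) ∧
        Submodule.span ℝ (Set.range fun i => ξ i p) = D.N p)
    {B : Set M} (hB : MeasurableSet B)
    (hBs : B ⊆ (chartAt (EuclideanSpace ℝ (Fin n)) x).source) (hBU : B ⊆ U) :
    AEMeasurable (fun ℓ : Fin n ⊕ Fin (s + 1) → ℝ =>
        ((B ∩ criticalSet n f ((w.reindex finSumFinEquiv.symm).constr ℝ ℓ)).encard : ℝ≥0∞))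
        volume ∧
      ∫⁻ p in B, (∫⁻ η, ENNReal.ofReal |D.lipschitzKilling A Ω p η|
          ∂(ellipsoidMeasure (inducedVolume (D.vol p)) (D.ellipsoidFibre A
            {φ | ∑ i, height (k := n + s) Ω φ (w i) ^ 2 = 1} p))) ∂(chartMeasure A.vol x) =
        (s + 1 : ℕ) * ∫⁻ ℓ : Fin n ⊕ Fin (s + 1) → ℝ, ballWeight n ℓ *
          ((B ∩ criticalSet n f ((w.reindex finSumFinEquiv.symm).constr ℝ ℓ)).encard : ℝ≥0∞) := by
  have hT := measurableSet_chart_symm_preimage (n := n) x hB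
  have hTW : (chartAt (EuclideanSpace ℝ (Fin n)) x).target ∩
        (chartAt (EuclideanSpace ℝ (Fin n)) x).symm ⁻¹' B ⊆
      (chartAt (EuclideanSpace ℝ (Fin n)) x).target ∩
        (chartAt (EuclideanSpace ℝ (Fin n)) x).symm ⁻¹' U :=
    fun y hy => ⟨hy.1, hBU hy.2⟩
  have hdens : AEMeasurable (chartDensity A.vol x) (volume.restrict
      ((chartAt (EuclideanSpace ℝ (Fin n)) x).target ∩
        (chartAt (EuclideanSpace ℝ (Fin n)) x).symm ⁻¹' B)) :=
    ((continuousOn_chartDensity hf hD w hw o x hU hξs hξ).mono hTW).aemeasurable hT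
  have hWo := (chartAt (EuclideanSpace ℝ (Fin n)) x).isOpen_inter_preimage_symm hU
  have hcm := contDiffOn_conormalMap
    (fun i k => contDiffOn_chartFrameMatrix hf (w.reindex finSumFinEquiv.symm) o x hU hξs i k)
    (det_chartFrameMatrix_ne_zero hn hf hD w hw o x hξ)
  have hcard := encard_conormalMap_fibre hn hf hD w hw o x hξ hBs hBU
  have hfib := fun y hy hyU => fibre_integral_eq hn hf hD w hw o x hU hξs hξ (y := y) hy hyU
  rw [setLIntegral_chartMeasure A.vol x hB _ hdens]
  set φ := chartAt (EuclideanSpace ℝ (Fin n)) x with hφ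
  set Gm := conormalMap (chartFrameMatrix (w.reindex finSumFinEquiv.symm) f o x ξ) with hGm
  set T := φ.target ∩ φ.symm ⁻¹' B with hTdef
  set W := φ.target ∩ φ.symm ⁻¹' U with hW
  have hWo' : IsOpen (basePoint (Fin n) (Fin (s + 1)) ⁻¹' W) :=
    hWo.preimage (basePoint _ _).continuous
  have hT' : MeasurableSet (basePoint (Fin n) (Fin (s + 1)) ⁻¹' T) :=
    (basePoint _ _).continuous.measurable hT
  have hTW' : basePoint (Fin n) (Fin (s + 1)) ⁻¹' T ⊆ basePoint (Fin n) (Fin (s + 1)) ⁻¹' W :=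
    Set.preimage_mono hTW
  have hder : ContinuousOn (fderiv ℝ Gm) (basePoint (Fin n) (Fin (s + 1)) ⁻¹' W) :=
    hcm.continuousOn_fderiv_of_isOpen hWo' le_rfl
  obtain ⟨harea1, harea2⟩ := lintegral_abs_det_fderiv_mul_eq_lintegral_mul_encard volume hT'
    (f := Gm) (f' := fderiv ℝ Gm)
    (fun z hz => (((hcm.differentiableOn one_ne_zero).differentiableAt
      (hWo'.mem_nhds (hTW' hz))).hasFDerivAt).hasFDerivWithinAt) (hder.mono hTW')
  simp only [hcard] at harea1 harea2
  refine ⟨harea1, ?_⟩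
  rw [← harea2 _ (measurable_ballWeight n), setLIntegral_basePoint_preimage,
    ← lintegral_const_mul' _ _ (ENNReal.natCast_ne_top _)]
  · exact setLIntegral_congr_fun hT fun y hy => hfib y hy.1 (hBU hy.2)
  · refine AEMeasurable.mul ?_ ((measurable_ballWeight n).comp_aemeasurable
      ((hcm.continuousOn.mono hTW').aemeasurable hT'))
    exact ENNReal.measurable_ofReal.comp_aemeasurable
      ((ContinuousLinearMap.continuous_det.comp_continuousOn (hder.mono hTW')).abs.aemeasurable hT')

end LocalFormula

/-! ### The curvature integral and critical points of height functions -/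

section GlobalFormula

variable {n : ℕ} {M : Type*} [TopologicalSpace M] [ChartedSpace (EuclideanSpace ℝ (Fin n)) M]
  [IsManifold (𝓡 n) ∞ M] {V P : Type*} [NormedAddCommGroup V] [NormedSpace ℝ V] [AddTorsor V P]
  {f : M → P} {s : ℕ} {A : EquiaffineStructure n M} {Ω : V [⋀^Fin (n + (s + 1))]→ₗ[ℝ] ℝ}
  {D : TransversalPair n (V := V) f (s + 1)}

/-- The curvature integral of a compact immersed manifold counts the critical points of height
functions. The manifold is cut into finitely many Borel pieces, each in a coordinate domain over
which `N` has a frame. -/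
theorem lintegral_lipschitzKilling [CompactSpace M] [MeasurableSpace M] [BorelSpace M]
    [FiniteDimensional ℝ V]
    (hn : 1 ≤ n) (hf : IsSmoothImmersion n (V := V) f)
    (hD : D.Induces A Ω) (w : Module.Basis (Fin (n + (s + 1))) ℝ V) (hw : Ω w = 1) :
    AEMeasurable (fun ℓ : Fin n ⊕ Fin (s + 1) → ℝ =>
        ((criticalSet n f ((w.reindex finSumFinEquiv.symm).constr ℝ ℓ)).encard : ℝ≥0∞))
        volume ∧
      ∫⁻ p, (∫⁻ η, ENNReal.ofReal |D.lipschitzKilling A Ω p η|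
          ∂(ellipsoidMeasure (inducedVolume (D.vol p)) (D.ellipsoidFibre A
            {φ | ∑ i, height (k := n + s) Ω φ (w i) ^ 2 = 1} p))) ∂(volumeMeasure A.vol) =
        (s + 1 : ℕ) * ∫⁻ ℓ : Fin n ⊕ Fin (s + 1) → ℝ, ballWeight n ℓ *
          ((criticalSet n f ((w.reindex finSumFinEquiv.symm).constr ℝ ℓ)).encard : ℝ≥0∞) := by
  obtain ⟨o⟩ : Nonempty P := inferInstance
  choose U hU hpU ξ hξs hξ using D.smooth_frame
  obtain ⟨t, -, ht⟩ := isCompact_univ.elim_nhds_subcover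
    (fun p => (chartAt (EuclideanSpace ℝ (Fin n)) p).source ∩ U p)
    fun p _ => (((chartAt (EuclideanSpace ℝ (Fin n)) p).open_source).inter (hU p)).mem_nhds
      ⟨mem_chart_source _ p, hpU p⟩
  set x : Fin t.card → M := fun i => t.equivFin.symm i with hx
  set O : Fin t.card → Set M := fun i =>
    (chartAt (EuclideanSpace ℝ (Fin n)) (x i)).source ∩ U (x i) with hO
  have hOo : ∀ i, IsOpen (O i) := fun i =>
    ((chartAt (EuclideanSpace ℝ (Fin n)) (x i)).open_source).inter (hU (x i))
  have hcov : ⋃ i, disjointed O i = Set.univ := by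
    rw [iUnion_disjointed, Set.eq_univ_iff_forall]
    intro p
    obtain ⟨q, hq, hpq⟩ := Set.mem_iUnion₂.1 (ht (Set.mem_univ p))
    refine Set.mem_iUnion.2 ⟨t.equivFin ⟨q, hq⟩, ?_⟩
    simpa [hO, hx] using hpq
  have hmeas : ∀ i, MeasurableSet (disjointed O i) := fun i => by
    rw [disjointed_apply, Finset.sup_set_eq_biUnion]
    exact (hOo i).measurableSet.diff
      (Finset.measurableSet_biUnion _ fun j _ => (hOo j).measurableSet)
  have hsub : ∀ i, disjointed O i ⊆ O i := fun i => disjointed_subset O i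
  have hdisj : Pairwise (Function.onFun Disjoint (disjointed O)) := disjoint_disjointed O
  have hloc := fun i => setLIntegral_chartMeasure_lipschitzKilling hn hf hD w hw o (x i)
    (hU (x i)) (hξs (x i)) (hξ (x i)) (hmeas i) (fun p hp => (hsub i hp).1)
    fun p hp => (hsub i hp).2
  have hcard : ∀ ℓ : Fin n ⊕ Fin (s + 1) → ℝ,
      ((criticalSet n f ((w.reindex finSumFinEquiv.symm).constr ℝ ℓ)).encard : ℝ≥0∞) =
      ∑ i, ((disjointed O i ∩
        criticalSet n f ((w.reindex finSumFinEquiv.symm).constr ℝ ℓ)).encard : ℝ≥0∞) := by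
    intro ℓ
    have h1 : criticalSet n f ((w.reindex finSumFinEquiv.symm).constr ℝ ℓ) = ⋃ i, (disjointed O i ∩
        criticalSet n f ((w.reindex finSumFinEquiv.symm).constr ℝ ℓ)) := by
      rw [← Set.iUnion_inter, hcov, Set.univ_inter]
    conv_lhs => rw [h1]
    rw [Set.encard_iUnion_of_finite, finsum_eq_sum_of_fintype]
    · exact map_sum ENat.toENNRealRingHom _ _
    · exact fun i j hij => ((hdisj hij).mono Set.inter_subset_left Set.inter_subset_left)
  refine ⟨?_, ?_⟩
  · simp only [hcard]
    exact Finset.aemeasurable_fun_sum _ fun i _ => (hloc i).1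
  · rw [lintegral_volumeMeasure A.vol x (disjointed O) hmeas hdisj hcov fun i p hp => (hsub i hp).1]
    simp only [hcard, Finset.mul_sum]
    have hm : ∀ i, AEMeasurable (fun ℓ : Fin n ⊕ Fin (s + 1) → ℝ => ballWeight n ℓ *
        ((disjointed O i ∩
          criticalSet n f ((w.reindex finSumFinEquiv.symm).constr ℝ ℓ)).encard : ℝ≥0∞)) volume :=
      fun i => (measurable_ballWeight n).aemeasurable.mul (hloc i).1
    rw [lintegral_finsetSum' _ fun i _ => hm i, Finset.mul_sum]
    exact Finset.sum_congr rfl fun i _ => (hloc i).2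

end GlobalFormula

/-! ### Extrema of height functions -/

section CriticalPoints

variable {n : ℕ} {M : Type*} [TopologicalSpace M] [ChartedSpace (EuclideanSpace ℝ (Fin n)) M]
  [IsManifold (𝓡 n) ∞ M] {V P : Type*} [NormedAddCommGroup V] [NormedSpace ℝ V] [AddTorsor V P]
  [FiniteDimensional ℝ V] {f : M → P}

theorem mem_criticalSet_of_forall_le (hf : IsSmoothImmersion n (V := V) f) (o : P) (l : V →ₗ[ℝ] ℝ)
    {p : M} (hp : ∀ q, l (f q -ᵥ o) ≤ l (f p -ᵥ o)) : p ∈ criticalSet n f l := by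
  intro v
  rw [hf.affineDeriv_eq o,
    mvfderiv_eq_fderiv_chart (mem_chart_source _ p) (hf.mdifferentiableAt o p)]
  have hd := differentiableAt_comp_chart_symm (mem_chart_source _ p) (hf.mdifferentiableAt o p)
  set φ := chartAt (EuclideanSpace ℝ (Fin n)) p
  have hmax : IsLocalMax (fun y => LinearMap.toContinuousLinearMap l
      (((fun q => (f q -ᵥ o : V)) ∘ φ.symm) y)) (φ p) := by
    refine Filter.Eventually.of_forall fun y => ?_
    simpa [φ.left_inv (mem_chart_source _ p)] using hp (φ.symm y)
  have h1 := ((LinearMap.toContinuousLinearMap l).hasFDerivAt.comp (φ p) hd.hasFDerivAt)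
  have h2 := hmax.hasFDerivAt_eq_zero h1
  exact congrArg (fun T : EuclideanSpace ℝ (Fin n) →L[ℝ] ℝ =>
    T (mfderiv (𝓡 n) (𝓡 n) φ p v : EuclideanSpace ℝ (Fin n))) h2

theorem mem_criticalSet_of_forall_ge (hf : IsSmoothImmersion n (V := V) f) (o : P) (l : V →ₗ[ℝ] ℝ)
    {p : M} (hp : ∀ q, l (f p -ᵥ o) ≤ l (f q -ᵥ o)) : p ∈ criticalSet n f l := by
  intro v
  have := mem_criticalSet_of_forall_le hf o (-l) (p := p) (fun q => by simpa using hp q) v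
  simpa using this

/-- A height function on a compact manifold of positive dimension has at least two critical
points: where it is constant, every point is critical. -/
theorem two_le_encard_criticalSet [CompactSpace M] [Nonempty M] (hn : 1 ≤ n)
    (hf : IsSmoothImmersion n (V := V) f) (l : V →ₗ[ℝ] ℝ) : 2 ≤ (criticalSet n f l).encard := by
  obtain ⟨o⟩ : Nonempty P := inferInstance
  have hc : Continuous fun q => l (f q -ᵥ o) :=
    (LinearMap.toContinuousLinearMap l).continuous.comp (hf.1 o).continuous
  obtain ⟨p, -, hp⟩ := isCompact_univ.exists_isMaxOn Set.univ_nonempty hc.continuousOn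
  obtain ⟨q, -, hq⟩ := isCompact_univ.exists_isMinOn Set.univ_nonempty hc.continuousOn
  have hp' : ∀ z, l (f z -ᵥ o) ≤ l (f p -ᵥ o) := fun z => hp (Set.mem_univ z)
  have hq' : ∀ z, l (f q -ᵥ o) ≤ l (f z -ᵥ o) := fun z => hq (Set.mem_univ z)
  by_cases hpq : p = q
  · subst hpq
    have huniv : ∀ z, z ∈ criticalSet n f l := fun z =>
      mem_criticalSet_of_forall_le hf o l fun y => (hp' y).trans (hq' z)
    set φ := chartAt (EuclideanSpace ℝ (Fin n)) p
    have : Nonempty (Fin n) := ⟨⟨0, hn⟩⟩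
    obtain ⟨a, ha, b, hb, hab⟩ := (infinite_of_mem_nhds (φ p)
      (φ.open_target.mem_nhds (φ.map_source (mem_chart_source _ p)))).nontrivial
    rw [← Set.encard_pair fun h => hab (φ.symm.injOn ha hb h)]
    exact Set.encard_le_encard fun z _ => huniv z
  · rw [← Set.encard_pair hpq]
    refine Set.encard_le_encard fun z hz => ?_
    rcases hz with rfl | rfl
    · exact mem_criticalSet_of_forall_le hf o l hp'
    · exact mem_criticalSet_of_forall_ge hf o l hq'

end CriticalPoints

/-! ### Minimal total absolute curvature -/

section TotalCurvatureTwo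

theorem lintegral_ballWeight (n s : ℕ) :
    ((s + 1 : ℕ) : ℝ≥0∞) * ∫⁻ x : Fin n ⊕ Fin (s + 1) → ℝ, ballWeight n x =
      (volume : Measure (EuclideanSpace ℝ (Fin (n + (s + 1))))).toSphere Set.univ := by
  rw [← volume_ball_mul_eq]
  congr 1
  have h := volume_measurePreserving_piCongrLeft (fun _ : Fin (n + (s + 1)) => ℝ)
    (finSumFinEquiv (m := n) (n := s + 1))
  rw [← h.lintegral_comp_emb (MeasurableEquiv.measurableEmbedding _)]
  refine lintegral_congr fun x => ?_
  rw [← ballWeight_reindex n (finSumFinEquiv (m := n) (n := s + 1))]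
  congr 1
  funext i
  exact (Equiv.piCongrLeft_apply_apply (fun _ : Fin (n + (s + 1)) => ℝ) finSumFinEquiv x i).symm

/-- A function which is invariant under scaling is determined almost everywhere by its values on the
unit ball. -/
theorem ae_eq_of_ae_mul_ballWeight_eq {ι : Type*} [Fintype ι] [Nonempty ι] {n : ℕ}
    {C : (ι → ℝ) → ℝ≥0∞} (hC : ∀ (c : ℝ) ℓ, c ≠ 0 → C (c • ℓ) = C ℓ) {a : ℝ≥0∞}
    (h : ∀ᵐ ℓ, ballWeight n ℓ * a = ballWeight n ℓ * C ℓ) : ∀ᵐ ℓ, C ℓ = a := by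
  have htop : ∀ ℓ : ι → ℝ, ballWeight n ℓ ≠ ⊤ := by
    intro ℓ
    unfold ballWeight Set.indicator
    split_ifs
    · exact ENNReal.ofReal_ne_top
    · exact ENNReal.zero_ne_top
  have hscale : ∀ k : ℕ, ∀ᵐ ℓ : ι → ℝ, ballWeight n (((k : ℝ) + 1)⁻¹ • ℓ) * a =
      ballWeight n (((k : ℝ) + 1)⁻¹ • ℓ) * C (((k : ℝ) + 1)⁻¹ • ℓ) := by
    intro k
    have hk : ((k : ℝ) + 1)⁻¹ ≠ 0 := by positivity
    rw [ae_iff] at h ⊢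
    have := Measure.addHaar_preimage_smul (volume : Measure (ι → ℝ)) hk
      {ℓ | ¬ballWeight n ℓ * a = ballWeight n ℓ * C ℓ}
    rw [h, mul_zero] at this
    exact this
  filter_upwards [ae_all_iff.2 hscale, Measure.ae_ne volume (0 : ι → ℝ)] with ℓ hℓ h0
  -- Scale `ℓ` into the unit ball.
  obtain ⟨k, hk⟩ := exists_nat_ge (∑ i, ℓ i ^ 2)
  have hk1 : ((k : ℝ) + 1)⁻¹ ≠ 0 := by positivity
  have hne : ballWeight n (((k : ℝ) + 1)⁻¹ • ℓ) ≠ 0 := by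
    refine ballWeight_ne_zero (smul_ne_zero hk1 h0) ?_
    simp only [Pi.smul_apply, smul_eq_mul, mul_pow, ← Finset.mul_sum]
    rw [inv_pow, inv_mul_le_iff₀ (by positivity)]
    nlinarith [Nat.cast_nonneg (α := ℝ) k]
  have := (ENNReal.mul_right_inj hne (htop _)).1 (hℓ k)
  rw [hC _ _ hk1] at this
  exact this.symm

variable {n : ℕ} {M : Type*} [TopologicalSpace M] [ChartedSpace (EuclideanSpace ℝ (Fin n)) M]
  [IsManifold (𝓡 n) ∞ M] {V P : Type*} [NormedAddCommGroup V] [NormedSpace ℝ V] [AddTorsor V P]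
  {f : M → P} {s : ℕ} {A : EquiaffineStructure n M} {Ω : V [⋀^Fin (n + (s + 1))]→ₗ[ℝ] ℝ}
  {D : TransversalPair n (V := V) f (s + 1)}

omit [IsManifold (𝓡 n) ∞ M] in
theorem criticalSet_smul (l : V →ₗ[ℝ] ℝ) {c : ℝ} (hc : c ≠ 0) :
    criticalSet n f (c • l) = criticalSet n f l := by
  ext p
  simp [criticalSet, hc]

/-- The total absolute curvature is `2` if and only if almost every height function has exactly two
critical points. -/
theorem totalAbsoluteCurvature_eq_two_iff [CompactSpace M] [Nonempty M] [MeasurableSpace M]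
    [BorelSpace M] [FiniteDimensional ℝ V]
    (hn : 1 ≤ n) (hf : IsSmoothImmersion n (V := V) f)
    (hD : D.Induces A Ω) (w : Module.Basis (Fin (n + (s + 1))) ℝ V) (hw : Ω w = 1) :
    D.totalAbsoluteCurvature A Ω {φ | ∑ i, height (k := n + s) Ω φ (w i) ^ 2 = 1} = 2 ↔
      ∀ᵐ ℓ : Fin n ⊕ Fin (s + 1) → ℝ,
        (criticalSet n f ((w.reindex finSumFinEquiv.symm).constr ℝ ℓ)).encard = 2 := by
  obtain ⟨hmeas, hint⟩ := lintegral_lipschitzKilling hn hf hD w hw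
  rw [TransversalPair.totalAbsoluteCurvature, hint]
  have hσ := lintegral_ballWeight n s
  have hE : Nontrivial (EuclideanSpace ℝ (Fin (n + (s + 1)))) := by
    have : Nonempty (Fin (n + (s + 1))) := ⟨Fin.last _⟩
    infer_instance
  have hσ0 : (volume : Measure (EuclideanSpace ℝ (Fin (n + (s + 1))))).toSphere Set.univ ≠ 0 := by
    rw [Ne, Measure.measure_univ_eq_zero]
    exact Measure.toSphere_ne_zero _
  have hσt : (volume : Measure (EuclideanSpace ℝ (Fin (n + (s + 1))))).toSphere Set.univ ≠ ⊤ :=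
    measure_ne_top _ _
  have hcast : ∀ ℓ : Fin n ⊕ Fin (s + 1) → ℝ,
      (criticalSet n f ((w.reindex finSumFinEquiv.symm).constr ℝ ℓ)).encard = 2 ↔
      ((criticalSet n f ((w.reindex finSumFinEquiv.symm).constr ℝ ℓ)).encard : ℝ≥0∞) = 2 := by
    intro ℓ
    rw [← ENat.toENNReal_inj]
    norm_cast
  have hs0 : ((s + 1 : ℕ) : ℝ≥0∞) ≠ 0 := by simp
  have hst : ((s + 1 : ℕ) : ℝ≥0∞) ≠ ⊤ := ENNReal.natCast_ne_top _
  rw [eq_comm, ENNReal.eq_div_iff hσ0 hσt, ← hσ, eq_comm, mul_right_comm, mul_assoc,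
    ENNReal.mul_right_inj hs0 hst, mul_comm (2 : ℝ≥0∞),
      ← lintegral_mul_const _ (measurable_ballWeight n)]
  simp only [hcast]
  constructor
  · intro h
    -- The integrands are comparable and have the same finite integral, so they agree.
    refine ae_eq_of_ae_mul_ballWeight_eq (n := n) (fun c ℓ hc => ?_) ?_
    · rw [map_smul, criticalSet_smul _ hc]
    · refine ae_eq_of_ae_le_of_lintegral_le (Filter.Eventually.of_forall fun ℓ => ?_) ?_
        ((measurable_ballWeight n).aemeasurable.mul hmeas) h.le
      · refine mul_le_mul_right ?_ _
        have := two_le_encard_criticalSet hn hf ((w.reindex finSumFinEquiv.symm).constr ℝ ℓ)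
        exact_mod_cast ENat.toENNReal_le.2 this
      · rw [lintegral_mul_const _ (measurable_ballWeight n)]
        refine ENNReal.mul_ne_top (fun hi => hσt ?_) ENNReal.ofNat_ne_top
        rw [← hσ, hi, ENNReal.mul_top hs0]
  · intro h
    exact lintegral_congr_ae (h.mono fun ℓ hℓ => by simp only [hℓ])

end TotalCurvatureTwo

/-! ### Maps into an affine hyperplane -/

section Restriction

variable {n : ℕ} {M : Type*} [TopologicalSpace M] [ChartedSpace (EuclideanSpace ℝ (Fin n)) M]
  {V P : Type*} [NormedAddCommGroup V] [NormedSpace ℝ V] [FiniteDimensional ℝ V] [AddTorsor V P]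

theorem exists_continuous_retraction (L' : Submodule ℝ V) :
    ∃ π : V →L[ℝ] L', ∀ x : L', π x = x := by
  obtain ⟨π, hπ⟩ := L'.subtype.exists_leftInverse_of_injective (Submodule.ker_subtype L')
  exact ⟨LinearMap.toContinuousLinearMap π, fun x => LinearMap.congr_fun hπ x⟩

/-- Differentiation commutes with the inclusion of a subspace, for functions which need not be
differentiable: if one of the two functions is, then so is the other. -/
theorem coe_mvfderiv {L' : Submodule ℝ V} (g : M → L') (p : M) (v : TangentSpace (𝓡 n) p) :
    (mvfderiv (𝓡 n) g p v : V) = mvfderiv (𝓡 n) (fun q => (g q : V)) p v := by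
  obtain ⟨π, hπ⟩ := exists_continuous_retraction L'
  by_cases hg : MDifferentiableAt (𝓡 n) 𝓘(ℝ, L') g p
  · have h := mfderiv_comp_apply p (I := 𝓡 n) (I' := 𝓘(ℝ, L')) (I'' := 𝓘(ℝ, V))
      (L'.subtypeL.mdifferentiableAt (x := g p)) hg v
    rw [ContinuousLinearMap.mfderiv_eq] at h
    exact h.symm
  · have hg' : ¬ MDifferentiableAt (𝓡 n) 𝓘(ℝ, V) (fun q => (g q : V)) p := by
      intro h
      have he : π ∘ (fun q => (g q : V)) = g := funext fun q => hπ (g q)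
      exact hg (he ▸ (π.mdifferentiableAt (x := (g p : V))).comp p h)
    have h1 : mvfderiv (𝓡 n) g p = 0 := by
      simp [mvfderiv, mfderiv_zero_of_not_mdifferentiableAt hg]
    have h2 : mvfderiv (𝓡 n) (fun q => (g q : V)) p = 0 := by
      simp [mvfderiv, mfderiv_zero_of_not_mdifferentiableAt hg']
    rw [h1, h2]
    simp

variable {f : M → P} {L : AffineSubspace ℝ P} [Nonempty L] (hfL : ∀ p, f p ∈ L)

theorem coe_affineDeriv_codRestrict (p : M) (v : TangentSpace (𝓡 n) p) :
    (affineDeriv (n := n) (V := L.direction) (fun q => (⟨f q, hfL q⟩ : L)) p v : V) =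
      affineDeriv (V := V) f p v := by
  rw [affineDeriv, coe_mvfderiv]
  rfl

theorem IsSmoothImmersion.codRestrict (hf : IsSmoothImmersion n (V := V) f) :
    IsSmoothImmersion n (V := L.direction) (fun q => (⟨f q, hfL q⟩ : L)) := by
  obtain ⟨π, hπ⟩ := exists_continuous_retraction L.direction
  refine ⟨fun o => ?_, fun p v v' h => hf.2 p ?_⟩
  · have h1 := π.contMDiff.comp (hf.1 (o : P))
    convert h1 using 1
    funext q
    exact (hπ ((⟨f q, hfL q⟩ : L) -ᵥ o)).symm
  · rw [← coe_affineDeriv_codRestrict hfL, ← coe_affineDeriv_codRestrict hfL, h]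

theorem criticalSet_codRestrict (l : V →ₗ[ℝ] ℝ) :
    criticalSet n (fun q => (⟨f q, hfL q⟩ : L)) (l ∘ₗ L.direction.subtype) =
      criticalSet n f l := by
  ext p
  refine forall_congr' fun v => ?_
  rw [LinearMap.comp_apply, Submodule.subtype_apply, coe_affineDeriv_codRestrict]

omit [FiniteDimensional ℝ V] in
/-- The volume form induced on a hyperplane by a transversal vector is nonzero. -/
theorem restrictVolume_ne_zero {k : ℕ} {Ω : V [⋀^Fin (k + 1)]→ₗ[ℝ] ℝ}
    (hΩ : Ω ≠ 0) (hV : Module.finrank ℝ V = k + 1) {L' : Submodule ℝ V}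
    (hL : Module.finrank ℝ L' = k) {ξ : V} (hξ : ξ ∉ L') : restrictVolume Ω L' ξ ≠ 0 := by
  have : FiniteDimensional ℝ V := Module.finite_of_finrank_pos (by omega)
  set u := Module.finBasisOfFinrankEq ℝ L' hL
  have hspan : Submodule.span ℝ (Set.range fun i => (u i : V)) = L' := by
    have h := congrArg (Submodule.map L'.subtype) u.span_eq
    rwa [Submodule.map_span, ← Set.range_comp, Submodule.map_top, Submodule.range_subtype] at h
  have hli : LinearIndependent ℝ (Fin.snoc (fun i => (u i : V)) ξ : Fin (k + 1) → V) := by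
    rw [linearIndependent_finSnoc, hspan]
    exact ⟨u.linearIndependent.map' L'.subtype (Submodule.ker_subtype L'), hξ⟩
  have hb := Ω.map_basis_ne_zero_iff
    (basisOfLinearIndependentOfCardEqFinrank hli (by simp [hV]))
  rw [coe_basisOfLinearIndependentOfCardEqFinrank] at hb
  intro h0
  refine hb.2 hΩ ?_
  rw [← curryLast_apply]
  exact congrArg (fun g => g u) h0

variable [IsManifold (𝓡 n) ∞ M]

/-- Total absolute curvature `2` is inherited by `f` as a map into an affine hyperplane. -/
theorem totalAbsoluteCurvature_codRestrict_eq_two [CompactSpace M] [MeasurableSpace M]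
    [BorelSpace M] {s : ℕ} {A : EquiaffineStructure n M}
    {Ω : V [⋀^Fin (n + (s + 1 + 1))]→ₗ[ℝ] ℝ} (hn : 1 ≤ n)
    (hV : Module.finrank ℝ V = n + (s + 1 + 1)) (hΩ : Ω ≠ 0)
    (hf : IsSmoothImmersion n (V := V) f)
    (D : TransversalPair n (V := V) f (s + 1 + 1)) (hD : D.Induces A Ω)
    {S : Set (⋀[ℝ]^(n + (s + 1)) V)} (hS : IsUnitEllipsoid (k := n + (s + 1)) Ω S)
    (hτ : D.totalAbsoluteCurvature A Ω S = 2)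
    (hL : Module.finrank ℝ L.direction = n + (s + 1))
    {ΩL : L.direction [⋀^Fin (n + (s + 1))]→ₗ[ℝ] ℝ} (hΩL : ΩL ≠ 0)
    {SL : Set (⋀[ℝ]^(n + s) L.direction)} (hSL : IsUnitEllipsoid (k := n + s) ΩL SL)
    (DL : TransversalPair n (V := L.direction) (fun q => (⟨f q, hfL q⟩ : L)) (s + 1))
    (hDL : DL.Induces A ΩL) : DL.totalAbsoluteCurvature A ΩL SL = 2 := by
  -- The empty manifold has total absolute curvature `0`.
  rcases isEmpty_or_nonempty M with hM | hM
  · rw [TransversalPair.totalAbsoluteCurvature, Measure.eq_zero_of_isEmpty (volumeMeasure A.vol),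
      lintegral_zero_measure, ENNReal.zero_div] at hτ
    exact absurd hτ (by norm_num)
  obtain ⟨w, hw, rfl⟩ : ∃ w : Module.Basis (Fin (n + (s + 1 + 1))) ℝ V, Ω w = 1 ∧
      S = {φ | ∑ i, height (k := n + (s + 1)) Ω φ (w i) ^ 2 = 1} := hS.exists_basis hV hΩ
  obtain ⟨u, hu, rfl⟩ : ∃ u : Module.Basis (Fin (n + (s + 1))) ℝ L.direction, ΩL u = 1 ∧
      SL = {φ | ∑ i, height (k := n + s) ΩL φ (u i) ^ 2 = 1} := hSL.exists_basis hL hΩL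
  have hfc := hf.codRestrict hfL
  replace hτ := (totalAbsoluteCurvature_eq_two_iff hn hf hD w hw).1 hτ
  refine (totalAbsoluteCurvature_eq_two_iff hn hfc hDL u hu).2 ?_
  have hmeas := (lintegral_lipschitzKilling hn hfc hDL u hu).1
  set w' := w.reindex finSumFinEquiv.symm
  set u' := u.reindex finSumFinEquiv.symm
  set R : (Fin n ⊕ Fin (s + 1 + 1) → ℝ) →ₗ[ℝ] (Fin n ⊕ Fin (s + 1) → ℝ) :=
    LinearMap.pi fun k => LinearMap.applyₗ (u' k : V) ∘ₗ (w'.constr ℝ).toLinearMap with hR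
  have hRu : ∀ ℓ, u'.constr ℝ (R ℓ) = w'.constr ℝ ℓ ∘ₗ L.direction.subtype := by
    intro ℓ
    refine u'.ext fun k => ?_
    rw [Module.Basis.constr_basis]
    rfl
  have hRs : Function.Surjective R := by
    intro ℓ'
    obtain ⟨g, hg⟩ := (u'.constr ℝ ℓ').exists_extend
    refine ⟨fun k => g (w' k), ?_⟩
    funext k
    have h1 : w'.constr ℝ (fun k => g (w' k)) = g := Module.Basis.constr_self _ _ _
    have h2 := LinearMap.congr_fun hg (u' k)
    rw [Module.Basis.constr_basis] at h2
    rw [← h2]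
    exact LinearMap.congr_fun h1 _
  have hC : ∀ ℓ, criticalSet n (fun q => (⟨f q, hfL q⟩ : L)) (u'.constr ℝ (R ℓ)) =
      criticalSet n f (w'.constr ℝ ℓ) := fun ℓ => by
    rw [hRu, criticalSet_codRestrict]
  -- The counting function is only almost everywhere measurable: null sets are pulled back by `R`
  -- through a measurable version of it and a measurable set on which the two agree.
  obtain ⟨E, hE, hEm, hEsub⟩ := hmeas.ae_eq_mk.exists_measurable_mem
  have hERL := (ae_comp_linearMap_mem_iff R volume volume hRs hEm).2 hE
  have hset : MeasurableSet {ℓ' | hmeas.mk _ ℓ' = 2} :=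
    hmeas.measurable_mk (measurableSet_singleton 2)
  have h2 := (ae_comp_linearMap_mem_iff R volume volume hRs hset).1 (by
    filter_upwards [hτ, hERL] with ℓ h1 h2
    have h3 := hEsub _ h2
    refine h3.symm.trans ?_
    simp only [hC, h1]
    norm_cast)
  filter_upwards [h2, hmeas.ae_eq_mk] with ℓ' h3 h4
  rw [← h4] at h3
  rw [← ENat.toENNReal_inj, h3]
  norm_cast

end Restriction

/-! ### The pair cut out by a hyperplane -/

section Hyperplane

/-- On vectors of the hyperplane `ker δ`, the value of a volume form depends on its last argument
only through `δ`. -/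
theorem apply_snoc_eq {W : Type*} [AddCommGroup W] [Module ℝ W] {k : ℕ}
    (hW : Module.finrank ℝ W = k + 1) (ν : W [⋀^Fin (k + 1)]→ₗ[ℝ] ℝ) (δ : W →ₗ[ℝ] ℝ)
    {v : Fin k → W} (hv : ∀ i, δ (v i) = 0) {z z' : W} (hz : δ z = δ z') (hz0 : δ z ≠ 0) :
    ν (Fin.snoc v z) = ν (Fin.snoc v z') := by
  have : FiniteDimensional ℝ W := Module.finite_of_finrank_pos (by omega)
  -- `v` and `z - z'` are `k + 1` vectors in a subspace of dimension `k`.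
  have hlin : curryLast ν z v - curryLast ν z' v = curryLast ν (z - z') v := by
    simp [curryLast, mul_sub]
  rw [← curryLast_apply, ← curryLast_apply, ← sub_eq_zero, hlin, curryLast_apply]
  refine ν.map_linearDependent _ fun h => hz0 ?_
  have hspan := h.span_eq_top_of_card_eq_finrank' (by simp [hW])
  have hle : Submodule.span ℝ (Set.range (Fin.snoc v (z - z') : Fin (k + 1) → W)) ≤
      LinearMap.ker δ := by
    rw [Submodule.span_le]
    rintro _ ⟨i, rfl⟩
    refine Fin.lastCases ?_ (fun i => ?_) i
    · simp [hz]
    · simp [hv]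
  rw [hspan] at hle
  exact hle (Submodule.mem_top (x := z))

variable {n : ℕ} {M : Type*} [TopologicalSpace M] [ChartedSpace (EuclideanSpace ℝ (Fin n)) M]
  {V P : Type*} [NormedAddCommGroup V] [NormedSpace ℝ V] [FiniteDimensional ℝ V] [AddTorsor V P]
  {f : M → P} {L : AffineSubspace ℝ P} [Nonempty L] (hfL : ∀ p, f p ∈ L) {s : ℕ}
  (D : TransversalPair n (V := V) f (s + 1 + 1)) {δ : V →ₗ[ℝ] ℝ}

omit [FiniteDimensional ℝ V] [Nonempty L] in
theorem apply_coe_direction (hδ : LinearMap.ker δ = L.direction) (x : L.direction) : δ x = 0 :=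
  LinearMap.mem_ker.1 (hδ.ge x.2)

/-- As `df(TM)` lies in `L'`, the transversal bundle does not. -/
theorem exists_mem_N_apply_eq_one (hδ : LinearMap.ker δ = L.direction) (hδ1 : ∃ ξ, δ ξ = 1)
    (hfL : ∀ p, f p ∈ L) (p : M) : ∃ z : D.N p, δ z = 1 := by
  obtain ⟨ξ, hξ⟩ := hδ1
  have h : ξ ∈ (affineDeriv (n := n) (V := V) f p).range ⊔ D.N p := by
    rw [(D.isCompl p).sup_eq_top]
    trivial
  obtain ⟨a, ⟨v, hv⟩, b, hb, hab⟩ := Submodule.mem_sup.1 h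
  refine ⟨⟨b, hb⟩, ?_⟩
  have ha : δ a = 0 := by
    rw [← hv]
    exact (congrArg δ (coe_affineDeriv_codRestrict hfL p v)).symm.trans (apply_coe_direction hδ _)
  rw [← hξ, ← hab, map_add, ha, zero_add]

/-- The intersection of the transversal bundle with the directions of `L`. -/
def sectionN (L : AffineSubspace ℝ P) (p : M) : Submodule ℝ L.direction :=
  (D.N p).comap L.direction.subtype

/-- The inclusion of the intersection into the transversal bundle. -/
def sectionInclusion (L : AffineSubspace ℝ P) (p : M) : sectionN D L p →ₗ[ℝ] D.N p :=
  (L.direction.subtype ∘ₗ (sectionN D L p).subtype).codRestrict (D.N p) fun x => x.2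

theorem isCompl_sectionN (p : M) :
    IsCompl (affineDeriv (n := n) (V := L.direction) (fun q => (⟨f q, hfL q⟩ : L)) p).range
      (sectionN D L p) := by
  constructor
  · rw [Submodule.disjoint_def]
    rintro x ⟨v, rfl⟩ hx
    have h := Submodule.disjoint_def.1 (D.isCompl p).disjoint _
      ⟨v, (coe_affineDeriv_codRestrict hfL p v).symm⟩ hx
    exact Subtype.ext h
  · rw [codisjoint_iff, Submodule.eq_top_iff']
    intro x
    have h : (x : V) ∈ (affineDeriv (n := n) (V := V) f p).range ⊔ D.N p := by
      rw [(D.isCompl p).sup_eq_top]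
      trivial
    obtain ⟨a, ⟨v, hv⟩, b, hb, hab⟩ := Submodule.mem_sup.1 h
    set y := affineDeriv (n := n) (V := L.direction) (fun q => (⟨f q, hfL q⟩ : L)) p v
    refine Submodule.mem_sup.2 ⟨y, ⟨v, rfl⟩, x - y, ?_, by simp⟩
    change (x : V) - y ∈ D.N p
    rw [coe_affineDeriv_codRestrict hfL, ← hab, ← hv]
    simpa using hb

theorem finrank_sectionN (hfL : ∀ p, f p ∈ L) (hf : IsSmoothImmersion n (V := V) f)
    (hL : Module.finrank ℝ L.direction = n + (s + 1)) (p : M) :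
    Module.finrank ℝ (sectionN D L p) = s + 1 := by
  have h := Submodule.finrank_add_eq_of_isCompl (isCompl_sectionN hfL D p)
  have hfr : Module.finrank ℝ (TangentSpace (𝓡 n) p) = n :=
    finrank_euclideanSpace_fin (𝕜 := ℝ) (n := n)
  have h2 := LinearMap.finrank_range_of_inj (f := (affineDeriv (n := n) (V := L.direction)
    (fun q => (⟨f q, hfL q⟩ : L)) p).toLinearMap) ((hf.codRestrict hfL).2 p)
  rw [hfr] at h2
  have h3 : Module.finrank ℝ (affineDeriv (n := n) (V := L.direction)
    (fun q => (⟨f q, hfL q⟩ : L)) p).range = n := h2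
  omega

/-- Near every point there are a section `Z` of `N` with `δ Z = 1` and a frame of `N ∩ L'`, where
`L' = ker δ`: choose a member of a frame of `N` on which `δ` does not vanish, rescale it to get
`Z`, and project the other members to `ker δ` along `Z`. -/
theorem exists_smooth_frame_sectionN (hfL : ∀ p, f p ∈ L) (hf : IsSmoothImmersion n (V := V) f)
    (hL : Module.finrank ℝ L.direction = n + (s + 1))
    (hδ : LinearMap.ker δ = L.direction) (hδ1 : ∃ ξ, δ ξ = 1) (p₀ : M) :
    ∃ U : Set M, IsOpen U ∧ p₀ ∈ U ∧ ∃ Z : M → V, ∃ ξ : Fin (s + 1) → M → L.direction,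
      ContMDiffOn (𝓡 n) 𝓘(ℝ, V) ∞ Z U ∧
      (∀ i, ContMDiffOn (𝓡 n) 𝓘(ℝ, L.direction) ∞ (ξ i) U) ∧
      ∀ p ∈ U, Z p ∈ D.N p ∧ δ (Z p) = 1 ∧ LinearIndependent ℝ (fun i => ξ i p) ∧
        Submodule.span ℝ (Set.range fun i => ξ i p) = sectionN D L p := by
  obtain ⟨U, hU, hpU, Ξ, hΞs, hΞ⟩ := D.smooth_frame p₀
  obtain ⟨π, hπ⟩ := exists_continuous_retraction L.direction
  obtain ⟨j₀, hj₀⟩ : ∃ j, δ (Ξ j p₀) ≠ 0 := by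
    by_contra! h
    obtain ⟨z, hz⟩ := exists_mem_N_apply_eq_one D hδ hδ1 hfL p₀
    have hle : D.N p₀ ≤ LinearMap.ker δ := by
      rw [← (hΞ p₀ hpU).2, Submodule.span_le]
      rintro _ ⟨j, rfl⟩
      exact h j
    exact one_ne_zero (hz.symm.trans (hle z.2))
  have hδs : ∀ j, ContMDiffOn (𝓡 n) 𝓘(ℝ, ℝ) ∞ (fun p => δ (Ξ j p)) U := fun j =>
    (LinearMap.toContinuousLinearMap δ).contMDiff.comp_contMDiffOn (hΞs j)
  set U' := U ∩ (fun p => δ (Ξ j₀ p)) ⁻¹' {0}ᶜ with hU'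
  have hU'o : IsOpen U' := (hδs j₀).continuousOn.isOpen_inter_preimage hU isOpen_compl_singleton
  set Z : M → V := fun p => (δ (Ξ j₀ p))⁻¹ • Ξ j₀ p with hZ
  have hZs : ContMDiffOn (𝓡 n) 𝓘(ℝ, V) ∞ Z U' :=
    (((hδs j₀).mono Set.inter_subset_left).inv₀ fun p hp => hp.2).smul
      ((hΞs j₀).mono Set.inter_subset_left)
  set ξ : Fin (s + 1) → M → L.direction := fun i p =>
    π (Ξ (j₀.succAbove i) p - δ (Ξ (j₀.succAbove i) p) • Z p) with hξ
  refine ⟨U', hU'o, ⟨hpU, hj₀⟩, Z, ξ, hZs, fun i => ?_, fun p hp => ?_⟩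
  · refine π.contMDiff.comp_contMDiffOn (((hΞs _).mono Set.inter_subset_left).sub ?_)
    exact ((hδs _).mono Set.inter_subset_left).smul hZs
  have hp0 : δ (Ξ j₀ p) ≠ 0 := hp.2
  have hΞN : ∀ j, Ξ j p ∈ D.N p := fun j => by
    rw [← (hΞ p hp.1).2]
    exact Submodule.subset_span ⟨j, rfl⟩
  have hZN : Z p ∈ D.N p := (D.N p).smul_mem _ (hΞN j₀)
  have hZ1 : δ (Z p) = 1 := by simp [hZ, hp0]
  have hξc : ∀ i, (ξ i p : V) = Ξ (j₀.succAbove i) p - δ (Ξ (j₀.succAbove i) p) • Z p := by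
    intro i
    have hmem : Ξ (j₀.succAbove i) p - δ (Ξ (j₀.succAbove i) p) • Z p ∈ L.direction := by
      rw [← hδ, LinearMap.mem_ker, map_sub, map_smul, hZ1]
      simp
    exact congrArg Subtype.val (hπ ⟨_, hmem⟩)
  have hspan : Submodule.span ℝ (Set.range fun i => ξ i p) = sectionN D L p := by
    apply le_antisymm
    · rw [Submodule.span_le]
      rintro _ ⟨i, rfl⟩
      change (ξ i p : V) ∈ D.N p
      rw [hξc]
      exact (D.N p).sub_mem (hΞN _) ((D.N p).smul_mem _ hZN)
    · intro x hx
      set Q : V →ₗ[ℝ] V := LinearMap.id - δ.smulRight (Z p) with hQ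
      have hQx : Q x = x := by
        simp [hQ, apply_coe_direction hδ x]
      have hxs : (x : V) ∈ Submodule.span ℝ (Set.range fun j => Ξ j p) := by
        rw [(hΞ p hp.1).2]
        exact hx
      have hle : (Submodule.span ℝ (Set.range fun j => Ξ j p)).map Q ≤
          (Submodule.span ℝ (Set.range fun i => ξ i p)).map L.direction.subtype := by
        rw [Submodule.map_span_le]
        rintro _ ⟨j, rfl⟩
        rcases eq_or_ne j j₀ with rfl | hj
        · have : Q (Ξ j p) = 0 := by simp [hQ, hZ, hp0]
          simp only [this, Submodule.zero_mem]
        · obtain ⟨i, rfl⟩ := Fin.exists_succAbove_eq hj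
          exact ⟨ξ i p, Submodule.subset_span ⟨i, rfl⟩, by simp [hξc, hQ]⟩
      obtain ⟨y, hy, hyx⟩ := hle (Submodule.mem_map_of_mem (f := Q) hxs)
      rw [hQx] at hyx
      rwa [← show y = x from Subtype.ext hyx]
  refine ⟨hZN, hZ1, ?_, hspan⟩
  rw [linearIndependent_iff_card_eq_finrank_span, Set.finrank, hspan,
    finrank_sectionN D hfL hf hL, Fintype.card_fin]

/-- The volume form on `N ∩ L'` obtained from `θ^⊥` by inserting in the last slot a vector of `N` on
which `δ` takes the value `1`; see `sectionVol_apply` for the independence of its choice. -/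
def sectionVol (hδ : LinearMap.ker δ = L.direction) (hδ1 : ∃ ξ, δ ξ = 1)
    (hfL : ∀ p, f p ∈ L) (p : M) : sectionN D L p [⋀^Fin (s + 1)]→ₗ[ℝ] ℝ :=
  (curryLast (D.vol p) (exists_mem_N_apply_eq_one D hδ hδ1 hfL p).choose).compLinearMap
    (sectionInclusion D L p)

theorem sectionVol_apply (hδ : LinearMap.ker δ = L.direction) (hδ1 : ∃ ξ, δ ξ = 1)
    (p : M) (η : Fin (s + 1) → sectionN D L p) {z : D.N p} (hz : δ z = 1) :
    sectionVol D hδ hδ1 hfL p η =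
      D.vol p (Fin.snoc (fun i => sectionInclusion D L p (η i)) z) := by
  have hz' := (exists_mem_N_apply_eq_one D hδ hδ1 hfL p).choose_spec
  refine (curryLast_apply _ _ _).trans ?_
  refine apply_snoc_eq (D.finrank_N p) (D.vol p) (δ ∘ₗ (D.N p).subtype) (fun i => ?_)
    (hz'.trans hz.symm)
    (by rw [LinearMap.comp_apply, Submodule.subtype_apply, hz']; exact one_ne_zero)
  exact apply_coe_direction hδ (η i)

theorem sectionVol_ne_zero_of_linearIndependent (hδ : LinearMap.ker δ = L.direction)
    (hδ1 : ∃ ξ, δ ξ = 1) (p : M) {η : Fin (s + 1) → sectionN D L p}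
    (hη : LinearIndependent ℝ η) : sectionVol D hδ hδ1 hfL p η ≠ 0 := by
  obtain ⟨z, hz⟩ := exists_mem_N_apply_eq_one D hδ hδ1 hfL p
  rw [sectionVol_apply hfL D hδ hδ1 p η hz]
  apply TransversalPair.vol_ne_zero_of_linearIndependent
  rw [linearIndependent_finSnoc]
  constructor
  · refine hη.map' (sectionInclusion D L p) (LinearMap.ker_eq_bot.2 fun x y h => ?_)
    apply Subtype.ext
    apply Subtype.ext
    exact congrArg (fun z : D.N p => (z : V)) h
  · intro h
    have hle : Submodule.span ℝ (Set.range fun i => sectionInclusion D L p (η i)) ≤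
        LinearMap.ker (δ ∘ₗ (D.N p).subtype) := by
      rw [Submodule.span_le]
      rintro _ ⟨i, rfl⟩
      exact apply_coe_direction hδ (η i)
    exact one_ne_zero (hz.symm.trans (hle h))

/-- The pair for `f` as a map into `L` which is cut out by a pair for `f`. -/
def TransversalPair.codRestrict (hf : IsSmoothImmersion n (V := V) f)
    (hL : Module.finrank ℝ L.direction = n + (s + 1))
    (hδ : LinearMap.ker δ = L.direction) (hδ1 : ∃ ξ, δ ξ = 1) :
    TransversalPair n (V := L.direction) (fun q => (⟨f q, hfL q⟩ : L)) (s + 1) where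
  N := sectionN D L
  isCompl := isCompl_sectionN hfL D
  smooth_frame p₀ := by
    obtain ⟨U, hU, hpU, Z, ξ, -, hξs, hξ⟩ := exists_smooth_frame_sectionN D hfL hf hL hδ hδ1 p₀
    exact ⟨U, hU, hpU, ξ, hξs, fun p hp => (hξ p hp).2.2⟩
  vol := sectionVol D hδ hδ1 hfL
  vol_ne_zero p h := by
    have hb := (Module.finBasisOfFinrankEq ℝ _ (finrank_sectionN D hfL hf hL p)).linearIndependent
    refine sectionVol_ne_zero_of_linearIndependent hfL D hδ hδ1 p hb ?_
    rw [h]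
    rfl
  vol_smooth U hU η hη := by
    refine contMDiffOn_of_locally_contMDiffOn fun p₀ hp₀ => ?_
    obtain ⟨U', hU', hpU', Z, _, hZs, -, hZ⟩ := exists_smooth_frame_sectionN D hfL hf hL hδ hδ1 p₀
    refine ⟨U', hU', hpU', ?_⟩
    classical
    -- Locally, the chosen vector may be replaced by the value of a smooth section.
    set ζ : ∀ p, D.N p := fun p => if h : p ∈ U' then ⟨Z p, (hZ p h).1⟩ else 0 with hζ
    have hζc : ∀ p ∈ U', (ζ p : V) = Z p := fun p hp => by simp [hζ, hp]
    set X : Fin (s + 1 + 1) → ∀ p, D.N p := fun i p =>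
      (Fin.snoc (fun i => sectionInclusion D L p (η i p)) (ζ p) : Fin (s + 1 + 1) → D.N p) i with hX
    refine (D.vol_smooth (U ∩ U') (hU.inter hU') X fun i => ?_).congr fun p hp => ?_
    · refine Fin.lastCases ?_ (fun i => ?_) i
      · refine (hZs.mono Set.inter_subset_right).congr fun p hp => ?_
        rw [← hζc p hp.2]
        simp [hX]
      · have h1 := L.direction.subtypeL.contMDiff.comp_contMDiffOn (n := ∞)
          ((hη i).mono (Set.inter_subset_left (t := U')))
        refine h1.congr fun p hp => ?_
        simp only [hX, Fin.snoc_castSucc]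
        rfl
    · exact sectionVol_apply hfL D hδ hδ1 p _ (z := ζ p) (by rw [hζc p hp.2]; exact (hZ p hp.2).2.1)

variable [IsManifold (𝓡 n) ∞ M]

/-- The pair cut out by `L` induces the same equiaffine structure as the original pair, for the
volume form `Ω (…, ξ)` on `L`. -/
theorem TransversalPair.Induces.codRestrict {D : TransversalPair n (V := V) f (s + 1 + 1)}
    {A : EquiaffineStructure n M} {Ω : V [⋀^Fin (n + (s + 1 + 1))]→ₗ[ℝ] ℝ} (hD : D.Induces A Ω)
    (hV : Module.finrank ℝ V = n + (s + 1 + 1))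
    (hf : IsSmoothImmersion n (V := V) f)
    (hL : Module.finrank ℝ L.direction = n + (s + 1))
    (hδ : LinearMap.ker δ = L.direction) {ξ : V} (hξ : δ ξ = 1) :
    (TransversalPair.codRestrict hfL D hf hL hδ ⟨ξ, hξ⟩).Induces A
      (restrictVolume (k := n + (s + 1)) Ω L.direction ξ) where
  gauss Y hY p v := by
    change (((_ : L.direction) - _ : L.direction) : V) ∈ D.N p
    rw [Submodule.coe_sub, coe_mvfderiv, coe_affineDeriv_codRestrict hfL]
    simp only [coe_affineDeriv_codRestrict hfL]
    exact hD.gauss Y hY p v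
  volume_eq p X η hη := by
    obtain ⟨z, hz⟩ := exists_mem_N_apply_eq_one D hδ ⟨ξ, hξ⟩ hfL p
    refine eq_div_of_mul_eq (sectionVol_ne_zero_of_linearIndependent hfL D hδ ⟨ξ, hξ⟩ p hη) ?_
    refine (congrArg _ (sectionVol_apply hfL D hδ ⟨ξ, hξ⟩ p η hz)).trans ?_
    rw [← hD.apply_append]
    refine Eq.trans ?_ (curryLast_apply (k := n + (s + 1)) Ω ξ _).symm
    refine Eq.trans ?_ (apply_snoc_eq (k := n + (s + 1)) hV Ω δ (fun i => apply_coe_direction hδ _)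
      (hz.trans hξ.symm) (by rw [hz]; exact one_ne_zero))
    congr 1
    have h1 := snoc_append (fun i => affineDeriv (V := V) f p (X i))
      (fun j => ((η j : L.direction) : V)) (z : V)
    refine Eq.trans ?_ (h1.symm.trans ?_)
    · congr 1
      funext j
      refine Fin.lastCases ?_ (fun j => ?_) j
      · simp
      · simp
        rfl
    · congr 1
      funext j
      refine Fin.addCases (fun j => ?_) (fun j => ?_) j
      · simp [coe_affineDeriv_codRestrict hfL]
      · simp

end Hyperplane

end Equiaffine

end

theorem proposition3p3 {n s : ℕ} (hn : 1 ≤ n)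
    {M : Type*} [TopologicalSpace M] [T2Space M] [CompactSpace M]
    [ChartedSpace (EuclideanSpace ℝ (Fin n)) M] [IsManifold (𝓡 n) ∞ M]
    [MeasurableSpace M] [BorelSpace M]
    (A : EquiaffineStructure n M)
    -- the ambient space has dimension `n + r` with `r = s + 2`
    (Ω : (EuclideanSpace ℝ (Fin (n + (s + 2)))) [⋀^Fin (n + (s + 2))]→ₗ[ℝ] ℝ)
    (f : M → EuclideanSpace ℝ (Fin (n + (s + 2))))
    (hf : IsEquiaffineImmersion A Ω f)
    (D : TransversalPair n f (s + 2)) (hD : D.Induces A Ω)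
    (S : Set (⋀[ℝ]^(n + (s + 1)) (EuclideanSpace ℝ (Fin (n + (s + 2))))))
    (hS : IsUnitEllipsoid Ω S)
    (hτ : D.totalAbsoluteCurvature A Ω S = 2)
    (L : AffineSubspace ℝ (EuclideanSpace ℝ (Fin (n + (s + 2))))) [Nonempty L]
    (hL : Module.finrank ℝ L.direction = n + (s + 1))
    (hfL : ∀ p, f p ∈ L)
    (ξ : EuclideanSpace ℝ (Fin (n + (s + 2)))) (hξ : ξ ∉ L.direction) :
    IsEquiaffineImmersion (r := s + 1) A (restrictVolume Ω L.direction ξ)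
        (fun p => (⟨f p, hfL p⟩ : L)) ∧
      ∀ S_L : Set (⋀[ℝ]^(n + s) L.direction),
        IsUnitEllipsoid (restrictVolume Ω L.direction ξ) S_L →
        ∀ D_L : TransversalPair n (V := L.direction) (fun p => (⟨f p, hfL p⟩ : L)) (s + 1),
          D_L.Induces A (restrictVolume Ω L.direction ξ) →
            D_L.totalAbsoluteCurvature A (restrictVolume Ω L.direction ξ) S_L = 2 := by
  have hV : Module.finrank ℝ (EuclideanSpace ℝ (Fin (n + (s + 2)))) = n + (s + 1 + 1) :=
    finrank_euclideanSpace_fin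
  refine ⟨?_, fun S_L hS_L D_L hD_L => ?_⟩
  · -- Normalize a linear form which vanishes on `L'` but not at `ξ`.
    obtain ⟨δ₀, hδ₀, hle⟩ := Submodule.exists_le_ker_of_notMem hξ
    have hδξ : ((δ₀ ξ)⁻¹ • δ₀) ξ = 1 := by simp [hδ₀]
    have hker : L.direction ≤ LinearMap.ker ((δ₀ ξ)⁻¹ • δ₀) := fun x hx => by
      have : δ₀ x = 0 := hle hx
      simp [this]
    have hδ : LinearMap.ker ((δ₀ ξ)⁻¹ • δ₀) = L.direction := by
      refine (Submodule.eq_of_le_of_finrank_le hker ?_).symm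
      have h := Submodule.finrank_lt (s := LinearMap.ker ((δ₀ ξ)⁻¹ • δ₀)) fun htop => by
        have : ξ ∈ LinearMap.ker ((δ₀ ξ)⁻¹ • δ₀) := htop ▸ Submodule.mem_top
        exact one_ne_zero (hδξ.symm.trans this)
      omega
    exact ⟨restrictVolume_ne_zero hf.1 hV hL hξ, hf.2.1.codRestrict hfL,
      TransversalPair.codRestrict hfL D hf.2.1 hL hδ ⟨ξ, hδξ⟩,
      hD.codRestrict hfL hV hf.2.1 hL hδ hδξ⟩
  · exact totalAbsoluteCurvature_codRestrict_eq_two hfL hn hV hf.1 hf.2.1 D hD hS hτ hL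
      (restrictVolume_ne_zero hf.1 hV hL hξ) hS_L D_L hD_L
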